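/- Fix $r_+>0$, $\Lambda<0$ and $-\frac94<\alpha<0$. Write $\ell=-\frac{\Lambda}{3}$, $\Delta=\sqrt{\frac94+\alpha}$, $M_{e=0}=\frac{r_+}{2}(1+\ell r_+^2)$, $M_0=r_++2\ell r_+^3$, and for $M\in(M_{e=0},M_0)$ let $e=e(M)>0$ be given by $1-\frac{2M}{r_+}+\frac{e^2}{r_+^2}+\ell r_+^2=0$. Put $$\Omega_{RN,M}^2=1-\frac{2M}{r}+\frac{e^2}{r^2}+\ell r^2,\qquad A_{RN,M}=e\Big(\frac1{r_+}-\frac1r\Big),\qquad K_+=\frac{M}{r_+^2}-\frac{e^2}{r_+^3}+\ell r_+ .$$ A function $\phi$ on $(r_+,\infty)$ satisfies the Dirichlet condition if $r^{\frac32-\Delta}\phi\to0$ as $r\to\infty$. For $q_0\in\mathbb R$ call $M$ a *linear hair mass* if there is a non-zero bounded $C^2$ function $\phi$ on $(r_+,\infty)$, with a limit at $r_+$ and satisfying the Dirichlet condition, such that $$\frac{d}{dr}\Big(r^2\Omega_{RN,M}^2\frac{d\phi}{dr}\Big)=\Big(\ell\alpha-\frac{q_0^2A_{RN,M}^2}{\Omega_{RN,M}^2}\Big)r^2\phi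 .$$ For a reference mass $M_c$ let $X$ be the space of $f\in C^2(r_+,\infty)$ with $$\|f\|_X=\big\|r^{\frac32+\Delta}f\big\|_\infty+\big\|r^{\frac52+\Delta}f'\big\|_\infty+\big\|r^{\frac32+\Delta}\Omega_{RN,M_c}^2f''\big\|_\infty<\infty$$ (sup norms over $(r_+,\infty)$), and let $X_\delta=\{f\in X:\|f\|_X<\delta\}$. Given $f\in X$, $\epsilon>0$ and $M$, a *background with horizon mass $M$ sourced by $f$* is a solution $(\kappa,\Omega^2,\varpi,Q,A)$ on $(r_+,\infty)$, with $\kappa,\Omega^2>0$, of $$\kappa^{-1}\kappa'=r f'^2+q_0^2r\kappa^2\Big(\frac{A}{\Omega^2}\Big)^2f^2,\qquad \Omega^2\kappa^{-2}=1-\frac{2\varpi}{r}+\frac{Q^2}{r^2}+\ell r^2,$$ $$\varpi'=\ell\alpha\frac{r^2f^2}{2}+\frac{r^2f'^2}{2}\Omega^2\kappa^{-2}+\frac{q_0^2A^2r^2f^2}{2\Omega^2}+q_0^2Qr\frac{A}{\Omega^2}\kappa f^2,\qquad Q'=q_0^2r^2\kappa\frac{A}{\Omega^2}f^2,\qquad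 A'=\frac{Q\kappa}{r^2},$$ such that, as $r\to r_+$, $\varpi\to M$, $Q\to e(M)$, $\kappa^{-1}\to1-\frac{\ell\alpha r_+}{2K_+}\epsilon^2$, $\Omega^2\to0$, $A\to0$, and, if $f\to\epsilon$ as $r\to r_+$, also $\frac{A}{\Omega^2}\to\frac{e}{2K_+r_+^2}$ and $(\Omega^2)'\to2K_+\kappa(r_+)$. Call $M$ a *hair mass for $(f,\epsilon)$* if there are such a background and a bounded $C^2$ function $\phi$ on $(r_+,\infty)$ satisfying the Dirichlet condition, with $\phi\to\epsilon$ as $r\to r_+$ (and $\phi'\to\frac{\ell\alpha\epsilon}{2K_+}\kappa(r_+)$ if $f\to\epsilon$), which solves $$\frac{d}{dr}\Big(r^2\Omega^2\kappa^{-1}\frac{d\phi}{dr}\Big)=\Big(\ell\alpha-\frac{q_0^2A^2}{\Omega^2}\Big)r^2\kappa\,\phi .$$ **Theorem.** 1. (Large charge case) For every $M_b\in(M_{e=0},M_0)$ there is $q_1>0$ such that for every $q_0$ with $|q_0|>q_1$, statement $(\ast)$ holds with $s=M_b$. 2. (Fixed charge case) Let $q_0\in\mathbb R$ satisfy $\alpha<-\frac32+\frac{q_0^2}{2\ell}$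 and $\ell r_+^2>R_0$, where $R_0$ is the positive root of $$24\Big(\alpha+\tfrac32-\tfrac{q_0^2}{2\ell}\Big)x^2+\Big(4\big(\alpha+\tfrac32-\tfrac{q_0^2}{2\ell}\big)-\tfrac{2q_0^2}{\ell}+6\Big)x+1=0 .$$ Then $(\ast)$ holds with $s=M_0$. Here $(\ast)$ is the statement: there is a linear hair mass in $(M_{e=0},s)$; and for every linear hair mass $M_c\in(M_{e=0},s)$ there are $\delta_0,\epsilon_0,C>0$ such that for all $0<\delta<\delta_0$, $0<\epsilon<\epsilon_0$ and $f\in X_\delta$ there is a hair mass $M_c^f\in(M_{e=0},s)$ for $(f,\epsilon)$ with $$|M_c^f-M_c|\le C\|f\|_X^2 .$$ -/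

import Mathlib

open Set Filter Topology

noncomputable section

namespace HairyBH

/-- `-Λ/3`, the inverse square of the AdS radius. -/
def adsConst (Λ : ℝ) : ℝ := -Λ / 3

/-- `Δ = √(9/4 + α)`. -/
def Del (α : ℝ) : ℝ := √(9 / 4 + α)

/-- The mass `M_{e=0}` of the Schwarzschild-AdS black hole of horizon radius `rp`. -/
def massNeutral (rp Λ : ℝ) : ℝ := rp / 2 * (1 + adsConst Λ * rp ^ 2)

/-- The mass `M_0` of the extremal Reissner–Nordström-AdS black hole of horizon radius `rp`. -/
def massExtremal (rp Λ : ℝ) : ℝ := rp + 2 * adsConst Λ * rp ^ 3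

/-- The charge `e ≥ 0` for which `rp` is a root of the Reissner–Nordström-AdS function of mass `M`,
that is `1 - 2M/rp + e²/rp² + (-Λ/3) rp² = 0`. -/
def chargeRN (rp Λ M : ℝ) : ℝ := √(2 * M * rp - rp ^ 2 - adsConst Λ * rp ^ 4)

/-- `Ω_RN²` for the parameters `(M, rp, Λ)`. -/
def OmegaRN (rp Λ M r : ℝ) : ℝ :=
  1 - 2 * M / r + chargeRN rp Λ M ^ 2 / r ^ 2 + adsConst Λ * r ^ 2

/-- `A_RN = e (1/rp - 1/r)`. -/
def potentialRN (rp Λ M r : ℝ) : ℝ := chargeRN rp Λ M * (1 / rp - 1 / r)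

/-- The surface gravity `K₊ = M/rp² - e²/rp³ + (-Λ/3) rp`. -/
def surfaceGravity (rp Λ M : ℝ) : ℝ :=
  M / rp ^ 2 - chargeRN rp Λ M ^ 2 / rp ^ 3 + adsConst Λ * rp

/-- The prescribed horizon value `1 - (-Λ/3) α rp ε² / (2 K₊)` of `κ⁻¹`. -/
def kappaInvHorizon (rp Λ α ε M : ℝ) : ℝ :=
  1 - adsConst Λ * α * rp / (2 * surfaceGravity rp Λ M) * ε ^ 2

/-- The left-hand side of the quadratic equation whose positive root is `R₀`. -/
def quadR0 (Λ α q₀ x : ℝ) : ℝ :=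
  24 * (α + 3 / 2 - q₀ ^ 2 / (2 * adsConst Λ)) * x ^ 2
    + (4 * (α + 3 / 2 - q₀ ^ 2 / (2 * adsConst Λ)) - 2 * q₀ ^ 2 / adsConst Λ + 6) * x + 1

/-- The Dirichlet boundary condition at infinity: `r^{3/2 - Δ} φ → 0`. -/
def Dirichlet (α : ℝ) (φ : ℝ → ℝ) : Prop :=
  Tendsto (fun r : ℝ => r ^ (3 / 2 - Del α) * φ r) atTop (𝓝 0)

/-- `φ` is a non-zero bounded stationary spherically symmetric solution of the Klein–Gordon equation
on the Reissner–Nordström-AdS exterior with parameters `(M, rp, Λ)`, extending continuously to the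
horizon and satisfying the Dirichlet condition. -/
structure IsLinearHair (rp Λ α q₀ M : ℝ) (φ : ℝ → ℝ) : Prop where
  contDiff : ContDiffOn ℝ 2 φ (Ioi rp)
  equation : ∀ r ∈ Ioi rp,
    HasDerivAt (fun s => s ^ 2 * OmegaRN rp Λ M s * deriv φ s)
      ((adsConst Λ * α - q₀ ^ 2 * potentialRN rp Λ M r ^ 2 / OmegaRN rp Λ M r) * r ^ 2 * φ r) r
  bounded : ∃ B : ℝ, ∀ r ∈ Ioi rp, |φ r| ≤ B
  horizon : ∃ a : ℝ, Tendsto φ (𝓝[>] rp) (𝓝 a)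
  dirichlet : Dirichlet α φ
  nonzero : ∃ r ∈ Ioi rp, φ r ≠ 0

/-- First weighted quantity in `‖f‖_X`. -/
def weight0 (α : ℝ) (f : ℝ → ℝ) (r : ℝ) : ℝ := r ^ (3 / 2 + Del α) * f r

/-- Second weighted quantity in `‖f‖_X`. -/
def weight1 (α : ℝ) (f : ℝ → ℝ) (r : ℝ) : ℝ := r ^ (5 / 2 + Del α) * deriv f r

/-- Third weighted quantity in `‖f‖_X`; the weight is `Ω_RN²` of the reference mass `Mref`. -/
def weight2 (rp Λ α Mref : ℝ) (f : ℝ → ℝ) (r : ℝ) : ℝ :=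
  r ^ (3 / 2 + Del α) * OmegaRN rp Λ Mref r * deriv (deriv f) r

/-- Sup norm on `(rp, ∞)`, meaningful for bounded functions. -/
def supNorm (rp : ℝ) (g : ℝ → ℝ) : ℝ := ⨆ r : Ioi rp, |g r|

/-- `f ∈ X`: `f` is `C²` on `(rp, ∞)` and `‖f‖_X < ∞`. This space is already complete: a Cauchy
sequence converges locally uniformly on `(rp, ∞)` together with its first two derivatives. -/
structure MemX (rp Λ α Mref : ℝ) (f : ℝ → ℝ) : Prop where
  contDiff : ContDiffOn ℝ 2 f (Ioi rp)
  bdd0 : BddAbove (range fun r : Ioi rp => |weight0 α f r|)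
  bdd1 : BddAbove (range fun r : Ioi rp => |weight1 α f r|)
  bdd2 : BddAbove (range fun r : Ioi rp => |weight2 rp Λ α Mref f r|)

/-- `‖f‖_X`. -/
def normX (rp Λ α Mref : ℝ) (f : ℝ → ℝ) : ℝ :=
  supNorm rp (weight0 α f) + supNorm rp (weight1 α f) + supNorm rp (weight2 rp Λ α Mref f)

/-- The ball `X_δ`. -/
def ballX (rp Λ α Mref δ : ℝ) : Set (ℝ → ℝ) :=
  {f | MemX rp Λ α Mref f ∧ normX rp Λ α Mref f < δ}

/-- `(κ, Ω², ϖ, Q, A)` solves on `(rp, ∞)` the background equations sourced by `f`, with horizon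
mass `M` and the characteristic initial data with parameter `ε`.

The data `ϖ, Q, κ, A` at the horizon determine the solution, hence also the horizon limits of
`A/Ω²` and of `dΩ²/dr`; these equal `e/(2K₊ rp²)` and `2K₊ κ(rp)` when `f(rp) = ε`. -/
structure IsBackground (rp Λ α q₀ ε M : ℝ) (f κ Ω2 ϖ Q A : ℝ → ℝ) : Prop where
  kappa_pos : ∀ r ∈ Ioi rp, 0 < κ r
  omega_pos : ∀ r ∈ Ioi rp, 0 < Ω2 r
  kappa_eq : ∀ r ∈ Ioi rp,
    HasDerivAt κ (κ r * (r * deriv f r ^ 2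
      + q₀ ^ 2 * r * κ r ^ 2 * (A r / Ω2 r) ^ 2 * f r ^ 2)) r
  omega_eq : ∀ r ∈ Ioi rp,
    Ω2 r / κ r ^ 2 = 1 - 2 * ϖ r / r + Q r ^ 2 / r ^ 2 + adsConst Λ * r ^ 2
  varpi_eq : ∀ r ∈ Ioi rp,
    HasDerivAt ϖ (adsConst Λ * α * (r ^ 2 * f r ^ 2 / 2)
      + r ^ 2 * deriv f r ^ 2 / 2 * (Ω2 r / κ r ^ 2)
      + q₀ ^ 2 * A r ^ 2 * r ^ 2 * f r ^ 2 / (2 * Ω2 r)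
      + q₀ ^ 2 * Q r * r * (A r / Ω2 r) * κ r * f r ^ 2) r
  charge_eq : ∀ r ∈ Ioi rp,
    HasDerivAt Q (q₀ ^ 2 * r ^ 2 * κ r * (A r / Ω2 r) * f r ^ 2) r
  potential_eq : ∀ r ∈ Ioi rp, HasDerivAt A (Q r * κ r / r ^ 2) r
  varpi_horizon : Tendsto ϖ (𝓝[>] rp) (𝓝 M)
  charge_horizon : Tendsto Q (𝓝[>] rp) (𝓝 (chargeRN rp Λ M))
  kappa_horizon : Tendsto (fun r => (κ r)⁻¹) (𝓝[>] rp) (𝓝 (kappaInvHorizon rp Λ α ε M))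
  omega_horizon : Tendsto Ω2 (𝓝[>] rp) (𝓝 0)
  potential_horizon : Tendsto A (𝓝[>] rp) (𝓝 0)
  gauge_potential : Tendsto f (𝓝[>] rp) (𝓝 ε) →
    Tendsto (fun r => A r / Ω2 r) (𝓝[>] rp)
      (𝓝 (chargeRN rp Λ M / (2 * surfaceGravity rp Λ M * rp ^ 2)))
  gauge_omega : Tendsto f (𝓝[>] rp) (𝓝 ε) →
    Tendsto (deriv Ω2) (𝓝[>] rp)
      (𝓝 (2 * surfaceGravity rp Λ M * (kappaInvHorizon rp Λ α ε M)⁻¹))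

/-- `φ` is a bounded solution, with horizon value `ε` and satisfying the Dirichlet condition, of the
stationary Klein–Gordon equation on the background `(κ, Ω², A)`. The last field is the
prescribed initial value of `dφ/dr`, which is the one selected by regularity when `f(rp) = ε`. -/
structure IsPerturbedHair (rp Λ α q₀ ε M : ℝ) (f κ Ω2 A φ : ℝ → ℝ) : Prop where
  contDiff : ContDiffOn ℝ 2 φ (Ioi rp)
  equation : ∀ r ∈ Ioi rp,
    HasDerivAt (fun s => s ^ 2 * Ω2 s * (κ s)⁻¹ * deriv φ s)
      ((adsConst Λ * α - q₀ ^ 2 * A r ^ 2 / Ω2 r) * r ^ 2 * κ r * φ r) r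
  bounded : ∃ B : ℝ, ∀ r ∈ Ioi rp, |φ r| ≤ B
  dirichlet : Dirichlet α φ
  horizon : Tendsto φ (𝓝[>] rp) (𝓝 ε)
  horizon_deriv : Tendsto f (𝓝[>] rp) (𝓝 ε) →
    Tendsto (deriv φ) (𝓝[>] rp)
      (𝓝 (adsConst Λ * α * ε / (2 * surfaceGravity rp Λ M) * (kappaInvHorizon rp Λ α ε M)⁻¹))

/-- `M` is a horizon mass for which the background equations sourced by `f` have a solution on
`(rp, ∞)` carrying a bounded stationary solution under the Dirichlet condition. -/
def IsPerturbedHairMass (rp Λ α q₀ ε : ℝ) (f : ℝ → ℝ) (M : ℝ) : Prop :=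
  ∃ κ Ω2 ϖ Q A : ℝ → ℝ, IsBackground rp Λ α q₀ ε M f κ Ω2 ϖ Q A ∧
    ∃ φ : ℝ → ℝ, IsPerturbedHair rp Λ α q₀ ε M f κ Ω2 A φ

/-- `M` is a mass for which the unperturbed problem has a stationary solution. -/
def IsLinearHairMass (rp Λ α q₀ M : ℝ) : Prop :=
  ∃ φ : ℝ → ℝ, IsLinearHair rp Λ α q₀ M φ

end HairyBH

end

/-! Everything reduces to one radial equation `(r U φ')' = q φ` with `U = rΩ²/κ`, which vanishes
linearly at the horizon. Set `σ = 3/2 - Δ` and `y = r^σ φ`. Since `α = σ² - 3σ`, the leading part of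
the potential for `y` cancels at infinity, and the solution regular at the horizon satisfies a
Volterra equation whose kernel decays like `r^{-1-Δ}`. It can be solved uniformly on the whole
exterior (`IsRadialCoef.exists_regularSol`), it depends in a Lipschitz way on `U'` and `q`
(`exists_regularSol_lipschitz`), and `y` has a limit `F` at infinity. The Dirichlet condition says
`F = 0`. Bounded linear hair that extends continuously to the horizon is a multiple of this
solution, because the other solution diverges logarithmically there
(`exists_regularSol_of_solution`).

Existence of linear hair is a continuity argument in the charge `e`. At `e = 0` the regular solution
is positive and `F ≠ 0`: by the Breitenlohner–Freedman bound `α > -9/4`, `r^{3/2} φ` is monotone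
(`neutral_pos_and_not_dirichlet`). If no smaller charge were Dirichlet, positivity would be both a
closed and an open condition up to the final charge (`exists_dirichlet_charge`). Positivity does
fail at some charge, by Picone's identity with an explicit test function: a sine on `[2rp, 3rp]`
when `|q₀|` is large, and `ξ^{-1/2} sin(k log ξ)` with `ξ = r - rp` near extremality. The second
works when the effective near-horizon mass violates the two-dimensional Breitenlohner–Freedman
bound, which is exactly `quadR0 < 0` at `ℓ rp²`.

Persistence rests on transversality (`exists_transversality`). Put `t = e² - e₀²`. The Wronskian of
the solution at `e` with a Dirichlet solution at `e₀` is zero at the horizon and tends to a constant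
times `F` at infinity. Increasing `e²` decreases both `U` and `q`, so the two terms in the
derivative of the Wronskian have the same sign to leading order, and `F` crosses zero with nonzero
slope in `t`.

A field `f` of size `‖f‖_X` changes the background by `O(‖f‖_X²)`. In the gauge `κ(∞) = 1` the
background is determined by the single function `w = r² κ A/Ω²`, found by a contraction
(`exists_background`); a constant rescaling then gives the prescribed horizon value of `κ`
(`IsNormalizedBg.isBackground`). The zero of `F` therefore survives with `|t| = O(‖f‖_X²)` by the
intermediate value theorem (`exists_dirichlet_perturbation`), and the horizon mass is affine in
`e²`. -/

noncomputable section

namespace HairyBH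

open MeasureTheory

/-! ### Locally bounded integrands and their primitives. -/

/-- `g` is continuous on `(a, ∞)` and bounded on every `(a, b]`. -/
structure LocBdd (a : ℝ) (g : ℝ → ℝ) : Prop where
  cont : ContinuousOn g (Ioi a)
  bdd : ∀ b, ∃ K, ∀ s ∈ Ioc a b, |g s| ≤ K

namespace LocBdd

variable {a : ℝ} {g h : ℝ → ℝ}

lemma of_continuousOn (hg : ContinuousOn g (Ici a)) : LocBdd a g := by
  refine ⟨hg.mono Ioi_subset_Ici_self, fun b => ?_⟩
  obtain ⟨K, hK⟩ := (isCompact_Icc (a := a) (b := b)).exists_bound_of_continuousOn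
    (hg.mono Icc_subset_Ici_self)
  exact ⟨K, fun s hs => hK s ⟨hs.1.le, hs.2⟩⟩

lemma const (c : ℝ) : LocBdd a fun _ => c := of_continuousOn continuousOn_const

lemma mul (hg : LocBdd a g) (hh : LocBdd a h) : LocBdd a fun s => g s * h s := by
  refine ⟨hg.cont.mul hh.cont, fun b => ?_⟩
  obtain ⟨K, hK⟩ := hg.bdd b
  obtain ⟨K', hK'⟩ := hh.bdd b
  refine ⟨K * K', fun s hs => ?_⟩
  rw [abs_mul]
  exact mul_le_mul (hK s hs) (hK' s hs) (abs_nonneg _) ((abs_nonneg _).trans (hK s hs))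

lemma add (hg : LocBdd a g) (hh : LocBdd a h) : LocBdd a fun s => g s + h s := by
  refine ⟨hg.cont.add hh.cont, fun b => ?_⟩
  obtain ⟨K, hK⟩ := hg.bdd b
  obtain ⟨K', hK'⟩ := hh.bdd b
  exact ⟨K + K', fun s hs => (abs_add_le _ _).trans (add_le_add (hK s hs) (hK' s hs))⟩

lemma neg (hg : LocBdd a g) : LocBdd a fun s => -g s := by
  refine ⟨hg.cont.neg, fun b => ?_⟩
  obtain ⟨K, hK⟩ := hg.bdd b
  exact ⟨K, fun s hs => by rw [abs_neg]; exact hK s hs⟩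

lemma sub (hg : LocBdd a g) (hh : LocBdd a h) : LocBdd a fun s => g s - h s := by
  simpa [sub_eq_add_neg] using hg.add hh.neg

lemma pow (hg : LocBdd a g) (n : ℕ) : LocBdd a fun s => g s ^ n := by
  induction n with
  | zero => simpa using const 1
  | succ n ih => simpa [pow_succ] using ih.mul hg

lemma of_le (hg : ContinuousOn g (Ioi a)) (hh : LocBdd a h) (hle : ∀ s ∈ Ioi a, |g s| ≤ h s) :
    LocBdd a g := by
  refine ⟨hg, fun b => ?_⟩
  obtain ⟨K, hK⟩ := hh.bdd b
  exact ⟨K, fun s hs => (hle s hs.1).trans ((le_abs_self _).trans (hK s hs))⟩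

lemma rpow (ha : 0 < a) (p : ℝ) : LocBdd a fun s => s ^ p :=
  of_continuousOn fun s hs => (Real.continuousAt_rpow_const s p
    (Or.inl (ha.trans_le hs).ne')).continuousWithinAt

lemma intervalIntegrable (hg : LocBdd a g) {x y : ℝ} (hx : a ≤ x) (hy : a ≤ y) :
    IntervalIntegrable g volume x y := by
  have key : ∀ z, a ≤ z → IntervalIntegrable g volume a z := by
    intro z hz
    rw [intervalIntegrable_iff_integrableOn_Ioc_of_le hz]
    obtain ⟨K, hK⟩ := hg.bdd z
    have hm : AEStronglyMeasurable g (volume.restrict (Ioc a z)) :=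
      (hg.cont.mono Ioc_subset_Ioi_self).aestronglyMeasurable measurableSet_Ioc
    refine Integrable.mono' (g := fun _ => K) (by simp) hm ?_
    exact (ae_restrict_iff' measurableSet_Ioc).2 (ae_of_all _ fun s hs => hK s hs)
  exact (key x hx).symm.trans (key y hy)

lemma hasDerivAt (hg : LocBdd a g) {r : ℝ} (hr : a < r) :
    HasDerivAt (fun u => ∫ s in a..u, g s) (g r) r :=
  intervalIntegral.integral_hasDerivAt_right (hg.intervalIntegrable le_rfl hr.le)
    (hg.cont.stronglyMeasurableAtFilter isOpen_Ioi r hr) (hg.cont.continuousAt (Ioi_mem_nhds hr))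

lemma continuousOn_primitive (hg : LocBdd a g) :
    ContinuousOn (fun u => ∫ s in a..u, g s) (Ici a) := by
  intro r hr
  have h1 := intervalIntegral.continuousOn_primitive_interval'
    (hg.intervalIntegrable le_rfl ((show a ≤ r from hr).trans (by linarith : r ≤ r + 1)))
    (left_mem_uIcc)
  rw [uIcc_of_le (by linarith [show a ≤ r from hr])] at h1
  refine (h1 r ⟨hr, by linarith⟩).mono_of_mem_nhdsWithin ?_
  rw [← Ici_inter_Iic]
  exact inter_mem_nhdsWithin _ (Iic_mem_nhds (by linarith))

lemma primitive (hg : LocBdd a g) : LocBdd a fun u => ∫ s in a..u, g s :=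
  of_continuousOn hg.continuousOn_primitive

lemma tendsto_primitive (hg : LocBdd a g) :
    Tendsto (fun u => ∫ s in a..u, g s) (𝓝[>] a) (𝓝 0) := by
  have := (hg.continuousOn_primitive a self_mem_Ici).mono_left
    (nhdsWithin_mono a Ioi_subset_Ici_self)
  simpa [ContinuousWithinAt] using this

lemma abs_integral_le (hh : LocBdd a h) {r : ℝ} (hr : a ≤ r)
    (hle : ∀ s ∈ Ioc a r, |g s| ≤ h s) : |∫ s in a..r, g s| ≤ ∫ s in a..r, h s := by
  rw [← Real.norm_eq_abs]
  exact intervalIntegral.norm_integral_le_of_norm_le hr (ae_of_all _ fun s hs => hle s hs)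
    (hh.intervalIntegrable le_rfl hr)

lemma integral_mono (hg : LocBdd a g) (hh : LocBdd a h) {r : ℝ} (hr : a ≤ r)
    (hle : ∀ s ∈ Ioc a r, g s ≤ h s) : ∫ s in a..r, g s ≤ ∫ s in a..r, h s := by
  rw [intervalIntegral.integral_of_le hr, intervalIntegral.integral_of_le hr]
  refine setIntegral_mono_on ?_ ?_ measurableSet_Ioc hle
  · exact (intervalIntegrable_iff_integrableOn_Ioc_of_le hr).1 (hg.intervalIntegrable le_rfl hr)
  · exact (intervalIntegrable_iff_integrableOn_Ioc_of_le hr).1 (hh.intervalIntegrable le_rfl hr)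

/-- Only a one-sided limit of `F` at `a` is needed. Integrands here need not extend continuously to
the horizon, so this replaces the usual fundamental theorem throughout. -/
lemma integral_eq (hg : LocBdd a g) {F : ℝ → ℝ} {r c : ℝ} (hr : a < r)
    (hF : ∀ s ∈ Ioi a, HasDerivAt F (g s) s) (hc : Tendsto F (𝓝[>] a) (𝓝 c)) :
    ∫ s in a..r, g s = F r - c :=
  intervalIntegral.integral_eq_sub_of_hasDerivAt_of_tendsto hr (fun s hs => hF s hs.1)
    (hg.intervalIntegrable le_rfl hr.le) hc
    ((hF r hr).continuousAt.tendsto.mono_left nhdsWithin_le_nhds)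

/-- An integral is estimated by the increment of a primitive of a majorant. -/
lemma abs_integral_le_sub {F f : ℝ → ℝ} {r : ℝ} (hr : a ≤ r)
    (hF : ∀ s ∈ Ici a, HasDerivAt F (f s) s) (hf : ContinuousOn f (Ici a))
    (hle : ∀ s ∈ Ioc a r, |g s| ≤ f s) : |∫ s in a..r, g s| ≤ F r - F a := by
  refine ((of_continuousOn hf).abs_integral_le hr hle).trans_eq ?_
  refine intervalIntegral.integral_eq_sub_of_hasDerivAt (fun s hs => hF s ?_) ?_
  · rw [uIcc_of_le hr] at hs; exact hs.1
  · exact (of_continuousOn hf).intervalIntegrable le_rfl hr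

lemma sub_le_integral (hg : LocBdd a g) {F f : ℝ → ℝ} {r : ℝ} (hr : a ≤ r)
    (hF : ∀ s ∈ Ici a, HasDerivAt F (f s) s) (hf : ContinuousOn f (Ici a))
    (hle : ∀ s ∈ Ioc a r, f s ≤ g s) : F r - F a ≤ ∫ s in a..r, g s := by
  refine le_trans (le_of_eq ?_) ((of_continuousOn hf).integral_mono hg hr hle)
  refine (intervalIntegral.integral_eq_sub_of_hasDerivAt (fun s hs => hF s ?_) ?_).symm
  · rw [uIcc_of_le hr] at hs; exact hs.1
  · exact (of_continuousOn hf).intervalIntegrable le_rfl hr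

end LocBdd

/-! ### Iteration principles. -/

/-- A function `y` with `|y| ≤ B ω`, for which every such bound can be improved to
`(δ + B / 2) ω`, satisfies `|y| ≤ 2 δ ω`. -/
lemma abs_le_of_halving {S : Set ℝ} {y ω : ℝ → ℝ} {δ B : ℝ} (hB : ∀ r ∈ S, |y r| ≤ B * ω r)
    (h : ∀ b, (∀ r ∈ S, |y r| ≤ b * ω r) → ∀ r ∈ S, |y r| ≤ (δ + b / 2) * ω r) :
    ∀ r ∈ S, |y r| ≤ 2 * δ * ω r := by
  have hn : ∀ n : ℕ, ∀ r ∈ S, |y r| ≤ (2 * δ + (B - 2 * δ) * (1 / 2) ^ n) * ω r := by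
    intro n
    induction n with
    | zero => intro r hr; simpa using hB r hr
    | succ n ih =>
      intro r hr
      refine (h _ ih r hr).trans_eq ?_
      rw [pow_succ]; ring
  intro r hr
  have h1 : Tendsto (fun n : ℕ => (2 * δ + (B - 2 * δ) * (1 / 2) ^ n) * ω r) atTop
      (𝓝 ((2 * δ + (B - 2 * δ) * 0) * ω r)) :=
    ((tendsto_pow_atTop_nhds_zero_of_lt_one (by norm_num) (by norm_num)).const_mul _
      |>.const_add _).mul_const _
  simpa using ge_of_tendsto' h1 fun n => hn n r hr

/-- Contraction principle for weighted bounded continuous functions on `(a, ∞)`. -/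
lemma exists_fixedPoint {a B : ℝ} {ω : ℝ → ℝ} (hB : 0 ≤ B)
    (hω : ∀ r ∈ Ioi a, 0 ≤ ω r ∧ ω r ≤ 1) (T : (ℝ → ℝ) → ℝ → ℝ)
    (hT : ∀ y, ContinuousOn y (Ioi a) → (∀ r ∈ Ioi a, |y r| ≤ B * ω r) →
      ContinuousOn (T y) (Ioi a) ∧ ∀ r ∈ Ioi a, |T y r| ≤ B * ω r)
    (hc : ∀ y z, ContinuousOn y (Ioi a) → (∀ r ∈ Ioi a, |y r| ≤ B * ω r) →
      ContinuousOn z (Ioi a) → (∀ r ∈ Ioi a, |z r| ≤ B * ω r) →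
      ∀ d, 0 ≤ d → (∀ r ∈ Ioi a, |y r - z r| ≤ d * ω r) →
        ∀ r ∈ Ioi a, |T y r - T z r| ≤ d / 2 * ω r) :
    ∃ y, ContinuousOn y (Ioi a) ∧ (∀ r ∈ Ioi a, |y r| ≤ B * ω r) ∧ ∀ r ∈ Ioi a, T y r = y r := by
  let u : ℕ → ℝ → ℝ := fun n => T^[n] fun _ => 0
  have hu : ∀ n, u (n + 1) = T (u n) := fun n => Function.iterate_succ_apply' T n _
  have hS : ∀ n, ContinuousOn (u n) (Ioi a) ∧ ∀ r ∈ Ioi a, |u n r| ≤ B * ω r := by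
    intro n
    induction n with
    | zero =>
      refine ⟨continuousOn_const, fun r hr => ?_⟩
      simpa [u] using mul_nonneg hB (hω r hr).1
    | succ n ih => rw [hu]; exact hT _ ih.1 ih.2
  have hd : ∀ n, ∀ r ∈ Ioi a, |u n r - u (n + 1) r| ≤ B / 2 ^ n * ω r := by
    intro n
    induction n with
    | zero => intro r hr; simpa [u] using (hS 1).2 r hr
    | succ n ih =>
      intro r hr
      rw [hu n, hu (n + 1)]
      have := hc (u n) (u (n + 1)) (hS n).1 (hS n).2 (hS _).1 (hS _).2 _ (by positivity) ih r hr
      refine this.trans_eq ?_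
      rw [pow_succ]; field_simp
  have hd' : ∀ r ∈ Ioi a, ∀ n, dist (u n r) (u (n + 1) r) ≤ 2 * (B * ω r) / 2 / 2 ^ n := by
    intro r hr n
    rw [Real.dist_eq]
    refine (hd n r hr).trans_eq ?_
    field_simp
  have hl : ∀ r ∈ Ioi a, ∃ l, Tendsto (fun n => u n r) atTop (𝓝 l) := fun r hr =>
    cauchySeq_tendsto_of_complete (cauchySeq_of_le_geometric_two (hd' r hr))
  choose! y hy using hl
  have hdist : ∀ n, ∀ r ∈ Ioi a, |u n r - y r| ≤ 2 * B / 2 ^ n * ω r := by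
    intro n r hr
    have := dist_le_of_le_geometric_two_of_tendsto (hd' r hr) (hy r hr) n
    rw [Real.dist_eq] at this
    refine this.trans_eq ?_
    ring
  have hlim : Tendsto (fun n : ℕ => 2 * B / (2 : ℝ) ^ n) atTop (𝓝 0) := by
    have := (tendsto_pow_atTop_nhds_zero_of_lt_one (r := (1 / 2 : ℝ)) (by norm_num)
      (by norm_num)).const_mul (2 * B)
    simpa [div_eq_mul_inv] using this
  -- The bound `ω ≤ 1` turns weighted convergence into uniform convergence, which keeps the limit
  -- continuous.
  have hyc : ContinuousOn y (Ioi a) := by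
    have : TendstoUniformlyOn u y atTop (Ioi a) := by
      rw [Metric.tendstoUniformlyOn_iff]
      intro ε hε
      filter_upwards [hlim.eventually (gt_mem_nhds hε)] with n hn r hr
      rw [dist_comm, Real.dist_eq]
      refine lt_of_le_of_lt ((hdist n r hr).trans ?_) hn
      exact mul_le_of_le_one_right (by positivity) (hω r hr).2
    exact this.continuousOn (Frequently.of_forall fun n => (hS n).1)
  have hyB : ∀ r ∈ Ioi a, |y r| ≤ B * ω r := fun r hr =>
    le_of_tendsto' (hy r hr).abs fun n => (hS n).2 r hr
  refine ⟨y, hyc, hyB, fun r hr => ?_⟩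
  have h1 : Tendsto (fun n => u (n + 1) r) atTop (𝓝 (T y r)) := by
    rw [tendsto_iff_dist_tendsto_zero]
    refine squeeze_zero (fun _ => dist_nonneg) (fun n => ?_) hlim
    rw [hu, Real.dist_eq]
    have h2 := hc (u n) y (hS n).1 (hS n).2 hyc hyB _ (by positivity) (hdist n) r hr
    refine h2.trans ((mul_le_of_le_one_right (by positivity) (hω r hr).2).trans ?_)
    exact half_le_self (by positivity)
  exact tendsto_nhds_unique h1 ((tendsto_add_atTop_iff_nat 1).2 (hy r hr))

/-! ### The radial equation and its reduced form. -/

/-- The primitive of `G` vanishing at the horizon. -/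
def hprim (rp : ℝ) (G : ℝ → ℝ) (r : ℝ) : ℝ := ∫ s in rp..r, G s

/-- Coefficients of the radial equation `(r U φ')' = q φ`, `U = ∫ G`, asymptotic to those of
pure AdS. -/
structure IsRadialCoef (rp L α C c : ℝ) (G q : ℝ → ℝ) : Prop where
  contG : ContinuousOn G (Ioi rp)
  contq : ContinuousOn q (Ioi rp)
  asympG : ∀ s ∈ Ioi rp, |G s - 3 * L * s ^ 2| ≤ C
  lower : ∀ s ∈ Ioi rp, c * s ^ 2 ≤ G s
  asympq : ∀ s ∈ Ioi rp, |q s - L * α * s ^ 2| ≤ C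

/-- The zeroth order coefficient of the equation for `y = r^{3/2 - D} φ`, up to the weight. -/
def redCoef (rp D : ℝ) (G q : ℝ → ℝ) (r : ℝ) : ℝ :=
  q r + (3 / 2 - D) * (G r - (3 / 2 - D) * (hprim rp G r / r))

/-- `r^{-2σ} P y'` as a functional of `y`, with `σ = 3/2 - D`. -/
def flux (rp D : ℝ) (G q y : ℝ → ℝ) (r : ℝ) : ℝ :=
  ∫ t in rp..r, t ^ (2 * D - 3) * (redCoef rp D G q t * y t)

/-- `y'` as a functional of `y`. -/
def slope (rp D : ℝ) (G q y : ℝ → ℝ) (r : ℝ) : ℝ :=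
  r ^ (3 - 2 * D) / (r * hprim rp G r) * flux rp D G q y r

/-- `y = r^{3/2 - D} φ` for a solution `φ` of the radial equation that is regular at the horizon,
with horizon value `a` of `y`. -/
structure IsRegularSol (rp D : ℝ) (G q : ℝ → ℝ) (a : ℝ) (y : ℝ → ℝ) : Prop where
  cont : ContinuousOn y (Ioi rp)
  bdd : ∃ B, ∀ r ∈ Ioi rp, |y r| ≤ B
  eq : ∀ r ∈ Ioi rp, y r = a + ∫ s in rp..r, slope rp D G q y s

section Coefficients

variable {rp L α C c D : ℝ} {G q : ℝ → ℝ}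

lemma IsRadialCoef.locBddG (h : IsRadialCoef rp L α C c G q) : LocBdd rp G := by
  refine LocBdd.of_le (h := fun s => C + |3 * L * s ^ 2|) h.contG
    (LocBdd.of_continuousOn (by fun_prop)) fun s hs => ?_
  have h1 := h.asympG s hs
  have h2 := abs_add_le (G s - 3 * L * s ^ 2) (3 * L * s ^ 2)
  simp only [sub_add_cancel] at h2
  linarith

lemma IsRadialCoef.locBddq (h : IsRadialCoef rp L α C c G q) : LocBdd rp q := by
  refine LocBdd.of_le (h := fun s => C + |L * α * s ^ 2|) h.contq
    (LocBdd.of_continuousOn (by fun_prop)) fun s hs => ?_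
  have h1 := h.asympq s hs
  have h2 := abs_add_le (q s - L * α * s ^ 2) (L * α * s ^ 2)
  simp only [sub_add_cancel] at h2
  linarith

lemma locBdd_inv (hrp : 0 < rp) : LocBdd rp fun s => s⁻¹ :=
  LocBdd.of_continuousOn (continuousOn_id.inv₀ fun _ hs => (hrp.trans_le hs).ne')

lemma IsRadialCoef.locBdd_redCoef (hrp : 0 < rp) (h : IsRadialCoef rp L α C c G q) :
    LocBdd rp (redCoef rp D G q) :=
  h.locBddq.add ((LocBdd.const _).mul (h.locBddG.sub ((LocBdd.const _).mul
    (h.locBddG.primitive.mul (locBdd_inv hrp)))))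

/-- Integrating `G ≥ c s²` gives `c (r³ - rp³)/3`, and `r³ - rp³ ≥ (r - rp) r²`. The factor `r - rp`
records the simple zero at the horizon, which later cancels that of a flux or of a potential. -/
lemma IsRadialCoef.hprim_ge (hrp : 0 < rp) (hc : 0 < c) (h : IsRadialCoef rp L α C c G q) {r : ℝ}
    (hr : rp < r) : c / 3 * ((r - rp) * r ^ 2) ≤ hprim rp G r := by
  have h1 := h.locBddG.sub_le_integral (F := fun s => c / 3 * s ^ 3) (f := fun s => c * s ^ 2)
    hr.le (fun s _ => by
      have := (hasDerivAt_pow 3 s).const_mul (c / 3)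
      exact this.congr_deriv (by norm_num; ring))
    (by fun_prop) (fun s hs => h.lower s hs.1)
  refine le_trans ?_ h1
  have : 0 ≤ c / 3 * (rp * (r - rp) * (r + rp)) := by
    have := sub_pos.2 hr
    have := hrp.trans hr
    positivity
  nlinarith [this]

lemma IsRadialCoef.hprim_pos (hrp : 0 < rp) (hc : 0 < c) (h : IsRadialCoef rp L α C c G q) {r : ℝ}
    (hr : rp < r) : 0 < hprim rp G r := by
  have := sub_pos.2 hr
  have h0 : 0 < r := hrp.trans hr
  exact lt_of_lt_of_le (by positivity) (h.hprim_ge hrp hc hr)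

lemma IsRadialCoef.abs_hprim_sub_le (hrp : 0 < rp) (hC : 0 ≤ C)
    (h : IsRadialCoef rp L α C c G q) {r : ℝ}
    (hr : rp < r) : |hprim rp G r - L * r ^ 3| ≤ (C + |L| * rp ^ 2) * r := by
  have h1 : ∫ s in rp..r, (G s - 3 * L * s ^ 2) = hprim rp G r - L * r ^ 3 + L * rp ^ 3 := by
    rw [intervalIntegral.integral_sub (h.locBddG.intervalIntegrable le_rfl hr.le)
      (Continuous.intervalIntegrable (by fun_prop) _ _), intervalIntegral.integral_const_mul,
      integral_pow]
    simp only [hprim]; norm_num; ring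
  have h2 : |∫ s in rp..r, (G s - 3 * L * s ^ 2)| ≤ C * (r - rp) := by
    rw [← Real.norm_eq_abs]
    have := intervalIntegral.norm_integral_le_of_norm_le_const (a := rp) (b := r) (C := C)
      (f := fun s => G s - 3 * L * s ^ 2) (fun s hs => by
        rw [uIoc_of_le hr.le] at hs; exact h.asympG s hs.1)
    rwa [abs_of_pos (sub_pos.2 hr)] at this
  have h3 : hprim rp G r - L * r ^ 3 = (∫ s in rp..r, (G s - 3 * L * s ^ 2)) - L * rp ^ 3 := by
    rw [h1]; ring
  rw [h3]
  refine (abs_sub _ _).trans ?_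
  have h4 : |L * rp ^ 3| ≤ |L| * rp ^ 2 * r := by
    rw [abs_mul, abs_of_pos (pow_pos hrp 3), pow_succ, ← mul_assoc]
    gcongr
  nlinarith [mul_nonneg hC hrp.le]

/-- The three leading terms combine to `L r² (α + 3σ - σ²)` with `σ = 3/2 - D`, which is zero by the
indicial equation `hα`. What remains is a sum of bounded deviations from pure AdS. -/
lemma exists_redCoef_bound (hrp : 0 < rp) (hC : 0 ≤ C)
    (hα : α = (3 / 2 - D) ^ 2 - 3 * (3 / 2 - D)) :
    ∃ K > 0, ∀ G q, IsRadialCoef rp L α C c G q → ∀ r ∈ Ioi rp, |redCoef rp D G q r| ≤ K := by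
  refine ⟨C + |3 / 2 - D| * (C + |3 / 2 - D| * (C + |L| * rp ^ 2)) + 1, by positivity,
    fun G q h r hr => ?_⟩
  have hr0 : 0 < r := hrp.trans hr
  have h1 : redCoef rp D G q r = (q r - L * α * r ^ 2) + (3 / 2 - D) * ((G r - 3 * L * r ^ 2)
      - (3 / 2 - D) * ((hprim rp G r - L * r ^ 3) / r)) := by
    rw [redCoef, hα]; field_simp; ring
  have h2 : |(hprim rp G r - L * r ^ 3) / r| ≤ C + |L| * rp ^ 2 := by
    rw [abs_div, abs_of_pos hr0, div_le_iff₀ hr0]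
    exact h.abs_hprim_sub_le hrp hC hr
  rw [h1]
  refine (abs_add_le _ _).trans ?_
  rw [abs_mul]
  have h3 := abs_sub (G r - 3 * L * r ^ 2) ((3 / 2 - D) * ((hprim rp G r - L * r ^ 3) / r))
  rw [abs_mul (3 / 2 - D) ((hprim rp G r - L * r ^ 3) / r)] at h3
  have h4 : |3 / 2 - D| * |(hprim rp G r - L * r ^ 3) / r|
      ≤ |3 / 2 - D| * (C + |L| * rp ^ 2) := by gcongr
  have h5 : |3 / 2 - D| * |G r - 3 * L * r ^ 2 - (3 / 2 - D) * ((hprim rp G r - L * r ^ 3) / r)|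
      ≤ |3 / 2 - D| * (C + |3 / 2 - D| * (C + |L| * rp ^ 2)) := by
    gcongr; linarith [h.asympG r hr]
  linarith [h.asympq r hr]

/-- Two sets of coefficients at distance at most `d`. -/
def CoefClose (rp d : ℝ) (G q G' q' : ℝ → ℝ) : Prop :=
  ∀ s ∈ Ioi rp, |G s - G' s| ≤ d ∧ |q s - q' s| ≤ d

lemma CoefClose.hprim_le {G' q' : ℝ → ℝ} {d : ℝ} (hG : LocBdd rp G)
    (hG' : LocBdd rp G') (h : CoefClose rp d G q G' q') {r : ℝ} (hr : rp < r) :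
    |hprim rp G r - hprim rp G' r| ≤ d * (r - rp) := by
  rw [hprim, hprim, ← intervalIntegral.integral_sub (hG.intervalIntegrable le_rfl hr.le)
    (hG'.intervalIntegrable le_rfl hr.le), ← Real.norm_eq_abs]
  have := intervalIntegral.norm_integral_le_of_norm_le_const (a := rp) (b := r) (C := d)
    (f := fun s => G s - G' s) (fun s hs => by
        rw [uIoc_of_le hr.le] at hs; exact (h s hs.1).1)
  rwa [abs_of_pos (sub_pos.2 hr)] at this

lemma CoefClose.redCoef_le {G' q' : ℝ → ℝ} {d : ℝ} (hrp : 0 < rp) (hD0 : 0 < D) (hD : D < 3 / 2)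
    (hG : LocBdd rp G) (hG' : LocBdd rp G') (h : CoefClose rp d G q G' q') {r : ℝ} (hr : rp < r) :
    |redCoef rp D G q r - redCoef rp D G' q' r| ≤ 5 * d := by
  have hr0 : 0 < r := hrp.trans hr
  have h1 := (h r hr).1
  have h2 := (h r hr).2
  have hd : 0 ≤ d := (abs_nonneg _).trans h1
  have h3 : |(hprim rp G r - hprim rp G' r) / r| ≤ d := by
    rw [abs_div, abs_of_pos hr0, div_le_iff₀ hr0]
    refine (h.hprim_le hG hG' hr).trans ?_
    nlinarith
  have e : redCoef rp D G q r - redCoef rp D G' q' r = (q r - q' r) + (3 / 2 - D) *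
      ((G r - G' r) - (3 / 2 - D) * ((hprim rp G r - hprim rp G' r) / r)) := by
    simp only [redCoef]; ring
  rw [e]
  have hσ : 0 < 3 / 2 - D := by linarith
  have hσ' : 3 / 2 - D < 3 / 2 := by linarith
  set σ := 3 / 2 - D
  rw [abs_le] at *
  have h4 : |σ * ((hprim rp G r - hprim rp G' r) / r)| ≤ 3 / 2 * d := by
    rw [abs_mul, abs_of_pos hσ]
    exact mul_le_mul hσ'.le (abs_le.2 h3) (abs_nonneg _) (by norm_num)
  have h5 : |σ * ((G r - G' r) - σ * ((hprim rp G r - hprim rp G' r) / r))| ≤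
      3 / 2 * (d + 3 / 2 * d) := by
    rw [abs_mul, abs_of_pos hσ]
    refine mul_le_mul hσ'.le ((abs_sub _ _).trans (add_le_add (abs_le.2 h1) h4)) (abs_nonneg _)
      (by norm_num)
  rw [abs_le] at h5
  -- As `0 < σ < 3/2`, the total is at most `1 + (3/2)(1 + 3/2) = 19/4` times `d`, rounded up to `5
  -- d`.
  constructor <;> linarith [h5.1, h5.2]

/-- An interval integral of a power above `-1` is comparable to the length times the value at the
right endpoint. -/
lemma integral_rpow_le_mul (hrp : 0 < rp) {a : ℝ} (ha : -1 < a) {r : ℝ} (hr : rp < r) :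
    ∫ t in rp..r, t ^ a ≤ (1 + 1 / (a + 1)) * ((r - rp) * r ^ a) := by
  have hr0 : 0 < r := hrp.trans hr
  have h1 : 0 < (r - rp) * r ^ a := mul_pos (sub_pos.2 hr) (Real.rpow_pos_of_pos hr0 _)
  have h2 : 0 < a + 1 := by linarith
  rcases le_total 0 a with h | h
  · have : ∫ t in rp..r, t ^ a ≤ ∫ _ in rp..r, r ^ a :=
      (LocBdd.rpow hrp a).integral_mono (LocBdd.const _) hr.le fun s hs =>
        Real.rpow_le_rpow (hrp.trans hs.1).le hs.2 h
    rw [intervalIntegral.integral_const, smul_eq_mul] at this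
    refine this.trans (le_mul_of_one_le_left h1.le ?_)
    have : 0 < 1 / (a + 1) := by positivity
    linarith
  · rw [integral_rpow (Or.inl ha), Real.rpow_add_one hr0.ne', Real.rpow_add_one hrp.ne']
    have h3 : r ^ a ≤ rp ^ a := Real.rpow_le_rpow_of_nonpos hrp hr.le h
    have h4 : r ^ a * r - rp ^ a * rp ≤ (r - rp) * r ^ a := by nlinarith
    calc (r ^ a * r - rp ^ a * rp) / (a + 1) ≤ (r - rp) * r ^ a / (a + 1) := by gcongr
      _ = 1 / (a + 1) * ((r - rp) * r ^ a) := by ring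
      _ ≤ _ := by gcongr; linarith

/-- The exponent `2D - 3` may lie below `-1`. Splitting it as `(D - 2) + (D - 1)` puts the
decreasing factor at `rp` and leaves `D - 1 > -1`, to which `integral_rpow_le_mul` applies without
losing the factor `r - rp`. -/
lemma integral_weight_le (hrp : 0 < rp) (hD0 : 0 < D) (hD : D < 3 / 2) {r : ℝ} (hr : rp < r) :
    ∫ t in rp..r, t ^ (2 * D - 3) ≤
      rp ^ (D - 2) * ((1 + 1 / D) * ((r - rp) * r ^ (D - 1))) := by
  have h1 : ∫ t in rp..r, t ^ (2 * D - 3) ≤ ∫ t in rp..r, rp ^ (D - 2) * t ^ (D - 1) := by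
    refine (LocBdd.rpow hrp _).integral_mono ((LocBdd.const _).mul (LocBdd.rpow hrp _)) hr.le
      fun s hs => ?_
    have hs0 : 0 < s := hrp.trans hs.1
    rw [show 2 * D - 3 = (D - 2) + (D - 1) by ring, Real.rpow_add hs0]
    exact mul_le_mul_of_nonneg_right
      (Real.rpow_le_rpow_of_nonpos hrp hs.1.le (by linarith)) (Real.rpow_nonneg hs0.le _)
  rw [intervalIntegral.integral_const_mul] at h1
  refine h1.trans (mul_le_mul_of_nonneg_left ?_ (Real.rpow_nonneg hrp.le _))
  have := integral_rpow_le_mul hrp (a := D - 1) (by linarith) hr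
  simpa using this

/-- The kernel of the Volterra equation decays like `r^{-1-D}`. -/
lemma exists_kernel_bound (hrp : 0 < rp) (hc : 0 < c) (hD0 : 0 < D) (hD : D < 3 / 2) :
    ∃ K > 0, ∀ U r, rp < r → c / 3 * ((r - rp) * r ^ 2) ≤ U →
      r ^ (3 - 2 * D) / (r * U) * ∫ t in rp..r, t ^ (2 * D - 3) ≤ K * r ^ (-1 - D) := by
  refine ⟨3 / c * (rp ^ (D - 2) * (1 + 1 / D)), by positivity, fun U r hr hU => ?_⟩
  have hr0 : 0 < r := hrp.trans hr
  have hd : 0 < r - rp := sub_pos.2 hr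
  have h1 : 0 < c / 3 * ((r - rp) * r ^ 2) := by positivity
  calc r ^ (3 - 2 * D) / (r * U) * ∫ t in rp..r, t ^ (2 * D - 3)
      ≤ r ^ (3 - 2 * D) / (r * (c / 3 * ((r - rp) * r ^ 2))) *
        (rp ^ (D - 2) * ((1 + 1 / D) * ((r - rp) * r ^ (D - 1)))) := by
        gcongr
        · exact intervalIntegral.integral_nonneg hr.le fun t ht =>
            Real.rpow_nonneg (hrp.trans_le ht.1).le _
        · exact integral_weight_le hrp hD0 hD hr
    _ = 3 / c * (rp ^ (D - 2) * (1 + 1 / D)) * (r ^ (3 - 2 * D) * r ^ (D - 1) / r ^ 3) := by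
        field_simp
    _ = _ := by
        rw [← Real.rpow_natCast r 3, ← Real.rpow_add hr0, ← Real.rpow_sub hr0]
        congr 2
        push_cast; ring

end Coefficients

/-! ### The Volterra equation for the regular solution. -/

section Volterra

variable {rp L α C c D : ℝ} {G q : ℝ → ℝ}

/-- Stated for an arbitrary bounded `w` so that it serves both for `redCoef * y` and for differences
of reduced coefficients. The zero of `U` at the horizon is absorbed by the shrinking interval of
integration. -/
lemma exists_slope_bound (hrp : 0 < rp) (hc : 0 < c) (hD0 : 0 < D) (hD : D < 3 / 2) :
    ∃ K > 0, ∀ U r Z, ∀ w : ℝ → ℝ, rp < r → c / 3 * ((r - rp) * r ^ 2) ≤ U →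
      (∀ t ∈ Ioc rp r, |w t| ≤ Z) →
      |r ^ (3 - 2 * D) / (r * U) * ∫ t in rp..r, t ^ (2 * D - 3) * w t| ≤
        K * Z * r ^ (-1 - D) := by
  obtain ⟨K, hK, h⟩ := exists_kernel_bound hrp hc hD0 hD
  refine ⟨K, hK, fun U r Z w hr hU hw => ?_⟩
  have hr0 : 0 < r := hrp.trans hr
  have hd : 0 < r - rp := sub_pos.2 hr
  have hU0 : 0 < U := lt_of_lt_of_le (by positivity) hU
  have hZ : 0 ≤ Z := (abs_nonneg _).trans (hw r ⟨hr, le_rfl⟩)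
  have h1 : |∫ t in rp..r, t ^ (2 * D - 3) * w t| ≤ ∫ t in rp..r, t ^ (2 * D - 3) * Z := by
    refine ((LocBdd.rpow hrp _).mul (LocBdd.const Z)).abs_integral_le hr.le fun t ht => ?_
    have : 0 < t := hrp.trans ht.1
    rw [abs_mul, abs_of_pos (Real.rpow_pos_of_pos this _)]
    exact mul_le_mul_of_nonneg_left (hw t ht) (Real.rpow_nonneg this.le _)
  rw [intervalIntegral.integral_mul_const] at h1
  rw [abs_mul, abs_of_pos (by positivity)]
  calc r ^ (3 - 2 * D) / (r * U) * |∫ t in rp..r, t ^ (2 * D - 3) * w t|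
      ≤ r ^ (3 - 2 * D) / (r * U) * ((∫ t in rp..r, t ^ (2 * D - 3)) * Z) := by gcongr
    _ = (r ^ (3 - 2 * D) / (r * U) * ∫ t in rp..r, t ^ (2 * D - 3)) * Z := by ring
    _ ≤ K * r ^ (-1 - D) * Z := mul_le_mul_of_nonneg_right (h U r hr hU) hZ
    _ = _ := by ring

lemma locBdd_of_bdd {y : ℝ → ℝ} (hy : ContinuousOn y (Ioi rp)) {B : ℝ}
    (hB : ∀ r ∈ Ioi rp, |y r| ≤ B) : LocBdd rp y :=
  LocBdd.of_le hy (LocBdd.const B) hB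

lemma IsRegularSol.locBdd {a : ℝ} {y : ℝ → ℝ} (h : IsRegularSol rp D G q a y) : LocBdd rp y := by
  obtain ⟨B, hB⟩ := h.bdd
  exact locBdd_of_bdd h.cont hB

lemma IsRadialCoef.locBdd_fluxIntegrand (hrp : 0 < rp) (h : IsRadialCoef rp L α C c G q)
    {y : ℝ → ℝ} (hy : LocBdd rp y) :
    LocBdd rp fun t => t ^ (2 * D - 3) * (redCoef rp D G q t * y t) :=
  (LocBdd.rpow hrp _).mul ((h.locBdd_redCoef hrp).mul hy)

lemma IsRadialCoef.continuousOn_slope (hrp : 0 < rp) (hc : 0 < c)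
    (h : IsRadialCoef rp L α C c G q) {y : ℝ → ℝ} (hy : LocBdd rp y) :
    ContinuousOn (slope rp D G q y) (Ioi rp) := by
  have hU : ContinuousOn (hprim rp G) (Ioi rp) := h.locBddG.primitive.cont
  have hf : ContinuousOn (flux rp D G q y) (Ioi rp) :=
    (h.locBdd_fluxIntegrand hrp hy).primitive.cont
  refine ((LocBdd.rpow hrp _).cont.div (continuousOn_id.mul hU) fun r hr => ?_).mul hf
  exact (mul_pos (hrp.trans hr) (h.hprim_pos hrp hc hr)).ne'

/-- Uniform pointwise bound on the slope operator. -/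
lemma exists_slope_le (hrp : 0 < rp) (hc : 0 < c) (hC : 0 ≤ C) (hD0 : 0 < D) (hD : D < 3 / 2)
    (hα : α = (3 / 2 - D) ^ 2 - 3 * (3 / 2 - D)) :
    ∃ K > 0, ∀ G q, IsRadialCoef rp L α C c G q → ∀ y : ℝ → ℝ, ∀ r ∈ Ioi rp, ∀ Y,
      (∀ t ∈ Ioc rp r, |y t| ≤ Y) → |slope rp D G q y r| ≤ K * Y * r ^ (-1 - D) := by
  obtain ⟨K1, hK1, h1⟩ := exists_redCoef_bound (L := L) hrp hC hα
  obtain ⟨K2, hK2, h2⟩ := exists_slope_bound hrp hc hD0 hD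
  refine ⟨K2 * K1, by positivity, fun G q h y r hr Y hY => ?_⟩
  have := h2 (hprim rp G r) r (K1 * Y) (fun t => redCoef rp D G q t * y t) hr
    (h.hprim_ge hrp hc hr) fun t ht => by
      rw [abs_mul]
      exact mul_le_mul (h1 G q h t ht.1) (hY t ht) (abs_nonneg _) hK1.le
  rw [slope, flux]
  refine this.trans_eq ?_
  ring

/-- The weight in which the Volterra operator is a contraction. -/
def volterraWeight (D k r : ℝ) : ℝ := Real.exp (-(k * r ^ (-D)))

lemma volterraWeight_pos (k r : ℝ) : 0 < volterraWeight D k r := Real.exp_pos _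

lemma volterraWeight_le_one {k r : ℝ} (hk : 0 ≤ k) (hr : 0 < r) : volterraWeight D k r ≤ 1 :=
  Real.exp_le_one_iff.2 (neg_nonpos.2 (mul_nonneg hk (Real.rpow_nonneg hr.le _)))

lemma volterraWeight_mono {k r s : ℝ} (hD : 0 ≤ D) (hk : 0 ≤ k) (hr : 0 < r) (hrs : r ≤ s) :
    volterraWeight D k r ≤ volterraWeight D k s :=
  Real.exp_le_exp.2 (neg_le_neg (mul_le_mul_of_nonneg_left
    (Real.rpow_le_rpow_of_nonpos hr hrs (neg_nonpos.2 hD)) hk))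

lemma hasDerivAt_volterraWeight {k r : ℝ} (hr : 0 < r) :
    HasDerivAt (volterraWeight D k) (k * D * (r ^ (-1 - D) * volterraWeight D k r)) r := by
  have := (((Real.hasDerivAt_rpow_const (p := -D) (Or.inl hr.ne')).const_mul k).neg).exp
  refine this.congr_deriv ?_
  rw [volterraWeight, show -D - 1 = -1 - D by ring]
  simp only [Pi.neg_apply]
  ring

lemma continuousOn_volterraWeight (hrp : 0 < rp) (k : ℝ) :
    ContinuousOn (volterraWeight D k) (Ici rp) := fun _ hr =>
  (hasDerivAt_volterraWeight (hrp.trans_le hr)).continuousAt.continuousWithinAt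

/-- Estimate of the integral of a function dominated by the weighted kernel. -/
lemma abs_integral_le_volterraWeight (hrp : 0 < rp) (hD0 : 0 < D) {k b : ℝ} (hk : 0 < k)
    (hb : 0 ≤ b) {g : ℝ → ℝ} {r : ℝ} (hr : rp < r)
    (hg : ∀ s ∈ Ioc rp r, |g s| ≤ b * (s ^ (-1 - D) * volterraWeight D k s)) :
    |∫ s in rp..r, g s| ≤ b / (k * D) * volterraWeight D k r := by
  have h := LocBdd.abs_integral_le_sub (a := rp) (g := g)
    (F := fun s => b / (k * D) * volterraWeight D k s)
    (f := fun s => b * (s ^ (-1 - D) * volterraWeight D k s)) hr.le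
    (fun s hs => by
      refine ((hasDerivAt_volterraWeight (hrp.trans_le hs)).const_mul _).congr_deriv ?_
      field_simp)
    (continuousOn_const.mul (ContinuousOn.mul (fun s hs => (Real.continuousAt_rpow_const s _
      (Or.inl (hrp.trans_le hs).ne')).continuousWithinAt) (continuousOn_volterraWeight hrp k))) hg
  refine h.trans (sub_le_self _ ?_)
  have := volterraWeight_pos (D := D) k rp
  positivity

lemma IsRadialCoef.locBdd_slope (hrp : 0 < rp) (hc : 0 < c) (hC : 0 ≤ C) (hD0 : 0 < D)
    (hD : D < 3 / 2) (hα : α = (3 / 2 - D) ^ 2 - 3 * (3 / 2 - D))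
    (h : IsRadialCoef rp L α C c G q) {y : ℝ → ℝ} (hy : ContinuousOn y (Ioi rp)) {B : ℝ}
    (hB : ∀ r ∈ Ioi rp, |y r| ≤ B) :
    LocBdd rp (slope rp D G q y) := by
  obtain ⟨K, hK, h1⟩ := exists_slope_le (L := L) hrp hc hC hD0 hD hα
  exact LocBdd.of_le (h.continuousOn_slope hrp hc (locBdd_of_bdd hy hB))
    ((LocBdd.const (K * B)).mul (LocBdd.rpow hrp (-1 - D)))
    fun s hs => h1 G q h y s hs B fun t ht => hB t ht.1

/-- The Volterra operator halves the weighted norm. -/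
lemma exists_volterra_contraction (hrp : 0 < rp) (hc : 0 < c) (hC : 0 ≤ C) (hD0 : 0 < D)
    (hD : D < 3 / 2) (hα : α = (3 / 2 - D) ^ 2 - 3 * (3 / 2 - D)) :
    ∃ k > 0, ∀ G q, IsRadialCoef rp L α C c G q → ∀ y : ℝ → ℝ, ∀ B, 0 ≤ B →
      (∀ r ∈ Ioi rp, |y r| ≤ B * volterraWeight D k r) →
      ∀ r ∈ Ioi rp, |∫ s in rp..r, slope rp D G q y s| ≤ B / 2 * volterraWeight D k r := by
  obtain ⟨K, hK, h1⟩ := exists_slope_le (L := L) hrp hc hC hD0 hD hα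
  -- The weight satisfies `ω' = k D r^{-1-D} ω`, so integrating a kernel of size `K` costs `K/(kD)`;
  -- this `k` makes that ratio `1/2`.
  refine ⟨2 * K / D, by positivity, fun G q h y B hB0 hB r hr => ?_⟩
  have := abs_integral_le_volterraWeight (g := slope rp D G q y) (k := 2 * K / D) (b := K * B) hrp
    hD0 (by positivity) (by positivity) hr fun s hs => by
      have hs0 : 0 < s := hrp.trans hs.1
      refine (h1 G q h y s hs.1 (B * volterraWeight D (2 * K / D) s) fun t ht => ?_).trans_eq
        (by ring)
      refine (hB t ht.1).trans (mul_le_mul_of_nonneg_left ?_ hB0)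
      exact volterraWeight_mono hD0.le (by positivity) (hrp.trans ht.1) ht.2
  refine this.trans_eq ?_
  field_simp

lemma slope_sub (hrp : 0 < rp) (h : IsRadialCoef rp L α C c G q) {y z : ℝ → ℝ}
    (hy : LocBdd rp y) (hz : LocBdd rp z) {r : ℝ} (hr : rp ≤ r) :
    slope rp D G q y r - slope rp D G q z r = slope rp D G q (fun s => y s - z s) r := by
  have : flux rp D G q (fun s => y s - z s) r = flux rp D G q y r - flux rp D G q z r := by
    rw [flux, flux, flux, ← intervalIntegral.integral_sub
      ((h.locBdd_fluxIntegrand hrp hy).intervalIntegrable le_rfl hr)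
      ((h.locBdd_fluxIntegrand hrp hz).intervalIntegrable le_rfl hr)]
    congr 1; ext t; ring
  rw [slope, slope, slope, this]; ring

lemma integral_slope_sub (hrp : 0 < rp) (hc : 0 < c) (hC : 0 ≤ C) (hD0 : 0 < D)
    (hD : D < 3 / 2) (hα : α = (3 / 2 - D) ^ 2 - 3 * (3 / 2 - D))
    (h : IsRadialCoef rp L α C c G q) {y z : ℝ → ℝ} (hy : ContinuousOn y (Ioi rp))
    (hz : ContinuousOn z (Ioi rp)) {B B' : ℝ} (hB : ∀ r ∈ Ioi rp, |y r| ≤ B)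
    (hB' : ∀ r ∈ Ioi rp, |z r| ≤ B') {r : ℝ} (hr : rp ≤ r) :
    (∫ s in rp..r, slope rp D G q y s) - (∫ s in rp..r, slope rp D G q z s) =
      ∫ s in rp..r, slope rp D G q (fun s => y s - z s) s := by
  rw [← intervalIntegral.integral_sub
    ((h.locBdd_slope hrp hc hC hD0 hD hα hy hB).intervalIntegrable le_rfl hr)
    ((h.locBdd_slope hrp hc hC hD0 hD hα hz hB').intervalIntegrable le_rfl hr)]
  refine intervalIntegral.integral_congr fun s hs => ?_
  rw [uIcc_of_le hr] at hs
  exact slope_sub hrp h (locBdd_of_bdd hy hB) (locBdd_of_bdd hz hB') hs.1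

/-- In the norm weighted by `ω` the Volterra operator is a contraction on the entire half-line, so
no continuation argument is needed and the solution is bounded up to infinity. -/
theorem IsRadialCoef.exists_regularSol (hrp : 0 < rp) (hc : 0 < c) (hC : 0 ≤ C) (hD0 : 0 < D)
    (hD : D < 3 / 2) (hα : α = (3 / 2 - D) ^ 2 - 3 * (3 / 2 - D))
    (h : IsRadialCoef rp L α C c G q) : ∃ y, IsRegularSol rp D G q 1 y := by
  obtain ⟨k, hk, hV⟩ := exists_volterra_contraction (L := L) hrp hc hC hD0 hD hα
  set ω := volterraWeight D k
  have hω1 : ∀ r ∈ Ioi rp, ω r ≤ 1 := fun r hr => volterraWeight_le_one hk.le (hrp.trans hr)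
  have hω0 : 0 < ω rp := volterraWeight_pos _ _
  have hωm : ∀ r ∈ Ioi rp, ω rp ≤ ω r := fun r hr =>
    volterraWeight_mono hD0.le hk.le hrp (le_of_lt hr)
  have hb : ∀ B : ℝ, 0 ≤ B → ∀ y : ℝ → ℝ, (∀ r ∈ Ioi rp, |y r| ≤ B * ω r) →
      ∀ r ∈ Ioi rp, |y r| ≤ B := fun B hB y hy r hr =>
    (hy r hr).trans (mul_le_of_le_one_right hB (hω1 r hr))
  -- The ball of radius `2/ω(rp)` is invariant: the constant `1` takes up one half, as `ω ≥ ω(rp)`,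
  -- and the operator halves the rest.
  have hB : 0 ≤ 2 / ω rp := by positivity
  obtain ⟨y, hy, hyB, hyT⟩ := exists_fixedPoint (a := rp) (ω := ω) hB
    (fun r hr => ⟨(volterraWeight_pos _ _).le, hω1 r hr⟩)
    (fun y r => 1 + ∫ s in rp..r, slope rp D G q y s)
    (fun y hy hyB => by
      refine ⟨continuousOn_const.add ((h.locBdd_slope hrp hc hC hD0 hD hα hy
        (hb _ hB y hyB)).primitive.cont), fun r hr => ?_⟩
      refine (abs_add_le _ _).trans ?_
      have h1 := hV G q h y _ hB hyB r hr
      have h2 : 1 ≤ 1 / ω rp * ω r := by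
        rw [one_div, inv_mul_eq_div, le_div_iff₀ hω0, one_mul]; exact hωm r hr
      rw [abs_one]
      calc _ ≤ 1 / ω rp * ω r + 2 / ω rp / 2 * ω r := add_le_add h2 h1
        _ = _ := by ring)
    (fun y z hy hyB hz hzB d hd hyz r hr => by
      have h1 := hV G q h (fun s => y s - z s) d hd hyz r hr
      rwa [← integral_slope_sub hrp hc hC hD0 hD hα h hy hz (hb _ hB y hyB) (hb _ hB z hzB)
        (le_of_lt hr), ← add_sub_add_left_eq_sub _ _ 1] at h1)
  exact ⟨y, hy, ⟨_, hb _ hB y hyB⟩, fun r hr => (hyT r hr).symm⟩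

/-- A priori bound for the inhomogeneous Volterra equation. -/
theorem exists_apriori_bound (hrp : 0 < rp) (hc : 0 < c) (hC : 0 ≤ C) (hD0 : 0 < D)
    (hD : D < 3 / 2) (hα : α = (3 / 2 - D) ^ 2 - 3 * (3 / 2 - D)) :
    ∃ K > 0, ∀ G q, IsRadialCoef rp L α C c G q → ∀ y : ℝ → ℝ,
      (∃ B, ∀ r ∈ Ioi rp, |y r| ≤ B) → ∀ δ,
      (∀ r ∈ Ioi rp, |y r - ∫ s in rp..r, slope rp D G q y s| ≤ δ) →
      ∀ r ∈ Ioi rp, |y r| ≤ K * δ := by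
  obtain ⟨k, hk, hV⟩ := exists_volterra_contraction (L := L) hrp hc hC hD0 hD hα
  set ω := volterraWeight D k with hω
  have hω0 : 0 < ω rp := volterraWeight_pos _ _
  have hωm : ∀ r ∈ Ioi rp, 1 ≤ ω r / ω rp := fun r hr => by
    rw [le_div_iff₀ hω0, one_mul]
    exact volterraWeight_mono hD0.le hk.le hrp (le_of_lt hr)
  refine ⟨2 / ω rp, by positivity, fun G q h y ⟨B, hB⟩ δ hδ r hr => ?_⟩
  have hδ0 : 0 ≤ δ := (abs_nonneg _).trans (hδ r hr)
  have hB0 : 0 ≤ B := (abs_nonneg _).trans (hB r hr)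
  have := abs_le_of_halving (S := Ioi rp) (y := y) (ω := ω) (δ := δ / ω rp) (B := B / ω rp)
    (fun r hr => (hB r hr).trans (by
      calc B ≤ B * (ω r / ω rp) := le_mul_of_one_le_right hB0 (hωm r hr)
        _ = _ := by ring))
    (fun b hb r hr => by
      have hb0 : 0 ≤ b := by
        by_contra hneg
        have h1 := hb r hr
        have h2 : b * ω r < 0 := mul_neg_of_neg_of_pos (not_le.1 hneg) (volterraWeight_pos _ _)
        linarith [abs_nonneg (y r)]
      have h1 := hV G q h y b hb0 hb r hr
      have h2 := abs_add_le (y r - ∫ s in rp..r, slope rp D G q y s)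
        (∫ s in rp..r, slope rp D G q y s)
      rw [sub_add_cancel] at h2
      have h3 : δ ≤ δ / ω rp * ω r := by
        calc δ ≤ δ * (ω r / ω rp) := le_mul_of_one_le_right hδ0 (hωm r hr)
          _ = _ := by ring
      have h4 := hδ r hr
      linarith) r hr
  refine this.trans ?_
  rw [show 2 * (δ / ω rp) * ω r = 2 / ω rp * δ * ω r by ring]
  exact mul_le_of_le_one_right (by positivity) (volterraWeight_le_one hk.le (hrp.trans hr))

end Volterra

/-! ### Bounds, limits and stability of regular solutions. -/

lemma continuousOn_rpow_Ici {r : ℝ} (hr : 0 < r) (p : ℝ) :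
    ContinuousOn (fun s : ℝ => s ^ p) (Ici r) :=
  fun s hs => (Real.continuousAt_rpow_const s p (Or.inl (hr.trans_le hs).ne')).continuousWithinAt

/-- Tail estimate for integrands dominated by `s^{-1-p}`. -/
lemma abs_integral_le_rpow_neg {r x p b : ℝ} (hr : 0 < r) (hp : 0 < p) (hb : 0 ≤ b) (hx : r ≤ x)
    {g : ℝ → ℝ} (hg : ∀ s ∈ Ioc r x, |g s| ≤ b * s ^ (-1 - p)) :
    |∫ s in r..x, g s| ≤ b / p * r ^ (-p) := by
  have h := LocBdd.abs_integral_le_sub (a := r) (g := g)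
    (F := fun s => -(b / p) * s ^ (-p)) (f := fun s => b * s ^ (-1 - p)) hx
    (fun s hs => by
      refine ((Real.hasDerivAt_rpow_const (p := -p)
        (Or.inl (hr.trans_le hs).ne')).const_mul _).congr_deriv ?_
      rw [show -p - 1 = -1 - p by ring]; field_simp)
    (continuousOn_const.mul (continuousOn_rpow_Ici hr _)) hg
  have : 0 ≤ b / p * x ^ (-p) :=
    mul_nonneg (by positivity) (Real.rpow_nonneg (hr.le.trans hx) _)
  linarith

section RegularSol

variable {rp L α C c D a : ℝ} {G q y : ℝ → ℝ}

lemma IsRadialCoef.hasDerivAt_flux (hrp : 0 < rp) (h : IsRadialCoef rp L α C c G q)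
    (hy : LocBdd rp y) {r : ℝ} (hr : rp < r) :
    HasDerivAt (flux rp D G q y) (r ^ (2 * D - 3) * (redCoef rp D G q r * y r)) r :=
  (h.locBdd_fluxIntegrand hrp hy).hasDerivAt hr

lemma IsRegularSol.locBdd_slope (hrp : 0 < rp) (hc : 0 < c) (hC : 0 ≤ C) (hD0 : 0 < D)
    (hD : D < 3 / 2) (hα : α = (3 / 2 - D) ^ 2 - 3 * (3 / 2 - D))
    (h : IsRadialCoef rp L α C c G q) (hy : IsRegularSol rp D G q a y) :
    LocBdd rp (slope rp D G q y) := by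
  obtain ⟨B, hB⟩ := hy.bdd
  exact h.locBdd_slope hrp hc hC hD0 hD hα hy.cont hB

lemma IsRegularSol.hasDerivAt (hrp : 0 < rp) (hc : 0 < c) (hC : 0 ≤ C) (hD0 : 0 < D)
    (hD : D < 3 / 2) (hα : α = (3 / 2 - D) ^ 2 - 3 * (3 / 2 - D))
    (h : IsRadialCoef rp L α C c G q) (hy : IsRegularSol rp D G q a y) {r : ℝ} (hr : rp < r) :
    HasDerivAt y (slope rp D G q y r) r := by
  refine (((hy.locBdd_slope hrp hc hC hD0 hD hα h).hasDerivAt hr).const_add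
      a).congr_of_eventuallyEq ?_
  filter_upwards [Ioi_mem_nhds hr] with s hs using hy.eq s hs

lemma IsRegularSol.tendsto_horizon (hrp : 0 < rp) (hc : 0 < c) (hC : 0 ≤ C) (hD0 : 0 < D)
    (hD : D < 3 / 2) (hα : α = (3 / 2 - D) ^ 2 - 3 * (3 / 2 - D))
    (h : IsRadialCoef rp L α C c G q) (hy : IsRegularSol rp D G q a y) :
    Tendsto y (𝓝[>] rp) (𝓝 a) := by
  have := ((hy.locBdd_slope hrp hc hC hD0 hD hα h).tendsto_primitive).const_add a
  rw [add_zero] at this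
  refine this.congr' ?_
  filter_upwards [self_mem_nhdsWithin] with s hs using (hy.eq s hs).symm

/-- Uniform bounds for regular solutions and their derivatives. -/
theorem exists_regularSol_bound (hrp : 0 < rp) (hc : 0 < c) (hC : 0 ≤ C) (hD0 : 0 < D)
    (hD : D < 3 / 2) (hα : α = (3 / 2 - D) ^ 2 - 3 * (3 / 2 - D)) :
    ∃ K > 0, ∀ G q, IsRadialCoef rp L α C c G q → ∀ a y, IsRegularSol rp D G q a y →
      ∀ r ∈ Ioi rp, |y r| ≤ K * |a| ∧ |slope rp D G q y r| ≤ K * |a| * r ^ (-1 - D) := by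
  obtain ⟨K, hK, h1⟩ := exists_apriori_bound (L := L) hrp hc hC hD0 hD hα
  obtain ⟨K', hK', h2⟩ := exists_slope_le (L := L) hrp hc hC hD0 hD hα
  refine ⟨K + K' * K, by positivity, fun G q h a y hy r hr => ?_⟩
  have h3 : ∀ r ∈ Ioi rp, |y r| ≤ K * |a| := h1 G q h y hy.bdd |a| fun r hr => by
    rw [hy.eq r hr, add_sub_cancel_right]
  have hr0 : 0 < r := hrp.trans hr
  constructor
  · refine (h3 r hr).trans ?_
    gcongr
    nlinarith
  · refine (h2 G q h y r hr _ fun t ht => h3 t ht.1).trans ?_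
    rw [← mul_assoc]
    gcongr
    linarith

lemma IsRegularSol.eq_zero (hrp : 0 < rp) (hc : 0 < c) (hC : 0 ≤ C) (hD0 : 0 < D)
    (hD : D < 3 / 2) (hα : α = (3 / 2 - D) ^ 2 - 3 * (3 / 2 - D))
    (h : IsRadialCoef rp L α C c G q) (hy : IsRegularSol rp D G q 0 y) {r : ℝ} (hr : rp < r) :
    y r = 0 := by
  obtain ⟨K, hK, h1⟩ := exists_regularSol_bound (L := L) hrp hc hC hD0 hD hα
  simpa using (h1 G q h 0 y hy r hr).1

/-- Regular solutions have a limit at infinity, with a rate. -/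
theorem IsRegularSol.exists_limit (hrp : 0 < rp) (hc : 0 < c) (hC : 0 ≤ C) (hD0 : 0 < D)
    (hD : D < 3 / 2) (hα : α = (3 / 2 - D) ^ 2 - 3 * (3 / 2 - D))
    (h : IsRadialCoef rp L α C c G q) (hy : IsRegularSol rp D G q a y) :
    ∃ F, Tendsto y atTop (𝓝 F) := by
  -- The slope is `O(r^{-1-D})`, hence integrable at infinity.
  obtain ⟨K, hK, h1⟩ := exists_regularSol_bound (L := L) hrp hc hC hD0 hD hα
  have hs := hy.locBdd_slope hrp hc hC hD0 hD hα h
  have hint : IntegrableOn (slope rp D G q y) (Ioi rp) := by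
    refine Integrable.mono' (g := fun s => K * |a| * s ^ (-1 - D))
      ((integrableOn_Ioi_rpow_of_lt (by linarith) hrp).const_mul _)
      (hs.cont.aestronglyMeasurable measurableSet_Ioi) ?_
    exact (ae_restrict_iff' measurableSet_Ioi).2 (ae_of_all _ fun s hs => (h1 G q h a y hy s hs).2)
  refine ⟨_, ((intervalIntegral_tendsto_integral_Ioi rp hint tendsto_id).const_add a).congr' ?_⟩
  filter_upwards [Ioi_mem_atTop rp] with r hr using (hy.eq r hr).symm

lemma IsRegularSol.sub_eq (hrp : 0 < rp) (hc : 0 < c) (hC : 0 ≤ C) (hD0 : 0 < D)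
    (hD : D < 3 / 2) (hα : α = (3 / 2 - D) ^ 2 - 3 * (3 / 2 - D))
    (h : IsRadialCoef rp L α C c G q) (hy : IsRegularSol rp D G q a y) {r x : ℝ} (hr : rp < r)
    (hx : rp < x) :
    y x - y r = ∫ s in r..x, slope rp D G q y s := by
  have hs := hy.locBdd_slope hrp hc hC hD0 hD hα h
  rw [hy.eq x hx, hy.eq r hr, add_sub_add_left_eq_sub,
    intervalIntegral.integral_interval_sub_left (hs.intervalIntegrable le_rfl hx.le)
      (hs.intervalIntegrable le_rfl hr.le)]

theorem exists_regularSol_rate (hrp : 0 < rp) (hc : 0 < c) (hC : 0 ≤ C) (hD0 : 0 < D)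
    (hD : D < 3 / 2) (hα : α = (3 / 2 - D) ^ 2 - 3 * (3 / 2 - D)) :
    ∃ K > 0, ∀ G q, IsRadialCoef rp L α C c G q → ∀ a y, IsRegularSol rp D G q a y →
      ∀ F, Tendsto y atTop (𝓝 F) → ∀ r ∈ Ioi rp, |y r - F| ≤ K * |a| * r ^ (-D) := by
  obtain ⟨K, hK, h1⟩ := exists_regularSol_bound (L := L) hrp hc hC hD0 hD hα
  refine ⟨K / D, by positivity, fun G q h a y hy F hF r hr => ?_⟩
  have h2 : Tendsto (fun x => |y r - y x|) atTop (𝓝 |y r - F|) := (hF.const_sub (y r)).abs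
  refine le_of_tendsto h2 ?_
  filter_upwards [Ici_mem_atTop r] with x hx
  have hx' : r ≤ x := hx
  rw [abs_sub_comm, hy.sub_eq hrp hc hC hD0 hD hα h hr (lt_of_lt_of_le hr hx')]
  refine (abs_integral_le_rpow_neg (b := K * |a|) (hrp.trans hr) hD0 (by positivity) hx'
    fun s hs => (h1 G q h a y hy s (lt_trans hr hs.1)).2).trans_eq ?_
  ring

/-- Regular solutions depend in a Lipschitz way on the coefficients. -/
theorem exists_regularSol_lipschitz (hrp : 0 < rp) (hc : 0 < c) (hC : 0 ≤ C) (hD0 : 0 < D)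
    (hD : D < 3 / 2) (hα : α = (3 / 2 - D) ^ 2 - 3 * (3 / 2 - D)) :
    ∃ K > 0, ∀ G q, IsRadialCoef rp L α C c G q → ∀ G' q', IsRadialCoef rp L α C c G' q' →
      ∀ d, 0 ≤ d → CoefClose rp d G q G' q' →
      ∀ y, IsRegularSol rp D G q 1 y → ∀ y', IsRegularSol rp D G' q' 1 y' →
      ∀ r ∈ Ioi rp, |y r - y' r| ≤ K * d ∧
        |slope rp D G q y r - slope rp D G' q' y' r| ≤ K * d * r ^ (-1 - D) := by
  obtain ⟨K1, hK1, h1⟩ := exists_regularSol_bound (L := L) hrp hc hC hD0 hD hα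
  obtain ⟨K2, hK2, h2⟩ := exists_slope_bound hrp hc hD0 hD
  obtain ⟨K3, hK3, h3⟩ := exists_apriori_bound (L := L) hrp hc hC hD0 hD hα
  obtain ⟨K4, hK4, h4⟩ := exists_slope_le (L := L) hrp hc hC hD0 hD hα
  set M := K2 * (5 * K1) + 3 / (c * rp ^ 2) * K1 with hM
  set N := K3 * (M / D * rp ^ (-D)) with hN
  have hM0 : 0 < M := by positivity
  have hN0 : 0 < N := by positivity
  refine ⟨N + (K4 * N + M), by positivity, fun G q h G' q' h' d hd hclose y hy y' hy' => ?_⟩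
  have hby' : ∀ r ∈ Ioi rp, |y' r| ≤ K1 := fun r hr => by
    simpa using (h1 G' q' h' 1 y' hy' r hr).1
  have hby : ∀ r ∈ Ioi rp, |y r| ≤ K1 := fun r hr => by
    simpa using (h1 G q h 1 y hy r hr).1
  -- First the same function `y'` is inserted in both slope operators. The difference splits into a
  -- change of reduced coefficient and a relative change of `U`; the latter is bounded because `U -
  -- U'` is also `O(r - rp)`.
  have key : ∀ r ∈ Ioi rp, |slope rp D G q y' r - slope rp D G' q' y' r|
      ≤ M * d * r ^ (-1 - D) := by
    intro r hr
    have hr0 : 0 < r := hrp.trans hr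
    have hdr : 0 < r - rp := sub_pos.2 hr
    have hU := h.hprim_pos hrp hc hr
    have hU' := h'.hprim_pos hrp hc hr
    have e1 : flux rp D G q y' r - flux rp D G' q' y' r =
        ∫ t in rp..r, t ^ (2 * D - 3) * ((redCoef rp D G q t - redCoef rp D G' q' t) * y' t) := by
      rw [flux, flux, ← intervalIntegral.integral_sub
        ((h.locBdd_fluxIntegrand hrp hy'.locBdd).intervalIntegrable le_rfl (le_of_lt hr))
        ((h'.locBdd_fluxIntegrand hrp hy'.locBdd).intervalIntegrable le_rfl (le_of_lt hr))]
      congr 1; ext t; ring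
    have e2 : slope rp D G q y' r - slope rp D G' q' y' r =
        r ^ (3 - 2 * D) / (r * hprim rp G r) * (∫ t in rp..r, t ^ (2 * D - 3) *
          ((redCoef rp D G q t - redCoef rp D G' q' t) * y' t)) -
        (hprim rp G r - hprim rp G' r) / hprim rp G r * slope rp D G' q' y' r := by
      rw [← e1, slope, slope]
      field_simp
      ring
    rw [e2]
    refine (abs_sub _ _).trans ?_
    have b1 := h2 (hprim rp G r) r (5 * d * K1)
      (fun t => (redCoef rp D G q t - redCoef rp D G' q' t) * y' t) hr (h.hprim_ge hrp hc hr)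
      fun t ht => by
        rw [abs_mul]
        exact mul_le_mul (hclose.redCoef_le hrp hD0 hD h.locBddG h'.locBddG ht.1) (hby' t ht.1)
          (abs_nonneg _) (by positivity)
    have b2 : |(hprim rp G r - hprim rp G' r) / hprim rp G r| ≤ 3 / (c * rp ^ 2) * d := by
      rw [abs_div, abs_of_pos hU, div_le_iff₀ hU]
      calc |hprim rp G r - hprim rp G' r| ≤ d * (r - rp) := hclose.hprim_le h.locBddG h'.locBddG hr
        _ = 3 / (c * rp ^ 2) * d * (c / 3 * ((r - rp) * rp ^ 2)) := by field_simp
        _ ≤ 3 / (c * rp ^ 2) * d * (c / 3 * ((r - rp) * r ^ 2)) := by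
          gcongr; exact le_of_lt hr
        _ ≤ _ := by gcongr; exact h.hprim_ge hrp hc hr
    have b3 : |slope rp D G' q' y' r| ≤ K1 * r ^ (-1 - D) := by
      simpa using (h1 G' q' h' 1 y' hy' r hr).2
    rw [abs_mul ((hprim rp G r - hprim rp G' r) / hprim rp G r)]
    calc _ ≤ K2 * (5 * d * K1) * r ^ (-1 - D) + 3 / (c * rp ^ 2) * d * (K1 * r ^ (-1 - D)) := by
          gcongr
      _ = _ := by rw [hM]; ring
  have hdiff : ∀ r ∈ Ioi rp, |y r - y' r| ≤ N * d := by
    have hb : ∀ r ∈ Ioi rp, |y r - y' r| ≤ K1 + K1 := fun r hr =>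
      (abs_sub _ _).trans (add_le_add (hby r hr) (hby' r hr))
    -- The difference of the solutions solves the Volterra equation of the first set of coefficients
    -- with a source of size `O(d)`, so the a priori bound applies.
    have := h3 G q h (fun s => y s - y' s) ⟨_, hb⟩ (M / D * rp ^ (-D) * d) fun r hr => by
      have i1 := (h.locBdd_slope hrp hc hC hD0 hD hα hy'.cont hby').intervalIntegrable
        le_rfl (le_of_lt hr)
      have i2 := (h'.locBdd_slope hrp hc hC hD0 hD hα hy'.cont hby').intervalIntegrable
        le_rfl (le_of_lt hr)
      rw [← integral_slope_sub hrp hc hC hD0 hD hα h hy.cont hy'.cont hby hby' (le_of_lt hr)]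
      have e : y r - y' r - ((∫ s in rp..r, slope rp D G q y s) -
          ∫ s in rp..r, slope rp D G q y' s) =
          ∫ s in rp..r, (slope rp D G q y' s - slope rp D G' q' y' s) := by
        rw [intervalIntegral.integral_sub i1 i2]
        linarith [hy.eq r hr, hy'.eq r hr]
      rw [e]
      refine (abs_integral_le_rpow_neg (b := M * d) hrp hD0 (by positivity) (le_of_lt hr)
        fun s hs => key s hs.1).trans_eq ?_
      ring
    intro r hr
    refine (this r hr).trans_eq ?_
    rw [hN]; ring
  intro r hr
  have hr0 : 0 < r := hrp.trans hr
  constructor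
  · refine (hdiff r hr).trans ?_
    gcongr
    linarith [mul_pos hK4 hN0]
  · have e : slope rp D G q y r - slope rp D G' q' y' r =
        slope rp D G q (fun s => y s - y' s) r +
          (slope rp D G q y' r - slope rp D G' q' y' r) := by
      rw [← slope_sub hrp h hy.locBdd hy'.locBdd (le_of_lt hr)]; ring
    rw [e]
    refine (abs_add_le _ _).trans ?_
    have b := h4 G q h (fun s => y s - y' s) r hr (N * d) fun t ht => hdiff t ht.1
    calc _ ≤ K4 * (N * d) * r ^ (-1 - D) + M * d * r ^ (-1 - D) := add_le_add b (key r hr)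
      _ = (K4 * N + M) * d * r ^ (-1 - D) := by ring
      _ ≤ _ := mul_le_mul_of_nonneg_right (mul_le_mul_of_nonneg_right (by linarith) hd)
        (Real.rpow_nonneg hr0.le _)

end RegularSol

/-! ### Back from `y` to the scalar field. -/

/-- The solution `φ = r^{D - 3/2} y` of the radial equation. -/
def radialSol (D : ℝ) (y : ℝ → ℝ) (r : ℝ) : ℝ := r ^ (D - 3 / 2) * y r

/-- The derivative of `radialSol`. -/
def radialDer (rp D : ℝ) (G q y : ℝ → ℝ) (r : ℝ) : ℝ :=
  r ^ (D - 3 / 2) * (slope rp D G q y r + (D - 3 / 2) * (y r / r))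

lemma rpow_weights {r : ℝ} (hr : 0 < r) (D : ℝ) : r ^ (3 / 2 - D) = (r ^ (D - 3 / 2))⁻¹ ∧
    r ^ (3 - 2 * D) = ((r ^ (D - 3 / 2)) ^ 2)⁻¹ ∧ r ^ (2 * D - 3) = (r ^ (D - 3 / 2)) ^ 2 := by
  have h2 : (r ^ (D - 3 / 2)) ^ 2 = r ^ (2 * D - 3) := by
    rw [pow_two, ← Real.rpow_add hr]; congr 1; ring
  refine ⟨?_, ?_, h2.symm⟩
  · rw [← Real.rpow_neg hr.le]; congr 1; ring
  · rw [h2, ← Real.rpow_neg hr.le]; congr 1; ring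

section RadialSol

variable {rp L α C c D a : ℝ} {G q y : ℝ → ℝ}

lemma hasDerivAt_radialSol {r s : ℝ} (hr : 0 < r) (hy : HasDerivAt y s r) :
    HasDerivAt (radialSol D y) (r ^ (D - 3 / 2) * (s + (D - 3 / 2) * (y r / r))) r := by
  refine ((Real.hasDerivAt_rpow_const (p := D - 3 / 2) (Or.inl hr.ne')).mul hy).congr_deriv ?_
  rw [Real.rpow_sub_one hr.ne']
  field_simp
  ring

lemma IsRegularSol.hasDerivAt_radialSol (hrp : 0 < rp) (hc : 0 < c) (hC : 0 ≤ C) (hD0 : 0 < D)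
    (hD : D < 3 / 2) (hα : α = (3 / 2 - D) ^ 2 - 3 * (3 / 2 - D))
    (h : IsRadialCoef rp L α C c G q) (hy : IsRegularSol rp D G q a y) {r : ℝ} (hr : rp < r) :
    HasDerivAt (radialSol D y) (radialDer rp D G q y r) r :=
  HairyBH.hasDerivAt_radialSol (hrp.trans hr) (hy.hasDerivAt hrp hc hC hD0 hD hα h hr)

lemma IsRadialCoef.hasDerivAt_hprim (h : IsRadialCoef rp L α C c G q) {r : ℝ} (hr : rp < r) :
    HasDerivAt (hprim rp G) (G r) r := h.locBddG.hasDerivAt hr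

/-- On the right side `U` no longer occurs in a denominator, so this form can be differentiated
directly and its horizon limit is visible. -/
lemma IsRadialCoef.mul_radialDer (hrp : 0 < rp) (hc : 0 < c)
    (h : IsRadialCoef rp L α C c G q) {r : ℝ} (hr : rp < r) :
    r * hprim rp G r * radialDer rp D G q y r = r ^ (3 / 2 - D) * flux rp D G q y r +
      (D - 3 / 2) * (hprim rp G r * r ^ (D - 3 / 2) * y r) := by
  have hr0 : 0 < r := hrp.trans hr
  have hU := h.hprim_pos hrp hc hr
  obtain ⟨e1, e2, -⟩ := rpow_weights hr0 D
  have hX := Real.rpow_pos_of_pos hr0 (D - 3 / 2)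
  rw [radialDer, slope, e1, e2]
  generalize r ^ (D - 3 / 2) = X at *
  field_simp

/-- A regular `y` gives a solution of the radial equation. -/
lemma IsRegularSol.hasDerivAt_equation (hrp : 0 < rp) (hc : 0 < c) (hC : 0 ≤ C) (hD0 : 0 < D)
    (hD : D < 3 / 2) (hα : α = (3 / 2 - D) ^ 2 - 3 * (3 / 2 - D))
    (h : IsRadialCoef rp L α C c G q) (hy : IsRegularSol rp D G q a y) {r : ℝ} (hr : rp < r) :
    HasDerivAt (fun s => s * hprim rp G s * radialDer rp D G q y s) (q r * radialSol D y r) r := by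
  have hr0 : 0 < r := hrp.trans hr
  have hU := h.hprim_pos hrp hc hr
  have e : (fun s => s * hprim rp G s * radialDer rp D G q y s) =ᶠ[𝓝 r]
      fun s => s ^ (3 / 2 - D) * flux rp D G q y s +
        (D - 3 / 2) * (hprim rp G s * s ^ (D - 3 / 2) * y s) := by
    filter_upwards [Ioi_mem_nhds hr] with s hs using h.mul_radialDer hrp hc hs
  refine HasDerivAt.congr_of_eventuallyEq ?_ e
  have d1 := (Real.hasDerivAt_rpow_const (p := 3 / 2 - D) (Or.inl hr0.ne')).mul
    (h.hasDerivAt_flux (D := D) hrp hy.locBdd hr)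
  have d2 := (((h.hasDerivAt_hprim hr).mul
    (Real.hasDerivAt_rpow_const (p := D - 3 / 2) (Or.inl hr0.ne'))).mul
    (hy.hasDerivAt hrp hc hC hD0 hD hα h hr)).const_mul (D - 3 / 2)
  refine (d1.add d2).congr_deriv ?_
  have hp := Real.rpow_pos_of_pos hr0 (D - 3 / 2)
  obtain ⟨e1, e2, e3⟩ := rpow_weights hr0 D
  simp only [Pi.mul_apply]
  rw [Real.rpow_sub_one hr0.ne', Real.rpow_sub_one hr0.ne', redCoef, slope, radialSol, e1, e2, e3]
  generalize r ^ (D - 3 / 2) = X at *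
  field_simp
  ring

lemma continuousOn_deriv_of_hasDerivAt {S : Set ℝ} {f f' : ℝ → ℝ}
    (h : ∀ r ∈ S, HasDerivAt f (f' r) r) (hf : ContinuousOn f' S) : ContinuousOn (deriv f) S :=
  hf.congr fun r hr => (h r hr).deriv

lemma contDiffOn_two_of_hasDerivAt {S : Set ℝ} (hS : IsOpen S) {f f' f'' : ℝ → ℝ}
    (h : ∀ r ∈ S, HasDerivAt f (f' r) r) (h' : ∀ r ∈ S, HasDerivAt f' (f'' r) r)
    (hf : ContinuousOn f'' S) : ContDiffOn ℝ 2 f S := by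
  have e : ∀ r ∈ S, deriv f r = f' r := fun r hr => (h r hr).deriv
  have h1 : ContDiffOn ℝ 1 f' S := by
    rw [show (1 : WithTop ℕ∞) = 0 + 1 by rfl, contDiffOn_succ_iff_deriv_of_isOpen hS]
    refine ⟨fun r hr => (h' r hr).differentiableAt.differentiableWithinAt, by simp, ?_⟩
    rw [contDiffOn_zero]
    exact continuousOn_deriv_of_hasDerivAt h' hf
  rw [show (2 : WithTop ℕ∞) = 1 + 1 by rfl, contDiffOn_succ_iff_deriv_of_isOpen hS]
  exact ⟨fun r hr => (h r hr).differentiableAt.differentiableWithinAt, by simp, h1.congr e⟩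

lemma IsRegularSol.contDiffOn_radialSol (hrp : 0 < rp) (hc : 0 < c) (hC : 0 ≤ C) (hD0 : 0 < D)
    (hD : D < 3 / 2) (hα : α = (3 / 2 - D) ^ 2 - 3 * (3 / 2 - D))
    (h : IsRadialCoef rp L α C c G q) (hy : IsRegularSol rp D G q a y) :
    ContDiffOn ℝ 2 (radialSol D y) (Ioi rp) := by
  have hP : ∀ r ∈ Ioi rp, r * hprim rp G r ≠ 0 := fun r hr =>
    (mul_pos (hrp.trans hr) (h.hprim_pos hrp hc hr)).ne'
  have hUc : ContinuousOn (hprim rp G) (Ioi rp) := h.locBddG.primitive.cont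
  have hpow : ∀ p : ℝ, ContinuousOn (fun s : ℝ => s ^ p) (Ioi rp) := fun p =>
    (LocBdd.rpow hrp p).cont
  have hslope := (hy.locBdd_slope hrp hc hC hD0 hD hα h).cont
  have hid : ContinuousOn (fun s : ℝ => s) (Ioi rp) := continuousOn_id
  have hφ : ContinuousOn (radialSol D y) (Ioi rp) := (hpow _).mul hy.cont
  have hd : ContinuousOn (radialDer rp D G q y) (Ioi rp) :=
    (hpow _).mul (hslope.add (continuousOn_const.mul
      (hy.cont.div hid fun r hr => (hrp.trans hr).ne')))
  refine contDiffOn_two_of_hasDerivAt isOpen_Ioi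
    (f' := radialDer rp D G q y)
    (f'' := fun r => (q r * radialSol D y r * (r * hprim rp G r) -
      r * hprim rp G r * radialDer rp D G q y r * (1 * hprim rp G r + r * G r)) /
        (r * hprim rp G r) ^ 2)
    (fun r hr => hy.hasDerivAt_radialSol hrp hc hC hD0 hD hα h hr) (fun r hr => ?_) ?_
  · have d := (hy.hasDerivAt_equation hrp hc hC hD0 hD hα h hr).div
      ((hasDerivAt_id r).mul (h.hasDerivAt_hprim hr)) (hP r hr)
    refine d.congr_of_eventuallyEq ?_
    filter_upwards [Ioi_mem_nhds hr] with s hs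
    have := hP s hs
    simp only [Pi.div_apply, Pi.mul_apply, id]
    rw [mul_div_cancel_left₀ _ this]
  · refine ContinuousOn.div ?_ ((hid.mul hUc).pow 2) fun r hr => pow_ne_zero 2 (hP r hr)
    exact ((h.contq.mul hφ).mul (hid.mul hUc)).sub (((hid.mul hUc).mul hd).mul
      ((continuousOn_const.mul hUc).add (hid.mul h.contG)))

/-- The flux of a Dirichlet solution is bounded. -/
lemma IsRegularSol.flux_bounded (hrp : 0 < rp) (hc : 0 < c) (hC : 0 ≤ C) (hD0 : 0 < D)
    (hD : D < 3 / 2) (hα : α = (3 / 2 - D) ^ 2 - 3 * (3 / 2 - D))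
    (h : IsRadialCoef rp L α C c G q) (hy : IsRegularSol rp D G q a y)
    (h0 : Tendsto y atTop (𝓝 0)) :
    ∃ K > 0, (∀ r ∈ Ioi rp, |flux rp D G q y r| ≤ K) ∧
      ∃ v, Tendsto (flux rp D G q y) atTop (𝓝 v) := by
  obtain ⟨K, hK, h1⟩ := exists_regularSol_rate (L := L) hrp hc hC hD0 hD hα
  obtain ⟨M, hM, h2⟩ := exists_redCoef_bound (L := L) hrp hC hα
  -- For a Dirichlet solution the rate gives `y = O(r^{-D})`, so the integrand of the flux is
  -- `O(r^{D-3})`, which is integrable since `D < 2`.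
  have hb : ∀ r ∈ Ioi rp, |r ^ (2 * D - 3) * (redCoef rp D G q r * y r)| ≤
      M * (K * |a|) * r ^ (-1 - (2 - D)) := by
    intro r hr
    have hr0 : 0 < r := hrp.trans hr
    have h3 := h1 G q h a y hy 0 h0 r hr
    rw [sub_zero] at h3
    rw [abs_mul, abs_mul, abs_of_pos (Real.rpow_pos_of_pos hr0 _)]
    calc _ ≤ r ^ (2 * D - 3) * (M * (K * |a| * r ^ (-D))) := by
          gcongr
          exact h2 G q h r hr
      _ = M * (K * |a|) * (r ^ (2 * D - 3) * r ^ (-D)) := by ring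
      _ = _ := by rw [← Real.rpow_add hr0]; congr 2; ring
  have hl := h.locBdd_fluxIntegrand (D := D) hrp hy.locBdd
  refine ⟨M * (K * |a|) / (2 - D) * rp ^ (-(2 - D)) + 1, ?_, fun r hr => ?_, ?_⟩
  · have : 0 < 2 - D := by linarith
    positivity
  · refine (abs_integral_le_rpow_neg hrp (by linarith) (by positivity) (le_of_lt hr)
      fun s hs => hb s hs.1).trans ?_
    linarith
  · have hint : IntegrableOn (fun r => r ^ (2 * D - 3) * (redCoef rp D G q r * y r)) (Ioi rp) := by
      refine Integrable.mono' (g := fun s => M * (K * |a|) * s ^ (-1 - (2 - D)))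
        ((integrableOn_Ioi_rpow_of_lt (by linarith) hrp).const_mul _)
        (hl.cont.aestronglyMeasurable measurableSet_Ioi) ?_
      exact (ae_restrict_iff' measurableSet_Ioi).2 (ae_of_all _ fun s hs => hb s hs)
    exact ⟨_, intervalIntegral_tendsto_integral_Ioi rp hint tendsto_id⟩

/-- Dirichlet solutions decay at the faster rate. -/
lemma IsRegularSol.decay_of_dirichlet (hrp : 0 < rp) (hc : 0 < c) (hC : 0 ≤ C) (hD0 : 0 < D)
    (hD : D < 3 / 2) (hα : α = (3 / 2 - D) ^ 2 - 3 * (3 / 2 - D))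
    (h : IsRadialCoef rp L α C c G q) (hy : IsRegularSol rp D G q a y)
    (h0 : Tendsto y atTop (𝓝 0)) :
    ∃ K > 0, ∀ r, 2 * rp ≤ r → |y r| ≤ K * r ^ (-(2 * D)) := by
  obtain ⟨K, hK, h1, -⟩ := hy.flux_bounded hrp hc hC hD0 hD hα h h0
  refine ⟨K * (6 / c) / (2 * D), by positivity, fun r hr => ?_⟩
  have hr1 : rp < r := by linarith
  have hr0 : 0 < r := hrp.trans hr1
  -- Beyond `2 rp` one has `U ≥ c s³/6`; with a bounded flux the slope is `O(s^{-1-2D})`, and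
  -- integrating from infinity gives the rate `r^{-2D}`.
  have hs : ∀ s ∈ Ici r, |slope rp D G q y s| ≤ K * (6 / c) * s ^ (-1 - 2 * D) := by
    intro s hs
    have hs' : r ≤ s := hs
    have hs1 : rp < s := lt_of_lt_of_le hr1 hs
    have hs0 : 0 < s := hrp.trans hs1
    have hU := h.hprim_pos hrp hc hs1
    have hU' : c / 6 * s ^ 3 ≤ hprim rp G s := by
      refine le_trans ?_ (h.hprim_ge hrp hc hs1)
      have : 0 ≤ c / 6 * s ^ 2 * (s - 2 * rp) := mul_nonneg (by positivity) (by linarith)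
      nlinarith [this]
    have hp := Real.rpow_pos_of_pos hs0 (3 - 2 * D)
    rw [slope, abs_mul, abs_of_pos (by positivity)]
    calc s ^ (3 - 2 * D) / (s * hprim rp G s) * |flux rp D G q y s|
        ≤ s ^ (3 - 2 * D) / (s * (c / 6 * s ^ 3)) * K := by
          gcongr
          exact h1 s hs1
      _ = K * (6 / c) * (s ^ (3 - 2 * D) / s ^ 4) := by field_simp
      _ = _ := by
          rw [← Real.rpow_natCast s 4, ← Real.rpow_sub hs0]
          congr 2; push_cast; ring
  have h2 : Tendsto (fun x => |y x - y r|) atTop (𝓝 |0 - y r|) := (h0.sub_const (y r)).abs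
  rw [zero_sub, abs_neg] at h2
  refine le_of_tendsto h2 ?_
  filter_upwards [Ici_mem_atTop r] with x hx
  have hx' : r ≤ x := hx
  rw [hy.sub_eq hrp hc hC hD0 hD hα h hr1 (lt_of_lt_of_le hr1 hx')]
  exact abs_integral_le_rpow_neg hr0 (by positivity) (by positivity) hx' fun s hsr =>
    hs s (le_of_lt hsr.1)

/-- The flux of any regular solution grows at most like `r^D`. -/
lemma IsRegularSol.flux_growth (hrp : 0 < rp) (hc : 0 < c) (hC : 0 ≤ C) (hD0 : 0 < D)
    (hD : D < 3 / 2) (hα : α = (3 / 2 - D) ^ 2 - 3 * (3 / 2 - D))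
    (h : IsRadialCoef rp L α C c G q) (hy : IsRegularSol rp D G q a y) :
    ∃ K > 0, ∀ r ∈ Ioi rp, |flux rp D G q y r| ≤ K * r ^ D := by
  obtain ⟨K, hK, h1⟩ := exists_regularSol_bound (L := L) hrp hc hC hD0 hD hα
  set N := |L| + (C + |L| * rp ^ 2) / rp ^ 2 with hN
  have hN0 : 0 ≤ N := by positivity
  refine ⟨K * |a| * N + 1, by positivity, fun r hr => ?_⟩
  have hr0 : 0 < r := hrp.trans hr
  have hU := h.hprim_pos hrp hc hr
  have hU' : hprim rp G r ≤ N * r ^ 3 := by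
    have h2 := (abs_le.1 (h.abs_hprim_sub_le hrp hC hr)).2
    have h3 : L * r ^ 3 ≤ |L| * r ^ 3 := by gcongr; exact le_abs_self L
    have h4 : (C + |L| * rp ^ 2) * r ≤ (C + |L| * rp ^ 2) / rp ^ 2 * r ^ 3 := by
      rw [div_mul_eq_mul_div, le_div_iff₀ (by positivity)]
      have : rp ^ 2 ≤ r ^ 2 := pow_le_pow_left₀ hrp.le (le_of_lt hr) 2
      calc (C + |L| * rp ^ 2) * r * rp ^ 2 ≤ (C + |L| * rp ^ 2) * r * r ^ 2 := by gcongr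
        _ = _ := by ring
    rw [hN]; linarith
  have e : flux rp D G q y r = slope rp D G q y r * (r * hprim rp G r) * r ^ (2 * D - 3) := by
    rw [slope, show 2 * D - 3 = -(3 - 2 * D) by ring, Real.rpow_neg hr0.le]
    have := Real.rpow_pos_of_pos hr0 (3 - 2 * D)
    field_simp
  rw [e, abs_mul, abs_mul, abs_of_pos (mul_pos hr0 hU), abs_of_pos (Real.rpow_pos_of_pos hr0 _)]
  calc _ ≤ K * |a| * r ^ (-1 - D) * (r * (N * r ^ 3)) * r ^ (2 * D - 3) := by
        gcongr
        exact (h1 G q h a y hy r hr).2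
    _ = K * |a| * N * (r ^ (-1 - D) * r ^ 4 * r ^ (2 * D - 3)) := by ring
    _ = K * |a| * N * r ^ D := by
        rw [← Real.rpow_natCast r 4, ← Real.rpow_add hr0, ← Real.rpow_add hr0]
        congr 2; push_cast; ring
    _ ≤ _ := by
        have := Real.rpow_pos_of_pos hr0 D
        nlinarith

end RadialSol

/-! ### The Wronskian of two regular solutions. -/

section Wronskian

variable {rp L α C c D a : ℝ} {G q y : ℝ → ℝ}

lemma rpow_neg_one_sub {s : ℝ} (hs : 0 < s) (D : ℝ) : s ^ (-1 - D) = s ^ (-D) / s := by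
  rw [show -1 - D = -D - 1 by ring, Real.rpow_sub_one hs.ne']

lemma abs_radialDer_le (hD0 : 0 < D) (hD : D < 3 / 2) {s A B : ℝ} (hs : 0 < s)
    (hA : |slope rp D G q y s| ≤ A) (hB : |y s| ≤ B) :
    |radialDer rp D G q y s| ≤ s ^ (D - 3 / 2) * (A + 3 / 2 * (B / s)) := by
  have hX := Real.rpow_pos_of_pos hs (D - 3 / 2)
  rw [radialDer, abs_mul, abs_of_pos hX]
  refine mul_le_mul_of_nonneg_left ((abs_add_le _ _).trans (add_le_add hA ?_)) hX.le
  rw [abs_mul, abs_div, abs_of_pos hs]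
  refine mul_le_mul ?_ (by gcongr) (by positivity) (by norm_num)
  rw [abs_le]; constructor <;> linarith

lemma radialDer_sub {s : ℝ} {G' q' y' : ℝ → ℝ} :
    radialDer rp D G q y s - radialDer rp D G' q' y' s = s ^ (D - 3 / 2) *
      ((slope rp D G q y s - slope rp D G' q' y' s) + (D - 3 / 2) * ((y s - y' s) / s)) := by
  rw [radialDer, radialDer]; ring

lemma abs_radialDer_sub_le (hD0 : 0 < D) (hD : D < 3 / 2) {s A B : ℝ} (hs : 0 < s)
    {G' q' y' : ℝ → ℝ} (hA : |slope rp D G q y s - slope rp D G' q' y' s| ≤ A)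
    (hB : |y s - y' s| ≤ B) :
    |radialDer rp D G q y s - radialDer rp D G' q' y' s| ≤
      s ^ (D - 3 / 2) * (A + 3 / 2 * (B / s)) := by
  have hX := Real.rpow_pos_of_pos hs (D - 3 / 2)
  rw [radialDer_sub, abs_mul, abs_of_pos hX]
  refine mul_le_mul_of_nonneg_left ((abs_add_le _ _).trans (add_le_add hA ?_)) hX.le
  rw [abs_mul, abs_div, abs_of_pos hs]
  refine mul_le_mul ?_ (by gcongr) (by positivity) (by norm_num)
  rw [abs_le]; constructor <;> linarith

/-- The Wronskian of two solutions of radial equations with different coefficients. -/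
def wronskian (rp D : ℝ) (G q y G' q' y' : ℝ → ℝ) (r : ℝ) : ℝ :=
  r * hprim rp G r * radialDer rp D G q y r * radialSol D y' r -
    r * hprim rp G' r * radialDer rp D G' q' y' r * radialSol D y r

/-- The derivative of the Wronskian. -/
def wronskianDer (rp D : ℝ) (G q y G' q' y' : ℝ → ℝ) (r : ℝ) : ℝ :=
  (q r - q' r) * (radialSol D y r * radialSol D y' r) +
    r * (hprim rp G r - hprim rp G' r) * (radialDer rp D G q y r * radialDer rp D G' q' y' r)

variable {G' q' y' : ℝ → ℝ}

lemma hasDerivAt_wronskian (hrp : 0 < rp) (hc : 0 < c) (hC : 0 ≤ C) (hD0 : 0 < D)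
    (hD : D < 3 / 2) (hα : α = (3 / 2 - D) ^ 2 - 3 * (3 / 2 - D))
    (h : IsRadialCoef rp L α C c G q) (h' : IsRadialCoef rp L α C c G' q')
    (hy : IsRegularSol rp D G q 1 y) (hy' : IsRegularSol rp D G' q' 1 y') {r : ℝ} (hr : rp < r) :
    HasDerivAt (wronskian rp D G q y G' q' y') (wronskianDer rp D G q y G' q' y' r) r := by
  have d := ((hy.hasDerivAt_equation hrp hc hC hD0 hD hα h hr).mul
    (hy'.hasDerivAt_radialSol hrp hc hC hD0 hD hα h' hr)).sub
    ((hy'.hasDerivAt_equation hrp hc hC hD0 hD hα h' hr).mul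
    (hy.hasDerivAt_radialSol hrp hc hC hD0 hD hα h hr))
  refine d.congr_deriv ?_
  rw [wronskianDer]; ring

/-- Written with fluxes, the Wronskian has limits at both ends that can be read off, whereas
`radialDer` does not show the cancellation of the common terms in `U`. -/
lemma wronskian_eq (hrp : 0 < rp) (hc : 0 < c) (h : IsRadialCoef rp L α C c G q)
    (h' : IsRadialCoef rp L α C c G' q') {r : ℝ} (hr : rp < r) :
    wronskian rp D G q y G' q' y' r = flux rp D G q y r * y' r - flux rp D G' q' y' r * y r +
      (D - 3 / 2) * ((hprim rp G r - hprim rp G' r) * r ^ (2 * D - 3) * (y r * y' r)) := by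
  have hr0 : 0 < r := hrp.trans hr
  rw [wronskian, h.mul_radialDer hrp hc hr, h'.mul_radialDer hrp hc hr, radialSol, radialSol]
  obtain ⟨e1, -, e3⟩ := rpow_weights hr0 D
  have hX := Real.rpow_pos_of_pos hr0 (D - 3 / 2)
  rw [e1, e3]
  generalize r ^ (D - 3 / 2) = X at *
  field_simp
  ring

lemma tendsto_wronskian_horizon (hrp : 0 < rp) (hc : 0 < c) (hC : 0 ≤ C) (hD0 : 0 < D)
    (hD : D < 3 / 2) (hα : α = (3 / 2 - D) ^ 2 - 3 * (3 / 2 - D))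
    (h : IsRadialCoef rp L α C c G q) (h' : IsRadialCoef rp L α C c G' q')
    (hy : IsRegularSol rp D G q 1 y) (hy' : IsRegularSol rp D G' q' 1 y') :
    Tendsto (wronskian rp D G q y G' q' y') (𝓝[>] rp) (𝓝 0) := by
  have t1 := hy.tendsto_horizon hrp hc hC hD0 hD hα h
  have t2 := hy'.tendsto_horizon hrp hc hC hD0 hD hα h'
  have f1 : Tendsto (flux rp D G q y) (𝓝[>] rp) (𝓝 0) :=
    (h.locBdd_fluxIntegrand hrp hy.locBdd).tendsto_primitive
  have f2 : Tendsto (flux rp D G' q' y') (𝓝[>] rp) (𝓝 0) :=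
    (h'.locBdd_fluxIntegrand hrp hy'.locBdd).tendsto_primitive
  have u1 : Tendsto (hprim rp G) (𝓝[>] rp) (𝓝 0) := h.locBddG.tendsto_primitive
  have u2 : Tendsto (hprim rp G') (𝓝[>] rp) (𝓝 0) := h'.locBddG.tendsto_primitive
  have p : Tendsto (fun r : ℝ => r ^ (2 * D - 3)) (𝓝[>] rp) (𝓝 (rp ^ (2 * D - 3))) :=
    (Real.continuousAt_rpow_const rp _ (Or.inl hrp.ne')).tendsto.mono_left nhdsWithin_le_nhds
  have t := ((f1.mul t2).sub (f2.mul t1)).add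
    ((((u1.sub u2).mul p).mul (t1.mul t2)).const_mul (D - 3 / 2))
  simp only [zero_mul, sub_zero, mul_zero, add_zero] at t
  refine t.congr' ?_
  filter_upwards [self_mem_nhdsWithin] with r hr using (wronskian_eq hrp hc h h' hr).symm

/-- At infinity the Wronskian with a Dirichlet solution sees the coefficient of the growing mode. -/
lemma tendsto_wronskian_atTop (hrp : 0 < rp) (hc : 0 < c) (hC : 0 ≤ C) (hD0 : 0 < D)
    (hD : D < 3 / 2) (hα : α = (3 / 2 - D) ^ 2 - 3 * (3 / 2 - D))
    (h : IsRadialCoef rp L α C c G q) (h' : IsRadialCoef rp L α C c G' q')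
    (hy : IsRegularSol rp D G q 1 y) (hy' : IsRegularSol rp D G' q' 1 y') {F v d : ℝ}
    (hd : CoefClose rp d G q G' q') (hd0 : 0 ≤ d)
    (hF : Tendsto y atTop (𝓝 F)) (h0 : Tendsto y' atTop (𝓝 0))
    (hv : Tendsto (flux rp D G' q' y') atTop (𝓝 v)) :
    Tendsto (wronskian rp D G q y G' q' y') atTop (𝓝 (-(v * F))) := by
  obtain ⟨K, hK, hdec⟩ := hy'.decay_of_dirichlet hrp hc hC hD0 hD hα h' h0
  obtain ⟨M, hM, hgr⟩ := hy.flux_growth hrp hc hC hD0 hD hα h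
  -- Growth `r^D` of one flux against decay `r^{-2D}` of the Dirichlet solution.
  have t1 : Tendsto (fun r => flux rp D G q y r * y' r) atTop (𝓝 0) := by
    refine squeeze_zero_norm' (a := fun r => M * K * r ^ (-D)) ?_
      (by simpa using (tendsto_rpow_neg_atTop hD0).const_mul (M * K))
    filter_upwards [Ici_mem_atTop (2 * rp)] with r hr
    have hr' : 2 * rp ≤ r := hr
    have hr1 : rp < r := by linarith
    have hr0 : 0 < r := hrp.trans hr1
    rw [Real.norm_eq_abs, abs_mul]
    calc _ ≤ M * r ^ D * (K * r ^ (-(2 * D))) :=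
          mul_le_mul (hgr r hr1) (hdec r hr') (abs_nonneg _) (by positivity)
      _ = M * K * (r ^ D * r ^ (-(2 * D))) := by ring
      _ = _ := by rw [← Real.rpow_add hr0]; congr 2; ring
  -- The cubic parts of the two `U` agree, so their difference is `O(r)` and the product is
  -- `O(r^{-2})`.
  have t2 : Tendsto (fun r => (hprim rp G r - hprim rp G' r) * r ^ (2 * D - 3) * y' r) atTop
      (𝓝 0) := by
    refine squeeze_zero_norm' (a := fun r => d * K * r ^ (-2 : ℝ)) ?_
      (by simpa using (tendsto_rpow_neg_atTop (y := 2) (by norm_num)).const_mul (d * K))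
    filter_upwards [Ici_mem_atTop (2 * rp)] with r hr
    have hr' : 2 * rp ≤ r := hr
    have hr1 : rp < r := by linarith
    have hr0 : 0 < r := hrp.trans hr1
    rw [Real.norm_eq_abs, abs_mul, abs_mul, abs_of_pos (Real.rpow_pos_of_pos hr0 _)]
    calc _ ≤ d * r * r ^ (2 * D - 3) * (K * r ^ (-(2 * D))) := by
          gcongr
          · exact (hd.hprim_le h.locBddG h'.locBddG hr1).trans (by gcongr; linarith)
          · exact hdec r hr'
      _ = d * K * (r ^ (1 : ℝ) * r ^ (2 * D - 3) * r ^ (-(2 * D))) := by rw [Real.rpow_one]; ring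
      _ = _ := by rw [← Real.rpow_add hr0, ← Real.rpow_add hr0]; congr 2; ring
  have t := (t1.sub (hv.mul hF)).add ((t2.mul hF).const_mul (D - 3 / 2))
  simp only [zero_mul, zero_sub, mul_zero, add_zero] at t
  refine t.congr' ?_
  filter_upwards [Ioi_mem_atTop rp] with r hr
  rw [wronskian_eq hrp hc h h' hr]; ring

lemma IsRegularSol.locBdd_radialDer (hrp : 0 < rp) (hc : 0 < c) (hC : 0 ≤ C) (hD0 : 0 < D)
    (hD : D < 3 / 2) (hα : α = (3 / 2 - D) ^ 2 - 3 * (3 / 2 - D))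
    (h : IsRadialCoef rp L α C c G q) (hy : IsRegularSol rp D G q a y) :
    LocBdd rp (radialDer rp D G q y) :=
  (LocBdd.rpow hrp _).mul ((hy.locBdd_slope hrp hc hC hD0 hD hα h).add
    ((LocBdd.const _).mul (hy.locBdd.mul (locBdd_inv hrp))))

lemma IsRegularSol.locBdd_radialSol (hrp : 0 < rp) (hy : IsRegularSol rp D G q a y) :
    LocBdd rp (radialSol D y) :=
  (LocBdd.rpow hrp _).mul hy.locBdd

/-- A Dirichlet solution has positive kinetic energy. -/
lemma IsRegularSol.exists_kinetic_pos (hrp : 0 < rp) (hc : 0 < c) (hC : 0 ≤ C) (hD0 : 0 < D)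
    (hD : D < 3 / 2) (hα : α = (3 / 2 - D) ^ 2 - 3 * (3 / 2 - D))
    (h : IsRadialCoef rp L α C c G q) (hy : IsRegularSol rp D G q 1 y)
    (h0 : Tendsto y atTop (𝓝 0)) :
    ∃ R > rp, ∃ k > 0, ∀ r, R ≤ r →
      k ≤ ∫ s in rp..r, (s - rp) / rp * radialDer rp D G q y s ^ 2 := by
  set k0 : ℝ → ℝ := fun s => (s - rp) / rp * radialDer rp D G q y s ^ 2 with hk0
  have hl : LocBdd rp k0 := (LocBdd.of_continuousOn (by fun_prop)).mul
    ((hy.locBdd_radialDer hrp hc hC hD0 hD hα h).pow 2)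
  have hnn : ∀ s, rp ≤ s → 0 ≤ k0 s := fun s hs =>
    mul_nonneg (div_nonneg (sub_nonneg.2 hs) hrp.le) (sq_nonneg _)
  have hmono : ∀ r x, rp ≤ r → r ≤ x → ∫ s in rp..r, k0 s ≤ ∫ s in rp..x, k0 s := by
    intro r x hr hx
    rw [← intervalIntegral.integral_add_adjacent_intervals (hl.intervalIntegrable le_rfl hr)
      (hl.intervalIntegrable hr (hr.trans hx))]
    exact le_add_of_nonneg_right (intervalIntegral.integral_nonneg hx fun s hs =>
      hnn s (hr.trans hs.1))
  -- The integral is nondecreasing in `r`; if it had no positive lower bound it would vanish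
  -- identically. Then `φ' = 0`, so `φ` is constant, equal to its limit `0` at infinity,
  -- contradicting `y → 1` at the horizon.
  by_contra hcon
  push Not at hcon
  have hzero : ∀ r, rp < r → ∫ s in rp..r, k0 s = 0 := by
    intro r hr
    refine le_antisymm ?_ (intervalIntegral.integral_nonneg hr.le fun s hs => hnn s hs.1)
    by_contra hpos
    obtain ⟨x, hx, hlt⟩ := hcon r hr _ (not_le.1 hpos)
    exact absurd (hmono r x hr.le hx) (not_le.2 hlt)
  have hder : ∀ r, rp < r → radialDer rp D G q y r = 0 := by
    intro r hr
    have d1 := hl.hasDerivAt hr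
    have d2 : HasDerivAt (fun u => ∫ s in rp..u, k0 s) 0 r :=
      (hasDerivAt_const r (0 : ℝ)).congr_of_eventuallyEq (by
        filter_upwards [Ioi_mem_nhds hr] with s hs using hzero s hs)
    have := d1.unique d2
    have hp : 0 < (r - rp) / rp := div_pos (sub_pos.2 hr) hrp
    simpa [hk0, hp.ne'] using this
  have hconst : ∀ r x, rp < r → rp < x → radialSol D y r = radialSol D y x := by
    intro r x hr hx
    refine isOpen_Ioi.is_const_of_deriv_eq_zero isPreconnected_Ioi (s := Ioi rp) ?_ ?_ hr hx
    · exact fun s hs => (hy.hasDerivAt_radialSol hrp hc hC hD0 hD hα h hs).differentiableAt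
        |>.differentiableWithinAt
    · intro s hs
      rw [(hy.hasDerivAt_radialSol hrp hc hC hD0 hD hα h hs).deriv, hder s hs]; rfl
  have hinf : Tendsto (radialSol D y) atTop (𝓝 0) := by
    have := (tendsto_rpow_neg_atTop (y := 3 / 2 - D) (by linarith)).mul h0
    rw [mul_zero, neg_sub] at this
    exact this
  have hall : ∀ r, rp < r → radialSol D y r = 0 := by
    intro r hr
    refine tendsto_nhds_unique (tendsto_const_nhds.congr' ?_) hinf
    filter_upwards [Ioi_mem_atTop rp] with x hx using hconst r x hr hx
  have hy0 : ∀ r, rp < r → y r = 0 := fun r hr => by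
    have := hall r hr
    have hp := (Real.rpow_pos_of_pos (hrp.trans hr) (D - 3 / 2)).ne'
    simpa [radialSol, hp] using this
  have := hy.tendsto_horizon hrp hc hC hD0 hD hα h
  refine one_ne_zero (tendsto_nhds_unique (this.congr' ?_) (tendsto_const_nhds (x := (0 : ℝ))))
  filter_upwards [self_mem_nhdsWithin] with r hr using hy0 r hr

end Wronskian

/-! ### Transversal crossing of the Dirichlet condition. -/

section Transversality

variable {rp L α C c D : ℝ}

lemma CoefClose.trans {d d' : ℝ} {G q G' q' G'' q'' : ℝ → ℝ} (h : CoefClose rp d G q G' q')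
    (h' : CoefClose rp d' G' q' G'' q'') : CoefClose rp (d + d') G q G'' q'' := fun s hs =>
  ⟨(abs_sub_le _ (G' s) _).trans (add_le_add (h s hs).1 (h' s hs).1),
    (abs_sub_le _ (q' s) _).trans (add_le_add (h s hs).2 (h' s hs).2)⟩

lemma CoefClose.mono {d d' : ℝ} {G q G' q' : ℝ → ℝ} (h : CoefClose rp d G q G' q')
    (hd : d ≤ d') : CoefClose rp d' G q G' q' := fun s hs =>
  ⟨(h s hs).1.trans hd, (h s hs).2.trans hd⟩

/-- Variation of the primitive when `G` changes by `-t / s²`. -/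
lemma hprim_sub_of_charge (hrp : 0 < rp) {t : ℝ} {G G' : ℝ → ℝ} (hG : LocBdd rp G)
    (hG' : LocBdd rp G') (h : ∀ s ∈ Ioi rp, G s - G' s = -t / s ^ 2) {r : ℝ} (hr : rp < r) :
    r * (hprim rp G r - hprim rp G' r) = -t * ((r - rp) / rp) := by
  have e : hprim rp G r - hprim rp G' r = t / r - t / rp := by
    rw [hprim, hprim, ← intervalIntegral.integral_sub (hG.intervalIntegrable le_rfl hr.le)
      (hG'.intervalIntegrable le_rfl hr.le)]
    refine (hG.sub hG').integral_eq (F := fun s => t / s) hr (fun s hs => ?_) ?_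
    · have := (hasDerivAt_inv (hrp.trans hs).ne').const_mul t
      rw [h s hs]
      refine (this.congr_deriv ?_).congr_of_eventuallyEq ?_
      · ring
      · exact Eventually.of_forall fun x => div_eq_mul_inv _ _
    · exact (continuousAt_const.div continuousAt_id hrp.ne').tendsto.mono_left nhdsWithin_le_nhds
  rw [e]
  have := hrp.trans hr
  field_simp
  ring

/-- Pure arithmetic for `exists_wronskianDer_le`. Here `φ, ψ` stand for the perturbed solution and
its derivative, `φ₀, ψ₀` for the Dirichlet pair, `b` for the change of `q` with the charge, and `a,
u` for the changes due to the source. The first term has a favourable sign; each other term contains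
two small factors besides the leading `t`, or one factor `ν`. -/
lemma wronskian_terms_le {rp s t ν d K₀ K1 K2 E N0 N1 N2 X Y φ φ₀ ψ ψ₀ a b u : ℝ} (hrp : 0 < rp)
    (hs : rp < s) (hν : 0 ≤ ν) (ht : |t| ≤ 1) (hd : d = |t| + ν) (hK₀ : 0 ≤ K₀) (hK1 : 0 ≤ K1)
    (hK2 : 0 ≤ K2) (hE : 0 ≤ E) (hN0 : 0 ≤ N0) (hN1 : 0 ≤ N1) (hN2 : 0 ≤ N2) (hX : 0 ≤ X)
    (hY : 0 ≤ Y) (f1 : |φ| ≤ K1 * X) (f0 : |φ₀| ≤ K2 * (X * Y)) (f2 : |φ - φ₀| ≤ E * d * X)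
    (p1 : |ψ| ≤ N1 * (X / s)) (p0 : |ψ₀| ≤ N0 * (X * Y / s)) (p2 : |ψ - ψ₀| ≤ N2 * d * (X / s))
    (v1 : |a| ≤ K₀ * ν) (v2 : t * b ≤ 0) (v3 : |b| ≤ K₀ * |t|) (u1 : |u| ≤ K₀ * ν * (s - rp)) :
    t * b * φ₀ ^ 2 + t * a * (φ * φ₀) + t * b * ((φ - φ₀) * φ₀) + t * (s * u) * (ψ * ψ₀) +
      -t ^ 2 * ((s - rp) / rp) * ((ψ - ψ₀) * ψ₀) ≤
    (K₀ * (K1 * K2) + 2 * (K₀ * (K2 * E)) + K₀ * (N1 * N0) + 2 / rp ^ 2 * (N0 * N2)) *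
      (|t| * (t ^ 2 + ν)) * (X ^ 2 * Y) := by
  have hs0 : 0 < s := hrp.trans hs
  have hsrp : 0 < s - rp := sub_pos.2 hs
  have hd0 : 0 ≤ d := by rw [hd]; positivity
  -- This brings every error to the common size `|t| (t² + ν)`, which is what survives division by
  -- `t`.
  have hdt : |t| * (|t| * d) ≤ 2 * (|t| * (t ^ 2 + ν)) := by
    have h1 : |t| * ν ≤ 1 * ν := by gcongr
    have h2 : |t| * |t| = t ^ 2 := by rw [← pow_two, sq_abs]
    have h3 : |t| * d ≤ 2 * (t ^ 2 + ν) := by rw [hd, mul_add, h2]; nlinarith [sq_nonneg t]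
    calc |t| * (|t| * d) ≤ |t| * (2 * (t ^ 2 + ν)) := by gcongr
      _ = _ := by ring
  have hνt : |t| * ν ≤ |t| * (t ^ 2 + ν) := by gcongr; nlinarith [sq_nonneg t]
  have T1 : t * b * φ₀ ^ 2 ≤ 0 :=
    mul_nonpos_of_nonpos_of_nonneg v2 (sq_nonneg _)
  have T2 : t * a * (φ * φ₀) ≤
      K₀ * (K1 * K2) * (|t| * (t ^ 2 + ν)) * (X ^ 2 * Y) := by
    refine (le_abs_self _).trans ?_
    rw [abs_mul, abs_mul, abs_mul]
    calc |t| * |a| * (|φ| * |φ₀|)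
        ≤ |t| * (K₀ * ν) * (K1 * X * (K2 * (X * Y))) := by gcongr
      _ = K₀ * (K1 * K2) * (|t| * ν) * (X ^ 2 * Y) := by ring
      _ ≤ _ := by gcongr
  have T3 : t * b * ((φ - φ₀) * φ₀) ≤
      2 * (K₀ * (K2 * (E))) * (|t| * (t ^ 2 + ν)) * (X ^ 2 * Y) := by
    refine (le_abs_self _).trans ?_
    rw [abs_mul, abs_mul, abs_mul]
    calc |t| * |b| * (|φ - φ₀| * |φ₀|)
        ≤ |t| * (K₀ * |t|) * (E * d * X * (K2 * (X * Y))) := by gcongr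
      _ = K₀ * (K2 * (E)) * (|t| * (|t| * d)) * (X ^ 2 * Y) := by ring
      _ ≤ K₀ * (K2 * (E)) * (2 * (|t| * (t ^ 2 + ν))) * (X ^ 2 * Y) := by gcongr
      _ = _ := by ring
  have T4 : t * (s * u) *
      (ψ * ψ₀) ≤
      K₀ * (N1 * N0) * (|t| * (t ^ 2 + ν)) * (X ^ 2 * Y) := by
    refine (le_abs_self _).trans ?_
    rw [abs_mul, abs_mul, abs_mul, abs_mul, abs_of_pos hs0]
    calc |t| * (s * |u|) *
        (|ψ| * |ψ₀|)
        ≤ |t| * (s * (K₀ * ν * s)) * (N1 * (X / s) * (N0 * (X * Y / s))) := by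
          gcongr
          refine u1.trans ?_
          gcongr
          linarith
      _ = K₀ * (N1 * N0) * (|t| * ν) * (X ^ 2 * Y) := by
          have e1 : s * s * (X / s * (X * Y / s)) = X ^ 2 * Y := by field_simp
          linear_combination (|t| * (K₀ * ν) * N1 * N0) * e1
      _ ≤ _ := by gcongr
  have T5 : -t ^ 2 * ((s - rp) / rp) * ((ψ - ψ₀) *
      ψ₀) ≤
      2 / rp ^ 2 * (N0 * N2) * (|t| * (t ^ 2 + ν)) * (X ^ 2 * Y) := by
    refine (le_abs_self _).trans ?_
    rw [abs_mul, abs_mul, abs_mul, abs_neg, abs_of_pos (div_pos hsrp hrp), abs_pow]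
    calc |t| ^ 2 * ((s - rp) / rp) * (|ψ - ψ₀| *
        |ψ₀|)
        ≤ |t| ^ 2 * (s / rp * (s / rp)) * (N2 * d * (X / s) * (N0 * (X * Y / s))) := by
          gcongr
          have h1 : 1 ≤ s / rp := by rw [le_div_iff₀ hrp, one_mul]; exact le_of_lt hs
          have h2 : (s - rp) / rp ≤ s / rp := by gcongr; linarith
          nlinarith
      _ = 1 / rp ^ 2 * (N0 * N2) * (|t| * (|t| * d)) * (X ^ 2 * Y) := by
          have e1 : s / rp * (s / rp) * (X / s * (X * Y / s)) = 1 / rp ^ 2 * (X ^ 2 * Y) := by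
            field_simp
          linear_combination (|t| ^ 2 * N2 * d * N0) * e1
      _ ≤ 1 / rp ^ 2 * (N0 * N2) * (2 * (|t| * (t ^ 2 + ν))) * (X ^ 2 * Y) := by gcongr
      _ = _ := by ring
  linarith

/-- Pointwise estimate of the derivative of the Wronskian near a Dirichlet solution. -/
lemma exists_wronskianDer_le (hrp : 0 < rp) (hc : 0 < c) (hC : 0 ≤ C) (hD0 : 0 < D)
    (hD : D < 3 / 2) (hα : α = (3 / 2 - D) ^ 2 - 3 * (3 / 2 - D)) {G₀ q₀ y₀ : ℝ → ℝ}
    (h₀ : IsRadialCoef rp L α C c G₀ q₀) (hy₀ : IsRegularSol rp D G₀ q₀ 1 y₀)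
    (hlim : Tendsto y₀ atTop (𝓝 0)) {K₀ : ℝ} (hK₀ : 0 ≤ K₀) :
    ∃ K > 0, ∀ t ν, 0 ≤ ν → |t| ≤ 1 → ∀ Gs qs : ℝ → ℝ, LocBdd rp Gs →
      (∀ s ∈ Ioi rp, Gs s - G₀ s = -t / s ^ 2) →
      (∀ s ∈ Ioi rp, t * (qs s - q₀ s) ≤ 0 ∧ |qs s - q₀ s| ≤ K₀ * |t|) →
      ∀ G q, IsRadialCoef rp L α C c G q → CoefClose rp (K₀ * ν) G q Gs qs →
      ∀ y, IsRegularSol rp D G q 1 y → ∀ s ∈ Ioi rp,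
        t * wronskianDer rp D G q y G₀ q₀ y₀ s ≤
          -t ^ 2 * ((s - rp) / rp * radialDer rp D G₀ q₀ y₀ s ^ 2) +
            K * (|t| * (t ^ 2 + ν)) * s ^ (-1 - (2 - D)) := by
  obtain ⟨K1, hK1, hb⟩ := exists_regularSol_bound (L := L) hrp hc hC hD0 hD hα
  obtain ⟨K2, hK2, hr⟩ := exists_regularSol_rate (L := L) hrp hc hC hD0 hD hα
  obtain ⟨K3, hK3, hl⟩ := exists_regularSol_lipschitz (L := L) hrp hc hC hD0 hD hα
  set e := K₀ + 1 / rp ^ 2 with he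
  have he0 : 0 < e := by positivity
  set N1 := K1 * rp ^ (-D) + 3 / 2 * K1 with hN1
  set N0 := K1 + 3 / 2 * K2 with hN0
  set N2 := K3 * e * rp ^ (-D) + 3 / 2 * (K3 * e) with hN2
  have hN1' : 0 < N1 := by positivity
  have hN0' : 0 < N0 := by positivity
  have hN2' : 0 < N2 := by positivity
  refine ⟨K₀ * (K1 * K2) + 2 * (K₀ * (K2 * (K3 * e))) + K₀ * (N1 * N0) + 2 / rp ^ 2 * (N0 * N2),
    by positivity, fun t ν hν ht Gs qs hGs hG hq G q h hclose y hy s hs => ?_⟩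
  have hs0 : 0 < s := hrp.trans hs
  have hsrp : 0 < s - rp := sub_pos.2 hs
  set d := |t| + ν with hd
  have hd0 : 0 ≤ d := by positivity
  have hcs : CoefClose rp ((K₀ + 1 / rp ^ 2) * |t|) Gs qs G₀ q₀ := fun x hx => by
    have hx0 : 0 < x := hrp.trans hx
    constructor
    · rw [hG x hx, abs_div, abs_neg, abs_of_pos (pow_pos hx0 2)]
      calc |t| / x ^ 2 ≤ |t| / rp ^ 2 := by gcongr; exact le_of_lt hx
        _ = 1 / rp ^ 2 * |t| := by ring
        _ ≤ _ := by gcongr; linarith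
    · refine (hq x hx).2.trans ?_
      gcongr
      have : 0 < 1 / rp ^ 2 := by positivity
      linarith
  have hc0 : CoefClose rp (e * d) G q G₀ q₀ := (hclose.trans hcs).mono (by
    have : 0 < 1 / rp ^ 2 := by positivity
    have h1 : K₀ * ν ≤ e * ν := by gcongr; linarith
    rw [hd]; linarith)
  have hX := Real.rpow_pos_of_pos hs0 (D - 3 / 2)
  have hY := Real.rpow_pos_of_pos hs0 (-D)
  have hYrp : s ^ (-D) ≤ rp ^ (-D) := Real.rpow_le_rpow_of_nonpos hrp (le_of_lt hs) (by linarith)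
  -- The product of a slow mode `X` and a Dirichlet mode `X Y` decays like `s^{D-3}`, which makes
  -- the error integrable.
  have hw : s ^ (-1 - (2 - D)) = (s ^ (D - 3 / 2)) ^ 2 * s ^ (-D) := by
    rw [pow_two, ← Real.rpow_add hs0, ← Real.rpow_add hs0]; congr 1; ring
  have b1 : |y s| ≤ K1 := by simpa using (hb G q h 1 y hy s hs).1
  have b1' : |slope rp D G q y s| ≤ K1 * (s ^ (-D) / s) := by
    simpa [rpow_neg_one_sub hs0] using (hb G q h 1 y hy s hs).2
  have b0 : |y₀ s| ≤ K2 * s ^ (-D) := by simpa using hr G₀ q₀ h₀ 1 y₀ hy₀ 0 hlim s hs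
  have b0' : |slope rp D G₀ q₀ y₀ s| ≤ K1 * (s ^ (-D) / s) := by
    simpa [rpow_neg_one_sub hs0] using (hb G₀ q₀ h₀ 1 y₀ hy₀ s hs).2
  obtain ⟨b2, b2'⟩ := hl G q h G₀ q₀ h₀ (e * d) (by positivity) hc0 y hy y₀ hy₀ s hs
  rw [rpow_neg_one_sub hs0] at b2'
  have p1 := abs_radialDer_le hD0 hD hs0 b1' b1
  have p0 := abs_radialDer_le hD0 hD hs0 b0' b0
  have p2 := abs_radialDer_sub_le hD0 hD hs0 b2' b2
  have u1 := hclose.hprim_le h.locBddG hGs hs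
  have u2 := hprim_sub_of_charge hrp hGs h₀.locBddG hG hs
  have v1 := (hclose s hs).2
  obtain ⟨v2, v3⟩ := hq s hs
  rw [hw]
  set X := s ^ (D - 3 / 2) with hXd
  set Y := s ^ (-D) with hYd
  have p1' : |radialDer rp D G q y s| ≤ N1 * (X / s) := by
    refine p1.trans ?_
    calc X * (K1 * (Y / s) + 3 / 2 * (K1 / s)) ≤ X * (K1 * (rp ^ (-D) / s) + 3 / 2 * (K1 / s)) := by
          gcongr
      _ = _ := by rw [hN1]; ring
  have p0' : |radialDer rp D G₀ q₀ y₀ s| ≤ N0 * (X * Y / s) := by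
    refine p0.trans_eq ?_
    rw [hN0]; ring
  have p2' : |radialDer rp D G q y s - radialDer rp D G₀ q₀ y₀ s| ≤ N2 * d * (X / s) := by
    refine p2.trans ?_
    calc X * (K3 * (e * d) * (Y / s) + 3 / 2 * (K3 * (e * d) / s))
        ≤ X * (K3 * (e * d) * (rp ^ (-D) / s) + 3 / 2 * (K3 * (e * d) / s)) := by gcongr
      _ = _ := by rw [hN2]; ring
  have f1 : |radialSol D y s| ≤ K1 * X := by
    rw [radialSol, abs_mul, abs_of_pos hX, mul_comm]; gcongr
  have f0 : |radialSol D y₀ s| ≤ K2 * (X * Y) := by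
    rw [radialSol, abs_mul, abs_of_pos hX]
    calc X * |y₀ s| ≤ X * (K2 * Y) := by gcongr
      _ = _ := by ring
  have f2 : |radialSol D y s - radialSol D y₀ s| ≤ K3 * e * d * X := by
    rw [radialSol, radialSol, ← mul_sub, abs_mul, abs_of_pos hX]
    calc X * |y s - y₀ s| ≤ X * (K3 * (e * d)) := by gcongr
      _ = _ := by ring
  -- Each product is expanded about the Dirichlet solution, and the coefficients about the
  -- intermediate Reissner–Nordström values `Gs`, `qs`. The only definite term kept is the kinetic
  -- one, from the charge dependence of `U`.
  have decomp : t * wronskianDer rp D G q y G₀ q₀ y₀ s =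
      -t ^ 2 * ((s - rp) / rp * radialDer rp D G₀ q₀ y₀ s ^ 2) +
      t * (qs s - q₀ s) * radialSol D y₀ s ^ 2 +
      t * (q s - qs s) * (radialSol D y s * radialSol D y₀ s) +
      t * (qs s - q₀ s) * ((radialSol D y s - radialSol D y₀ s) * radialSol D y₀ s) +
      t * (s * (hprim rp G s - hprim rp Gs s)) *
        (radialDer rp D G q y s * radialDer rp D G₀ q₀ y₀ s) +
      -t ^ 2 * ((s - rp) / rp) * ((radialDer rp D G q y s - radialDer rp D G₀ q₀ y₀ s) *
        radialDer rp D G₀ q₀ y₀ s) := by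
    rw [wronskianDer]
    linear_combination (t * (radialDer rp D G q y s * radialDer rp D G₀ q₀ y₀ s)) * u2
  have := wronskian_terms_le hrp hs hν ht hd hK₀ hK1.le hK2.le (by positivity : 0 ≤ K3 * e) hN0'.le
    hN1'.le hN2'.le hX.le hY.le f1 f0 f2 p1' p0' p2' v1 v2 v3 u1
  rw [decomp]
  linarith

/-- The coefficient of the growing mode crosses zero transversally as the charge varies. -/
theorem exists_transversality (hrp : 0 < rp) (hc : 0 < c) (hC : 0 ≤ C) (hD0 : 0 < D)
    (hD : D < 3 / 2) (hα : α = (3 / 2 - D) ^ 2 - 3 * (3 / 2 - D)) {G₀ q₀ y₀ : ℝ → ℝ}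
    (h₀ : IsRadialCoef rp L α C c G₀ q₀) (hy₀ : IsRegularSol rp D G₀ q₀ 1 y₀)
    (hlim : Tendsto y₀ atTop (𝓝 0)) {K₀ : ℝ} (hK₀ : 0 ≤ K₀) :
    ∃ v : ℝ, ∃ k > 0, ∃ K > 0, ∀ t ν, 0 ≤ ν → |t| ≤ 1 → ∀ Gs qs : ℝ → ℝ, LocBdd rp Gs →
      (∀ s ∈ Ioi rp, Gs s - G₀ s = -t / s ^ 2) →
      (∀ s ∈ Ioi rp, t * (qs s - q₀ s) ≤ 0 ∧ |qs s - q₀ s| ≤ K₀ * |t|) →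
      ∀ G q, IsRadialCoef rp L α C c G q → CoefClose rp (K₀ * ν) G q Gs qs →
      ∀ y, IsRegularSol rp D G q 1 y → ∀ F, Tendsto y atTop (𝓝 F) →
        t * (v * F) ≤ -k * t ^ 2 + K * (|t| * (t ^ 2 + ν)) := by
  obtain ⟨K, hK, hW⟩ := exists_wronskianDer_le (L := L) hrp hc hC hD0 hD hα h₀ hy₀ hlim hK₀
  obtain ⟨R, hR, k, hk, hkin⟩ := hy₀.exists_kinetic_pos hrp hc hC hD0 hD hα h₀ hlim
  obtain ⟨-, -, -, v, hv⟩ := hy₀.flux_bounded hrp hc hC hD0 hD hα h₀ hlim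
  have hp : 0 < 2 - D := by linarith
  -- The sign comes from the limit `-v F` of the Wronskian at infinity. Its horizon value is zero,
  -- so the limit is the full integral of the derivative.
  refine ⟨-v, k, hk, K / (2 - D) * rp ^ (-(2 - D)), by positivity,
    fun t ν hν ht Gs qs hGs hG hq G q h hclose y hy F hF => ?_⟩
  have hcs : CoefClose rp (K₀ * ν + (K₀ + 1 / rp ^ 2) * |t|) G q G₀ q₀ :=
    hclose.trans fun x hx => by
    have hx0 : 0 < x := hrp.trans hx
    have : 0 < 1 / rp ^ 2 := by positivity
    constructor
    · rw [hG x hx, abs_div, abs_neg, abs_of_pos (pow_pos hx0 2)]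
      calc |t| / x ^ 2 ≤ |t| / rp ^ 2 := by gcongr; exact le_of_lt hx
        _ = 1 / rp ^ 2 * |t| := by ring
        _ ≤ _ := by gcongr; linarith
    · refine (hq x hx).2.trans ?_
      gcongr
      linarith
  have tW := tendsto_wronskian_atTop hrp hc hC hD0 hD hα h h₀ hy hy₀ hcs (by positivity) hF hlim hv
  have lU : LocBdd rp fun r => r * (hprim rp G r - hprim rp G₀ r) :=
    (LocBdd.of_continuousOn continuousOn_id).mul (h.locBddG.primitive.sub h₀.locBddG.primitive)
  have lW : LocBdd rp (wronskianDer rp D G q y G₀ q₀ y₀) :=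
    ((h.locBddq.sub h₀.locBddq).mul ((hy.locBdd_radialSol hrp).mul (hy₀.locBdd_radialSol hrp))).add
      (lU.mul ((hy.locBdd_radialDer hrp hc hC hD0 hD hα h).mul
        (hy₀.locBdd_radialDer hrp hc hC hD0 hD hα h₀)))
  have lk : LocBdd rp fun s => (s - rp) / rp * radialDer rp D G₀ q₀ y₀ s ^ 2 :=
    (LocBdd.of_continuousOn (by fun_prop)).mul
      ((hy₀.locBdd_radialDer hrp hc hC hD0 hD hα h₀).pow 2)
  set B := K * (|t| * (t ^ 2 + ν)) with hB
  have hB0 : 0 ≤ B := by positivity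
  have lr : LocBdd rp fun s => B * s ^ (-1 - (2 - D)) := (LocBdd.const _).mul (LocBdd.rpow hrp _)
  have hfin : ∀ r, R ≤ r → t * wronskian rp D G q y G₀ q₀ y₀ r ≤
      -k * t ^ 2 + B / (2 - D) * rp ^ (-(2 - D)) := by
    intro r hr
    have hr1 : rp < r := lt_of_lt_of_le hR hr
    have e := lW.integral_eq hr1
      (fun s hs => hasDerivAt_wronskian hrp hc hC hD0 hD hα h h₀ hy hy₀ hs)
      (tendsto_wronskian_horizon hrp hc hC hD0 hD hα h h₀ hy hy₀)
    rw [sub_zero] at e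
    rw [← e, ← intervalIntegral.integral_const_mul]
    refine (((LocBdd.const t).mul lW).integral_mono (((LocBdd.const (-t ^ 2)).mul lk).add lr)
      hr1.le fun s hs => hW t ν hν ht Gs qs hGs hG hq G q h hclose y hy s hs.1).trans ?_
    rw [intervalIntegral.integral_add (((LocBdd.const (-t ^ 2)).mul lk).intervalIntegrable le_rfl
      hr1.le) (lr.intervalIntegrable le_rfl hr1.le), intervalIntegral.integral_const_mul]
    have h1 := hkin r hr
    have h2 : ∫ s in rp..r, B * s ^ (-1 - (2 - D)) ≤ B / (2 - D) * rp ^ (-(2 - D)) :=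
      (le_abs_self _).trans (abs_integral_le_rpow_neg hrp hp hB0 hr1.le fun s hs => by
        rw [abs_of_nonneg]
        exact mul_nonneg hB0 (Real.rpow_nonneg (hrp.trans hs.1).le _))
    have h3 := mul_le_mul_of_nonneg_left h1 (sq_nonneg t)
    linarith
  have := le_of_tendsto (tW.const_mul t)
    (eventually_atTop.2 ⟨R, fun r hr => hfin r hr⟩)
  rw [hB] at this
  calc t * (-v * F) = t * -(v * F) := by ring
    _ ≤ _ := this
    _ = _ := by ring

end Transversality

/-! ### Metric functions of a background as functionals of its profile. -/

/-- The derivative of `r Ω² / κ` in terms of `κ`, `Q` and `b = f²`. -/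
def metricDer (L α : ℝ) (κ Q b : ℝ → ℝ) (s : ℝ) : ℝ :=
  κ s * (1 - Q s ^ 2 / s ^ 2 + 3 * L * s ^ 2 - L * α * s ^ 2 * b s)

/-- The electric potential vanishing at the horizon. -/
def gaugePot (rp : ℝ) (κ Q : ℝ → ℝ) (r : ℝ) : ℝ := ∫ s in rp..r, κ s * Q s / s ^ 2

/-- `r² κ A / Ω²`. -/
def gaugeRatio (rp L α : ℝ) (κ Q b : ℝ → ℝ) (r : ℝ) : ℝ :=
  r ^ 3 * gaugePot rp κ Q r / hprim rp (metricDer L α κ Q b) r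

/-- The zeroth order coefficient of the Klein–Gordon equation. -/
def massCoef (rp L α q₀ : ℝ) (κ Q w : ℝ → ℝ) (s : ℝ) : ℝ :=
  L * α * s ^ 2 * κ s - q₀ ^ 2 * (gaugePot rp κ Q s * w s)

/-- Bounds on the functions `κ`, `Q` and `b = f²` of a background. -/
structure IsProfile (rp L α c E : ℝ) (κ Q b : ℝ → ℝ) : Prop where
  contκ : ContinuousOn κ (Ioi rp)
  contQ : ContinuousOn Q (Ioi rp)
  contb : ContinuousOn b (Ioi rp)
  κ_pos : ∀ s ∈ Ioi rp, 0 < κ s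
  κ_le : ∀ s ∈ Ioi rp, κ s ≤ 1
  κ_asymp : ∀ s ∈ Ioi rp, (1 - κ s) * s ^ 2 ≤ 1
  Q_le : ∀ s ∈ Ioi rp, |Q s| ≤ E
  b_nonneg : ∀ s ∈ Ioi rp, 0 ≤ b s
  b_le : ∀ s ∈ Ioi rp, s ^ 2 * b s ≤ 1
  lower : ∀ s ∈ Ioi rp, c * s ^ 2 ≤ metricDer L α κ Q b s

section Profile

variable {rp L α c E q₀ : ℝ} {κ Q b w : ℝ → ℝ}

namespace IsProfile

lemma locBddκ (h : IsProfile rp L α c E κ Q b) : LocBdd rp κ :=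
  locBdd_of_bdd h.contκ (B := 1) fun s hs => by rw [abs_of_pos (h.κ_pos s hs)]; exact h.κ_le s hs

lemma locBddQ (h : IsProfile rp L α c E κ Q b) : LocBdd rp Q := locBdd_of_bdd h.contQ h.Q_le

lemma locBdd_potInt (hrp : 0 < rp) (h : IsProfile rp L α c E κ Q b) :
    LocBdd rp fun s => κ s * Q s / s ^ 2 := by
  simpa [div_eq_mul_inv] using (h.locBddκ.mul h.locBddQ).mul ((locBdd_inv hrp).pow 2)

lemma cont_metricDer (hrp : 0 < rp) (h : IsProfile rp L α c E κ Q b) :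
    ContinuousOn (metricDer L α κ Q b) (Ioi rp) := by
  refine h.contκ.mul (ContinuousOn.sub (ContinuousOn.add (continuousOn_const.sub
    ((h.contQ.pow 2).div (continuousOn_id.pow 2) fun s hs => (pow_pos (hrp.trans hs) 2).ne'))
    (by fun_prop)) (ContinuousOn.mul (by fun_prop) h.contb))

end IsProfile

lemma abs_integral_inv_sq_le (hrp : 0 < rp) {g : ℝ → ℝ} {K r : ℝ} (hr : rp ≤ r)
    (hg : ∀ s ∈ Ioc rp r, |g s| ≤ K / s ^ 2) :
    |∫ s in rp..r, g s| ≤ K * ((r - rp) / (rp * r)) := by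
  have h := LocBdd.abs_integral_le_sub (a := rp) (g := g) (F := fun s => -K * s⁻¹)
    (f := fun s => K / s ^ 2) hr
    (fun s hs => ((hasDerivAt_inv (hrp.trans_le hs).ne').const_mul (-K)).congr_deriv (by ring))
    (continuousOn_const.div (continuousOn_id.pow 2)
      fun s hs => (pow_pos (hrp.trans_le hs) 2).ne') hg
  refine h.trans_eq ?_
  have := hrp.trans_le hr
  field_simp
  ring

lemma IsProfile.abs_bracket_le (hrp : 0 < rp) (hL : 0 < L) (h : IsProfile rp L α c E κ Q b) {s : ℝ}
    (hs : s ∈ Ioi rp) : |1 - Q s ^ 2 / s ^ 2 - L * α * s ^ 2 * b s| ≤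
      1 + E ^ 2 / rp ^ 2 + L * |α| := by
  have hs0 : 0 < s := hrp.trans hs
  have h1 : Q s ^ 2 / s ^ 2 ≤ E ^ 2 / rp ^ 2 := by
    rw [← sq_abs (Q s)]
    have := h.Q_le s hs
    have h3 : rp ≤ s := le_of_lt hs
    gcongr
  have h2 : |L * α * s ^ 2 * b s| ≤ L * |α| := by
    rw [mul_assoc (L * α), abs_mul, abs_mul, abs_of_pos hL,
      abs_of_nonneg (mul_nonneg (sq_nonneg s) (h.b_nonneg s hs))]
    exact mul_le_of_le_one_right (by positivity) (h.b_le s hs)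
  have h3 : 0 ≤ Q s ^ 2 / s ^ 2 := by positivity
  rw [abs_le] at *
  constructor <;> linarith [h2.1, h2.2]

/-- `(r - rp)/(rp r)` is the exact integral of `s^{-2}`. Keeping it, and not just a constant,
matters: its zero at the horizon offsets that of `U` in the gauge ratio. -/
lemma IsProfile.abs_gaugePot_le (hrp : 0 < rp) (h : IsProfile rp L α c E κ Q b) {r : ℝ}
    (hr : rp < r) : |gaugePot rp κ Q r| ≤ E * ((r - rp) / (rp * r)) := by
  refine abs_integral_inv_sq_le hrp hr.le fun s hs => ?_
  have hs0 : 0 < s := hrp.trans hs.1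
  rw [abs_div, abs_mul, abs_of_pos (h.κ_pos s hs.1), abs_of_pos (pow_pos hs0 2)]
  gcongr
  calc κ s * |Q s| ≤ 1 * E := mul_le_mul (h.κ_le s hs.1) (h.Q_le s hs.1) (abs_nonneg _) zero_le_one
    _ = E := one_mul E

lemma IsProfile.abs_gaugePot_le' (hrp : 0 < rp) (h : IsProfile rp L α c E κ Q b) {r : ℝ}
    (hr : rp < r) : |gaugePot rp κ Q r| ≤ E / rp := by
  have hE : 0 ≤ E := (abs_nonneg _).trans (h.Q_le r hr)
  refine (h.abs_gaugePot_le hrp hr).trans ?_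
  have hr0 := hrp.trans hr
  rw [div_eq_mul_one_div E]
  refine mul_le_mul_of_nonneg_left ?_ hE
  rw [div_le_div_iff₀ (by positivity) hrp]
  nlinarith

/-- Uniform asymptotics of the coefficients of the Klein–Gordon equation. -/
lemma exists_isRadialCoef (hrp : 0 < rp) (hL : 0 < L) (hE : 0 ≤ E) (q₀ : ℝ) (B : ℝ) (hB : 0 ≤ B) :
    ∃ C > 0, ∀ κ Q b w, IsProfile rp L α c E κ Q b → ContinuousOn w (Ioi rp) →
      (∀ s ∈ Ioi rp, |w s| ≤ B) →
      IsRadialCoef rp L α C c (metricDer L α κ Q b) (massCoef rp L α q₀ κ Q w) := by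
  refine ⟨3 * L + (1 + E ^ 2 / rp ^ 2 + L * |α|) + L * |α| + q₀ ^ 2 * (E / rp * B), by positivity,
    fun κ Q b w h hw hwB => ⟨h.cont_metricDer hrp, ?_, fun s hs => ?_, h.lower, fun s hs => ?_⟩⟩
  · exact (ContinuousOn.mul (by fun_prop) h.contκ).sub (continuousOn_const.mul
      ((h.locBdd_potInt hrp).primitive.cont.mul hw))
  · have e : metricDer L α κ Q b s - 3 * L * s ^ 2 = -(3 * L * ((1 - κ s) * s ^ 2)) +
        κ s * (1 - Q s ^ 2 / s ^ 2 - L * α * s ^ 2 * b s) := by rw [metricDer]; ring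
    have h1 : |κ s * (1 - Q s ^ 2 / s ^ 2 - L * α * s ^ 2 * b s)| ≤
        1 * (1 + E ^ 2 / rp ^ 2 + L * |α|) := by
      rw [abs_mul, abs_of_pos (h.κ_pos s hs)]
      exact mul_le_mul (h.κ_le s hs) (h.abs_bracket_le hrp hL hs) (abs_nonneg _) zero_le_one
    have h2 : |-(3 * L * ((1 - κ s) * s ^ 2))| ≤ 3 * L := by
      rw [abs_neg, abs_mul, abs_of_pos (by positivity : (0 : ℝ) < 3 * L), abs_of_nonneg
        (mul_nonneg (sub_nonneg.2 (h.κ_le s hs)) (sq_nonneg s))]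
      exact mul_le_of_le_one_right (by positivity) (h.κ_asymp s hs)
    rw [e]
    refine (abs_add_le _ _).trans ?_
    have : 0 ≤ L * |α| + q₀ ^ 2 * (E / rp * B) := by positivity
    linarith
  · have e : massCoef rp L α q₀ κ Q w s - L * α * s ^ 2 = -(L * α * ((1 - κ s) * s ^ 2)) -
        q₀ ^ 2 * (gaugePot rp κ Q s * w s) := by rw [massCoef]; ring
    have h1 : |q₀ ^ 2 * (gaugePot rp κ Q s * w s)| ≤ q₀ ^ 2 * (E / rp * B) := by
      rw [abs_mul, abs_of_nonneg (sq_nonneg q₀), abs_mul]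
      gcongr
      · exact h.abs_gaugePot_le' hrp hs
      · exact hwB s hs
    have h2 : |-(L * α * ((1 - κ s) * s ^ 2))| ≤ L * |α| := by
      rw [abs_neg, abs_mul, abs_mul, abs_of_pos hL, abs_of_nonneg
        (mul_nonneg (sub_nonneg.2 (h.κ_le s hs)) (sq_nonneg s))]
      exact mul_le_of_le_one_right (by positivity) (h.κ_asymp s hs)
    rw [e]
    refine (abs_sub _ _).trans ?_
    have : 0 ≤ 3 * L + (1 + E ^ 2 / rp ^ 2 + L * |α|) := by positivity
    linarith

lemma IsProfile.hprim_ge (hrp : 0 < rp) (hL : 0 < L) (hc : 0 < c)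
    (h : IsProfile rp L α c E κ Q b) {r : ℝ} (hr : rp < r) :
    c / 3 * ((r - rp) * r ^ 2) ≤ hprim rp (metricDer L α κ Q b) r := by
  obtain ⟨C, -, hC⟩ := exists_isRadialCoef (α := α) (c := c) hrp hL
    ((abs_nonneg _).trans (h.Q_le r hr)) 0 0 le_rfl
  exact (hC κ Q b (fun _ => 0) h continuousOn_const (by simp)).hprim_ge hrp hc hr

lemma IsProfile.locBdd_metricDer (hrp : 0 < rp) (hL : 0 < L)
    (h : IsProfile rp L α c E κ Q b) : LocBdd rp (metricDer L α κ Q b) := by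
  obtain ⟨C, -, hC⟩ := exists_isRadialCoef (α := α) (c := c) hrp hL
    ((abs_nonneg _).trans (h.Q_le (rp + 1) (by simp))) 0 0 le_rfl
  exact (hC κ Q b (fun _ => 0) h continuousOn_const (by simp)).locBddG

lemma IsProfile.continuousOn_gaugeRatio (hrp : 0 < rp) (hL : 0 < L) (hc : 0 < c)
    (h : IsProfile rp L α c E κ Q b) : ContinuousOn (gaugeRatio rp L α κ Q b) (Ioi rp) := by
  refine ContinuousOn.div (ContinuousOn.mul (by fun_prop) (h.locBdd_potInt hrp).primitive.cont)
    (h.locBdd_metricDer hrp hL).primitive.cont fun r hr => ?_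
  have := h.hprim_ge hrp hL hc hr
  have h0 : 0 < r - rp := sub_pos.2 hr
  have h1 : 0 < r := hrp.trans hr
  exact (lt_of_lt_of_le (by positivity) this).ne'

/-- The simple zeros of `A` and `U` cancel, and the powers of `r` balance at infinity. This bound
does not involve `w`, so it supplies the invariant ball of the fixed-point argument. -/
lemma IsProfile.abs_gaugeRatio_le (hrp : 0 < rp) (hL : 0 < L) (hc : 0 < c)
    (h : IsProfile rp L α c E κ Q b) {r : ℝ} (hr : rp < r) :
    |gaugeRatio rp L α κ Q b r| ≤ 3 * E / (c * rp) := by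
  have hU := h.hprim_ge hrp hL hc hr
  have hA := h.abs_gaugePot_le hrp hr
  have h0 : 0 < r - rp := sub_pos.2 hr
  have h1 : 0 < r := hrp.trans hr
  have hE : 0 ≤ E := (abs_nonneg _).trans (h.Q_le r hr)
  have hU0 : 0 < hprim rp (metricDer L α κ Q b) r := lt_of_lt_of_le (by positivity) hU
  rw [gaugeRatio, abs_div, abs_mul, abs_of_pos hU0, abs_of_pos (pow_pos h1 3)]
  calc r ^ 3 * |gaugePot rp κ Q r| / hprim rp (metricDer L α κ Q b) r
      ≤ r ^ 3 * (E * ((r - rp) / (rp * r))) / (c / 3 * ((r - rp) * r ^ 2)) := by gcongr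
    _ = _ := by field_simp

/-- Two profiles at distance at most `d`. -/
def ProfileClose (rp d : ℝ) (κ Q b κ' Q' b' : ℝ → ℝ) : Prop :=
  ∀ s ∈ Ioi rp, |κ s - κ' s| * s ^ 2 ≤ d ∧ |Q s - Q' s| ≤ d ∧ |b s - b' s| * s ^ 2 ≤ d

/-- The coefficients depend in a Lipschitz way on the profile. -/
lemma exists_profile_lipschitz (hrp : 0 < rp) (hL : 0 < L) (hc : 0 < c) (hE : 0 ≤ E) (q₀ : ℝ) :
    ∃ K > 0, ∀ κ Q b, IsProfile rp L α c E κ Q b → ∀ κ' Q' b', IsProfile rp L α c E κ' Q' b' →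
      ∀ d, 0 ≤ d → ProfileClose rp d κ Q b κ' Q' b' → ∀ r ∈ Ioi rp,
        |metricDer L α κ Q b r - metricDer L α κ' Q' b' r| ≤ K * d ∧
        |gaugeRatio rp L α κ Q b r - gaugeRatio rp L α κ' Q' b' r| ≤ K * d ∧
        |massCoef rp L α q₀ κ Q (gaugeRatio rp L α κ Q b) r -
          massCoef rp L α q₀ κ' Q' (gaugeRatio rp L α κ' Q' b') r| ≤ K * d := by
  set M := 3 * L + (1 + E ^ 2 / rp ^ 2 + L * |α|) / rp ^ 2 with hM
  set K1 := M + (2 * E / rp ^ 2 + L * |α|) with hK1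
  set K2 := E / rp ^ 2 + 1 with hK2
  set B := 3 * E / (c * rp) with hB
  set K3 := 3 * K2 / (c * rp) + B * (3 * K1 / (c * rp ^ 2)) with hK3
  set K4 := L * |α| + q₀ ^ 2 * (K2 / rp * B + E / rp * K3) with hK4
  have hM0 : 0 ≤ M := by positivity
  have hK10 : 0 ≤ K1 := by positivity
  have hK20 : 0 ≤ K2 := by positivity
  have hB0 : 0 ≤ B := by positivity
  have hK30 : 0 ≤ K3 := by positivity
  have hK40 : 0 ≤ K4 := by positivity
  refine ⟨K1 + K3 + K4 + 1, by positivity, fun κ Q b h κ' Q' b' h' d hd hcl => ?_⟩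
  have a1 : ∀ s ∈ Ioi rp, |metricDer L α κ Q b s - metricDer L α κ' Q' b' s| ≤ K1 * d := by
    intro s hs
    have hs0 : 0 < s := hrp.trans hs
    have hrs : rp ^ 2 ≤ s ^ 2 := pow_le_pow_left₀ hrp.le (le_of_lt hs) 2
    obtain ⟨c1, c2, c3⟩ := hcl s hs
    -- The change of `κ` multiplies a bracket of size `s²`, which is why closeness of profiles
    -- carries the weight `s²` on `κ`.
    have e : metricDer L α κ Q b s - metricDer L α κ' Q' b' s =
        (κ s - κ' s) * (3 * L * s ^ 2 + (1 - Q s ^ 2 / s ^ 2 - L * α * s ^ 2 * b s)) +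
        κ' s * (-((Q s - Q' s) * (Q s + Q' s) / s ^ 2) - L * α * ((b s - b' s) * s ^ 2)) := by
      rw [metricDer, metricDer]; ring
    have t1 : |3 * L * s ^ 2 + (1 - Q s ^ 2 / s ^ 2 - L * α * s ^ 2 * b s)| ≤ M * s ^ 2 := by
      refine (abs_add_le _ _).trans ?_
      have h1 := h.abs_bracket_le hrp hL hs
      have h2 : 1 + E ^ 2 / rp ^ 2 + L * |α| ≤ (1 + E ^ 2 / rp ^ 2 + L * |α|) / rp ^ 2 * s ^ 2 := by
        rw [div_mul_eq_mul_div, le_div_iff₀ (by positivity)]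
        gcongr
      rw [abs_of_nonneg (by positivity), hM]
      linarith
    have t2 : |-((Q s - Q' s) * (Q s + Q' s) / s ^ 2) - L * α * ((b s - b' s) * s ^ 2)| ≤
        (2 * E / rp ^ 2 + L * |α|) * d := by
      refine (abs_sub _ _).trans ?_
      have h1 : |-((Q s - Q' s) * (Q s + Q' s) / s ^ 2)| ≤ d * (2 * E) / rp ^ 2 := by
        rw [abs_neg, abs_div, abs_mul, abs_of_pos (pow_pos hs0 2)]
        have : |Q s + Q' s| ≤ 2 * E :=
          (abs_add_le _ _).trans (by linarith [h.Q_le s hs, h'.Q_le s hs])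
        gcongr
      have h2 : |L * α * ((b s - b' s) * s ^ 2)| ≤ L * |α| * d := by
        rw [abs_mul, abs_mul, abs_of_pos hL, abs_mul, abs_of_pos (pow_pos hs0 2)]
        gcongr
      calc _ ≤ d * (2 * E) / rp ^ 2 + L * |α| * d := add_le_add h1 h2
        _ = _ := by ring
    rw [e]
    refine (abs_add_le _ _).trans ?_
    rw [abs_mul, abs_mul, abs_of_pos (h'.κ_pos s hs)]
    have t3 : |κ s - κ' s| * |3 * L * s ^ 2 + (1 - Q s ^ 2 / s ^ 2 - L * α * s ^ 2 * b s)| ≤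
        M * d := by
      calc _ ≤ |κ s - κ' s| * (M * s ^ 2) := by gcongr
        _ = M * (|κ s - κ' s| * s ^ 2) := by ring
        _ ≤ _ := by gcongr
    have t4 : κ' s * |-((Q s - Q' s) * (Q s + Q' s) / s ^ 2) - L * α * ((b s - b' s) * s ^ 2)| ≤
        (2 * E / rp ^ 2 + L * |α|) * d :=
      (mul_le_of_le_one_left (abs_nonneg _) (h'.κ_le s hs)).trans t2
    rw [hK1]; linarith
  have a2 : ∀ r ∈ Ioi rp, |gaugePot rp κ Q r - gaugePot rp κ' Q' r| ≤
      K2 * d * ((r - rp) / (rp * r)) := by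
    intro r hr
    have hr' : rp ≤ r := le_of_lt hr
    rw [gaugePot, gaugePot, ← intervalIntegral.integral_sub
      ((h.locBdd_potInt hrp).intervalIntegrable le_rfl hr')
      ((h'.locBdd_potInt hrp).intervalIntegrable le_rfl hr')]
    refine abs_integral_inv_sq_le hrp hr' fun s hs => ?_
    have hs0 : 0 < s := hrp.trans hs.1
    have hrs : rp ^ 2 ≤ s ^ 2 := pow_le_pow_left₀ hrp.le hs.1.le 2
    obtain ⟨c1, c2, -⟩ := hcl s hs.1
    have c1' : |κ s - κ' s| ≤ d / rp ^ 2 := by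
      rw [le_div_iff₀ (by positivity)]
      exact (mul_le_mul_of_nonneg_left hrs (abs_nonneg _)).trans c1
    rw [← sub_div, abs_div, abs_of_pos (pow_pos hs0 2)]
    gcongr
    have e : κ s * Q s - κ' s * Q' s = (κ s - κ' s) * Q s + κ' s * (Q s - Q' s) := by ring
    rw [e]
    refine (abs_add_le _ _).trans ?_
    rw [abs_mul, abs_mul, abs_of_pos (h'.κ_pos s hs.1)]
    calc |κ s - κ' s| * |Q s| + κ' s * |Q s - Q' s| ≤ d / rp ^ 2 * E + 1 * d := by
          gcongr
          · exact h.Q_le s hs.1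
          · exact h'.κ_le s hs.1
      _ = _ := by rw [hK2]; ring
  have a2' : ∀ r ∈ Ioi rp, |gaugePot rp κ Q r - gaugePot rp κ' Q' r| ≤ K2 * d / rp := by
    intro r hr
    have hr0 : 0 < r := hrp.trans hr
    refine (a2 r hr).trans ?_
    rw [div_eq_mul_one_div (K2 * d)]
    refine mul_le_mul_of_nonneg_left ?_ (by positivity)
    rw [div_le_div_iff₀ (by positivity) hrp]
    nlinarith
  have a3 : ∀ r ∈ Ioi rp, |gaugeRatio rp L α κ Q b r - gaugeRatio rp L α κ' Q' b' r| ≤ K3 * d := by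
    intro r hr
    have hU := h.hprim_ge hrp hL hc hr
    have hU' := h'.hprim_ge hrp hL hc hr
    have h0 : 0 < r - rp := sub_pos.2 hr
    have h1 : 0 < r := hrp.trans hr
    have hrs : rp ^ 2 ≤ r ^ 2 := pow_le_pow_left₀ hrp.le (le_of_lt hr) 2
    have hU0 : 0 < hprim rp (metricDer L α κ Q b) r := lt_of_lt_of_le (by positivity) hU
    have hU0' : 0 < hprim rp (metricDer L α κ' Q' b') r := lt_of_lt_of_le (by positivity) hU'
    -- Difference of quotients, arranged so that each difference vanishing like `r - rp` stands over
    -- a single factor `U`.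
    have e : gaugeRatio rp L α κ Q b r - gaugeRatio rp L α κ' Q' b' r =
        r ^ 3 * (gaugePot rp κ Q r - gaugePot rp κ' Q' r) / hprim rp (metricDer L α κ Q b) r -
        gaugeRatio rp L α κ' Q' b' r * ((hprim rp (metricDer L α κ Q b) r -
          hprim rp (metricDer L α κ' Q' b') r) / hprim rp (metricDer L α κ Q b) r) := by
      rw [gaugeRatio, gaugeRatio]
      field_simp
      ring
    have hclG : CoefClose rp (K1 * d) (metricDer L α κ Q b) (fun _ => 0) (metricDer L α κ' Q' b')
        (fun _ => 0) := fun s hs => ⟨a1 s hs, by simpa using mul_nonneg hK10 hd⟩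
    have t1 := hclG.hprim_le (h.locBdd_metricDer hrp hL) (h'.locBdd_metricDer hrp hL) hr
    rw [e]
    refine (abs_sub _ _).trans ?_
    rw [abs_div, abs_mul, abs_mul, abs_div, abs_of_pos hU0, abs_of_pos (pow_pos h1 3)]
    have t2 : r ^ 3 * |gaugePot rp κ Q r - gaugePot rp κ' Q' r| /
        hprim rp (metricDer L α κ Q b) r ≤ 3 * K2 / (c * rp) * d := by
      calc _ ≤ r ^ 3 * (K2 * d * ((r - rp) / (rp * r))) / (c / 3 * ((r - rp) * r ^ 2)) := by
            gcongr
            exact a2 r hr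
        _ = _ := by field_simp
    have t3 : |gaugeRatio rp L α κ' Q' b' r| * (|hprim rp (metricDer L α κ Q b) r -
          hprim rp (metricDer L α κ' Q' b') r| / hprim rp (metricDer L α κ Q b) r) ≤
        B * (3 * K1 / (c * rp ^ 2) * d) := by
      refine mul_le_mul (h'.abs_gaugeRatio_le hrp hL hc hr) ?_ (by positivity) hB0
      calc _ ≤ K1 * d * (r - rp) / (c / 3 * ((r - rp) * rp ^ 2)) := by
            gcongr
            refine le_trans ?_ hU
            gcongr
        _ = _ := by field_simp
    calc _ ≤ 3 * K2 / (c * rp) * d + B * (3 * K1 / (c * rp ^ 2) * d) := add_le_add t2 t3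
      _ = _ := by rw [hK3]; ring
  intro r hr
  have a4 : |massCoef rp L α q₀ κ Q (gaugeRatio rp L α κ Q b) r -
      massCoef rp L α q₀ κ' Q' (gaugeRatio rp L α κ' Q' b') r| ≤ K4 * d := by
    have e : massCoef rp L α q₀ κ Q (gaugeRatio rp L α κ Q b) r -
        massCoef rp L α q₀ κ' Q' (gaugeRatio rp L α κ' Q' b') r =
        L * α * ((κ r - κ' r) * r ^ 2) - q₀ ^ 2 *
        ((gaugePot rp κ Q r - gaugePot rp κ' Q' r) * gaugeRatio rp L α κ Q b r +
        gaugePot rp κ' Q' r * (gaugeRatio rp L α κ Q b r - gaugeRatio rp L α κ' Q' b' r)) := by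
      rw [massCoef, massCoef]; ring
    have t1 : |L * α * ((κ r - κ' r) * r ^ 2)| ≤ L * |α| * d := by
      rw [abs_mul, abs_mul, abs_of_pos hL, abs_mul, abs_of_pos (pow_pos (hrp.trans hr) 2)]
      gcongr
      exact (hcl r hr).1
    have t2 : |(gaugePot rp κ Q r - gaugePot rp κ' Q' r) * gaugeRatio rp L α κ Q b r +
        gaugePot rp κ' Q' r * (gaugeRatio rp L α κ Q b r - gaugeRatio rp L α κ' Q' b' r)| ≤
        K2 * d / rp * B + E / rp * (K3 * d) := by
      refine (abs_add_le _ _).trans ?_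
      rw [abs_mul, abs_mul]
      have := h.abs_gaugeRatio_le hrp hL hc hr
      have := h'.abs_gaugePot_le' hrp hr
      gcongr
      · exact a2' r hr
      · exact a3 r hr
    rw [e]
    refine (abs_sub _ _).trans ?_
    rw [abs_mul (q₀ ^ 2), abs_of_nonneg (sq_nonneg q₀)]
    calc _ ≤ L * |α| * d + q₀ ^ 2 * (K2 * d / rp * B + E / rp * (K3 * d)) := by gcongr
      _ = _ := by rw [hK4]; ring
  have m1 : 0 ≤ K1 * d := by positivity
  have m3 : 0 ≤ K3 * d := by positivity
  have m4 : 0 ≤ K4 * d := by positivity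
  refine ⟨(a1 r hr).trans ?_, (a3 r hr).trans ?_, a4.trans ?_⟩ <;> linarith

end Profile

/-! ### Backgrounds with a small source. -/

/-- The source terms `h = r f'²` and `b = f²` of a scalar field of squared size `ν`. -/
structure IsSource (rp ν : ℝ) (h b : ℝ → ℝ) : Prop where
  conth : ContinuousOn h (Ioi rp)
  contb : ContinuousOn b (Ioi rp)
  h_nonneg : ∀ s ∈ Ioi rp, 0 ≤ h s
  h_le : ∀ s ∈ Ioi rp, h s ≤ ν / s ^ 4
  b_nonneg : ∀ s ∈ Ioi rp, 0 ≤ b s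
  b_le : ∀ s ∈ Ioi rp, b s ≤ ν / s ^ 3

/-- The logarithmic derivative of `κ`. -/
def lapseRate (q₀ : ℝ) (h b w : ℝ → ℝ) (s : ℝ) : ℝ := h s + q₀ ^ 2 * (b s * w s ^ 2) / s ^ 3

/-- `κ`, normalised to be `1` at infinity. -/
def lapse (q₀ : ℝ) (h b w : ℝ → ℝ) (r : ℝ) : ℝ := Real.exp (-∫ s in Ioi r, lapseRate q₀ h b w s)

/-- The charge `Q` with horizon value `e`. -/
def charge (rp q₀ e : ℝ) (b w : ℝ → ℝ) (r : ℝ) : ℝ := e + q₀ ^ 2 * ∫ s in rp..r, b s * w s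

/-- `w = r² κ A / Ω²` for a solution of the background equations with horizon charge `e`. -/
structure IsBgRatio (rp L α q₀ B e : ℝ) (h b w : ℝ → ℝ) : Prop where
  cont : ContinuousOn w (Ioi rp)
  le : ∀ s ∈ Ioi rp, |w s| ≤ B
  eq : ∀ s ∈ Ioi rp, gaugeRatio rp L α (lapse q₀ h b w) (charge rp q₀ e b w) b s = w s

lemma integrableOn_Ioi_of_le {r K : ℝ} (hr : 0 < r) {g : ℝ → ℝ} (hg : ContinuousOn g (Ioi r))
    (hle : ∀ s ∈ Ioi r, |g s| ≤ K / s ^ 4) : IntegrableOn g (Ioi r) := by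
  refine Integrable.mono' (g := fun s => K * s ^ (-1 - 3 : ℝ))
    ((integrableOn_Ioi_rpow_of_lt (by norm_num) hr).const_mul _)
    (hg.aestronglyMeasurable measurableSet_Ioi) ?_
  refine (ae_restrict_iff' measurableSet_Ioi).2 (ae_of_all _ fun s hs => (hle s hs).trans_eq ?_)
  rw [show (-1 - 3 : ℝ) = -((4 : ℕ) : ℝ) by norm_num, Real.rpow_neg (hr.trans hs).le,
    Real.rpow_natCast, div_eq_mul_inv]

lemma abs_integral_Ioi_le {r K : ℝ} (hr : 0 < r) (hK : 0 ≤ K) {g : ℝ → ℝ}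
    (hg : ContinuousOn g (Ioi r)) (hle : ∀ s ∈ Ioi r, |g s| ≤ K / s ^ 4) :
    |∫ s in Ioi r, g s| ≤ K / (3 * r ^ 3) := by
  have h1 := (intervalIntegral_tendsto_integral_Ioi r (integrableOn_Ioi_of_le hr hg hle)
    tendsto_id).abs
  refine le_of_tendsto h1 ?_
  filter_upwards [Ici_mem_atTop r] with x hx
  have := abs_integral_le_rpow_neg (p := 3) (g := g) hr (by norm_num) hK hx fun s hs =>
    (hle s hs.1).trans_eq (by
      rw [show (-1 - 3 : ℝ) = -((4 : ℕ) : ℝ) by norm_num, Real.rpow_neg (hr.trans hs.1).le,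
        Real.rpow_natCast, div_eq_mul_inv])
  refine this.trans_eq ?_
  rw [show (-3 : ℝ) = -((3 : ℕ) : ℝ) by norm_num, Real.rpow_neg hr.le, Real.rpow_natCast]
  field_simp

lemma abs_exp_neg_sub_le {x y : ℝ} (hx : 0 ≤ x) (hy : 0 ≤ y) :
    |Real.exp (-x) - Real.exp (-y)| ≤ |x - y| := by
  have key : ∀ x y : ℝ, 0 ≤ x → x ≤ y → |Real.exp (-x) - Real.exp (-y)| ≤ |x - y| := by
    intro x y hx hxy
    have h1 : Real.exp (-y) ≤ Real.exp (-x) := Real.exp_le_exp.2 (by linarith)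
    rw [abs_of_nonneg (sub_nonneg.2 h1), abs_sub_comm, abs_of_nonneg (sub_nonneg.2 hxy)]
    have h2 : Real.exp (-y) = Real.exp (-x) * Real.exp (x - y) := by
      rw [← Real.exp_add]; congr 1; ring
    have h3 := Real.add_one_le_exp (x - y)
    have h4 : Real.exp (-x) ≤ 1 := Real.exp_le_one_iff.2 (by linarith)
    have h5 := Real.exp_pos (-x)
    rw [h2]
    nlinarith
  rcases le_total x y with hxy | hxy
  · exact key x y hx hxy
  · rw [abs_sub_comm, abs_sub_comm x]; exact key y x hy hxy

section Background

variable {rp L α q₀ ν e B : ℝ} {h b w : ℝ → ℝ}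

namespace IsSource

lemma nonneg (hrp : 0 < rp) (hs : IsSource rp ν h b) : 0 ≤ ν := by
  have h1 := (hs.h_nonneg (rp + 1) (by simp)).trans (hs.h_le (rp + 1) (by simp))
  have h2 : 0 < (rp + 1) ^ 4 := by positivity
  by_contra hneg
  exact absurd h1 (not_le.2 (div_neg_of_neg_of_pos (not_le.1 hneg) h2))

lemma continuousOn_lapseRate (hrp : 0 < rp) (hs : IsSource rp ν h b)
    (hw : ContinuousOn w (Ioi rp)) :
    ContinuousOn (lapseRate q₀ h b w) (Ioi rp) :=
  hs.conth.add ((continuousOn_const.mul (hs.contb.mul (hw.pow 2))).div (by fun_prop)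
    fun s hs => (pow_pos (hrp.trans hs) 3).ne')

lemma lapseRate_nonneg (hrp : 0 < rp) (hs : IsSource rp ν h b) {s : ℝ} (hs' : s ∈ Ioi rp) :
    0 ≤ lapseRate q₀ h b w s := by
  have h1 := hs.b_nonneg s hs'
  have h2 : 0 < s := hrp.trans hs'
  exact add_nonneg (hs.h_nonneg s hs') (by positivity)

lemma div_cube_le (hrp : 0 < rp) (hs : IsSource rp ν h b) {s : ℝ} (hs' : s ∈ Ioi rp) :
    b s / s ^ 3 ≤ ν / rp ^ 2 / s ^ 4 := by
  have h2 : 0 < s := hrp.trans hs'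
  have hν := hs.nonneg hrp
  have hrs : rp ^ 2 ≤ s ^ 2 := pow_le_pow_left₀ hrp.le (le_of_lt hs') 2
  calc b s / s ^ 3 ≤ ν / s ^ 3 / s ^ 3 := by gcongr; exact hs.b_le s hs'
    _ = ν / s ^ 2 / s ^ 4 := by field_simp
    _ ≤ _ := by gcongr

lemma lapseRate_le (hrp : 0 < rp) (hs : IsSource rp ν h b) (hw : ∀ s ∈ Ioi rp, |w s| ≤ B) {s : ℝ}
    (hs' : s ∈ Ioi rp) :
    |lapseRate q₀ h b w s| ≤ ν * (1 + q₀ ^ 2 * B ^ 2 / rp ^ 2) / s ^ 4 := by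
  have h2 : 0 < s := hrp.trans hs'
  have hν := hs.nonneg hrp
  rw [abs_of_nonneg (hs.lapseRate_nonneg hrp hs')]
  have h3 : w s ^ 2 ≤ B ^ 2 := by
    rw [← sq_abs (w s)]; exact pow_le_pow_left₀ (abs_nonneg _) (hw s hs') 2
  have h4 := hs.div_cube_le hrp hs'
  have h5 : 0 ≤ b s / s ^ 3 := div_nonneg (hs.b_nonneg s hs') (by positivity)
  calc lapseRate q₀ h b w s = h s + q₀ ^ 2 * (b s / s ^ 3 * w s ^ 2) := by rw [lapseRate]; ring
    _ ≤ ν / s ^ 4 + q₀ ^ 2 * (ν / rp ^ 2 / s ^ 4 * B ^ 2) := by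
      gcongr
      exact hs.h_le s hs'
    _ = _ := by ring

lemma integral_lapseRate_nonneg (hrp : 0 < rp) (hs : IsSource rp ν h b) {r : ℝ} (hr : rp ≤ r) :
    0 ≤ ∫ s in Ioi r, lapseRate q₀ h b w s :=
  setIntegral_nonneg measurableSet_Ioi fun _ hs' =>
    hs.lapseRate_nonneg hrp (lt_of_le_of_lt hr hs')

lemma integral_lapseRate_le (hrp : 0 < rp) (hs : IsSource rp ν h b) (hwc : ContinuousOn w (Ioi rp))
    (hw : ∀ s ∈ Ioi rp, |w s| ≤ B) {r : ℝ} (hr : rp ≤ r) :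
    (∫ s in Ioi r, lapseRate q₀ h b w s) * r ^ 2 ≤ ν * (1 + q₀ ^ 2 * B ^ 2 / rp ^ 2) / rp := by
  have h2 : 0 < r := hrp.trans_le hr
  have hν := hs.nonneg hrp
  have h1 := (le_abs_self _).trans (abs_integral_Ioi_le (K := ν * (1 + q₀ ^ 2 * B ^ 2 / rp ^ 2)) h2
    (by positivity) ((hs.continuousOn_lapseRate (q₀ := q₀) hrp hwc).mono (Ioi_subset_Ioi hr))
    fun s hs' => hs.lapseRate_le hrp hw (lt_of_le_of_lt hr hs'))
  calc _ ≤ ν * (1 + q₀ ^ 2 * B ^ 2 / rp ^ 2) / (3 * r ^ 3) * r ^ 2 := by gcongr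
    _ = ν * (1 + q₀ ^ 2 * B ^ 2 / rp ^ 2) / (3 * r) := by field_simp
    _ ≤ _ := by gcongr; linarith

lemma locBdd_lapseRate (hrp : 0 < rp) (hs : IsSource rp ν h b) (hwc : ContinuousOn w (Ioi rp))
    (hw : ∀ s ∈ Ioi rp, |w s| ≤ B) : LocBdd rp (lapseRate q₀ h b w) := by
  refine LocBdd.of_le (hs.continuousOn_lapseRate hrp hwc)
    (h := fun s => ν * (1 + q₀ ^ 2 * B ^ 2 / rp ^ 2) / s ^ 4)
    (LocBdd.of_continuousOn ?_) fun s hs' => hs.lapseRate_le hrp hw hs'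
  exact continuousOn_const.div (by fun_prop) fun s hs => (pow_pos (hrp.trans_le hs) 4).ne'

lemma hasDerivAt_lapse (hrp : 0 < rp) (hs : IsSource rp ν h b) (hwc : ContinuousOn w (Ioi rp))
    (hw : ∀ s ∈ Ioi rp, |w s| ≤ B) {r : ℝ} (hr : rp < r) :
    HasDerivAt (lapse q₀ h b w) (lapse q₀ h b w r * lapseRate q₀ h b w r) r := by
  have hc := hs.continuousOn_lapseRate (q₀ := q₀) hrp hwc
  have hi : ∀ x, rp ≤ x → IntegrableOn (lapseRate q₀ h b w) (Ioi x) := fun x hx =>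
    integrableOn_Ioi_of_le (hrp.trans_le hx) (hc.mono (Ioi_subset_Ioi hx)) fun s hs' =>
      hs.lapseRate_le hrp hw (lt_of_le_of_lt hx hs')
  have hl := hs.locBdd_lapseRate (q₀ := q₀) hrp hwc hw
  -- The lapse is normalised at infinity; on a neighbourhood of `r` the tail integral is a constant
  -- minus a primitive from the horizon, which can be differentiated.
  have e : (fun x => ∫ s in Ioi x, lapseRate q₀ h b w s) =ᶠ[𝓝 r]
      fun x => (∫ s in Ioi rp, lapseRate q₀ h b w s) - ∫ s in rp..x, lapseRate q₀ h b w s := by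
    filter_upwards [Ioi_mem_nhds hr] with x hx
    rw [← intervalIntegral.integral_interval_add_Ioi (hi rp le_rfl) (hi x (le_of_lt hx))]
    ring
  have d := (((hl.hasDerivAt hr).const_sub
    (∫ s in Ioi rp, lapseRate q₀ h b w s)).congr_of_eventuallyEq e).neg.exp
  refine d.congr_deriv ?_
  simp only [lapse, neg_neg, Pi.neg_apply]

lemma tendsto_lapse_horizon (hrp : 0 < rp) (hs : IsSource rp ν h b) (hwc : ContinuousOn w (Ioi rp))
    (hw : ∀ s ∈ Ioi rp, |w s| ≤ B) :
    Tendsto (lapse q₀ h b w) (𝓝[>] rp) (𝓝 (lapse q₀ h b w rp)) := by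
  have hc := hs.continuousOn_lapseRate (q₀ := q₀) hrp hwc
  have hi : ∀ x, rp ≤ x → IntegrableOn (lapseRate q₀ h b w) (Ioi x) := fun x hx =>
    integrableOn_Ioi_of_le (hrp.trans_le hx) (hc.mono (Ioi_subset_Ioi hx)) fun s hs' =>
      hs.lapseRate_le hrp hw (lt_of_le_of_lt hx hs')
  have hl := hs.locBdd_lapseRate (q₀ := q₀) hrp hwc hw
  have t := (Real.continuous_exp.tendsto _).comp
    ((hl.tendsto_primitive.const_sub (∫ s in Ioi rp, lapseRate q₀ h b w s)).neg)
  rw [sub_zero] at t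
  refine t.congr' ?_
  filter_upwards [self_mem_nhdsWithin] with x hx
  simp only [Function.comp, lapse]
  rw [← intervalIntegral.integral_interval_add_Ioi (hi rp le_rfl) (hi x (le_of_lt hx))]
  congr 1; ring

lemma locBdd_bw (hrp : 0 < rp) (hs : IsSource rp ν h b) (hwc : ContinuousOn w (Ioi rp))
    (hw : ∀ s ∈ Ioi rp, |w s| ≤ B) : LocBdd rp fun s => b s * w s := by
  refine LocBdd.mul (LocBdd.of_le hs.contb (h := fun s => ν / s ^ 3) (LocBdd.of_continuousOn ?_)
    fun s hs' => ?_) (locBdd_of_bdd hwc hw)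
  · exact continuousOn_const.div (by fun_prop) fun s hs => (pow_pos (hrp.trans_le hs) 3).ne'
  · rw [abs_of_nonneg (hs.b_nonneg s hs')]; exact hs.b_le s hs'

lemma abs_integral_b_mul_le (hrp : 0 < rp) (hs : IsSource rp ν h b) {M : ℝ} (hM : 0 ≤ M)
    (hw : ∀ s ∈ Ioi rp, |w s| ≤ M) {r : ℝ} (hr : rp < r) :
    |∫ s in rp..r, b s * w s| ≤ ν * M / rp ^ 2 := by
  have hν := hs.nonneg hrp
  have h1 := abs_integral_inv_sq_le (K := ν * M / rp) (g := fun s => b s * w s) hrp hr.le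
    fun s hs' => by
      have hs0 : 0 < s := hrp.trans hs'.1
      have h3 := hs.b_nonneg s hs'.1
      rw [abs_mul, abs_of_nonneg h3]
      calc b s * |w s| ≤ ν / s ^ 3 * M := by
            gcongr
            · exact hs.b_le s hs'.1
            · exact hw s hs'.1
        _ = ν * M / s / s ^ 2 := by field_simp
        _ ≤ _ := by gcongr; exact hs'.1.le
  refine h1.trans ?_
  have hr0 := hrp.trans hr
  calc ν * M / rp * ((r - rp) / (rp * r)) ≤ ν * M / rp * (1 / rp) := by
        refine mul_le_mul_of_nonneg_left ?_ (by positivity)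
        rw [div_le_div_iff₀ (by positivity) hrp]
        nlinarith
    _ = _ := by field_simp

lemma sq_mul_le (hrp : 0 < rp) (hs : IsSource rp ν h b) {s : ℝ} (hs' : s ∈ Ioi rp) :
    s ^ 2 * b s ≤ ν / rp := by
  have hs0 : 0 < s := hrp.trans hs'
  have hν := hs.nonneg hrp
  calc s ^ 2 * b s ≤ s ^ 2 * (ν / s ^ 3) := by gcongr; exact hs.b_le s hs'
    _ = ν / s := by field_simp
    _ ≤ _ := by gcongr; exact le_of_lt hs'

end IsSource

/-- For small sources the functions `κ`, `Q`, `b` satisfy the bounds of a profile. -/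
lemma exists_isProfile (hrp : 0 < rp) (hL : 0 < L) (hα : α ≤ 0) (q₀ : ℝ) {E₀ c B : ℝ} (hE₀ : 0 ≤ E₀)
    (hc : 0 < c) (hB : 0 ≤ B)
    (hlow : ∀ e ∈ Icc 0 E₀, ∀ s ∈ Ioi rp, 4 * c * s ^ 2 ≤ 1 - e ^ 2 / s ^ 2 + 3 * L * s ^ 2) :
    ∃ ν₀ > 0, ν₀ ≤ 1 ∧ ∀ ν ≤ ν₀, ∀ h b, IsSource rp ν h b → ∀ e ∈ Icc 0 E₀, ∀ w,
      ContinuousOn w (Ioi rp) → (∀ s ∈ Ioi rp, |w s| ≤ B) →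
      IsProfile rp L α c (E₀ + 1) (lapse q₀ h b w) (charge rp q₀ e b w) b := by
  set k1 := (1 + q₀ ^ 2 * B ^ 2 / rp ^ 2) / rp with hk1
  set k2 := q₀ ^ 2 * B / rp ^ 2 with hk2
  have hk1' : 0 < k1 := by positivity
  have hk2' : 0 ≤ k2 := by positivity
  -- The constraints in turn give: `ν₀ ≤ 1`; `(1 - κ) s² ≤ 1`; `κ ≥ 1/2`; `|Q - e| ≤ 1`; `Q² ≤ e² +
  -- 2c rp⁴`; and `s² b ≤ 1`.
  set ν₀ := min (min 1 (min (1 / k1) (rp ^ 2 / (2 * k1))))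
    (min (1 / (k2 + 1)) (min (2 * c * rp ^ 4 / ((k2 + 1) * (2 * E₀ + 1))) rp)) with hν₀
  have l1 : ν₀ ≤ 1 := (min_le_left _ _).trans (min_le_left _ _)
  have l2 : ν₀ ≤ 1 / k1 := (min_le_left _ _).trans ((min_le_right _ _).trans (min_le_left _ _))
  have l3 : ν₀ ≤ rp ^ 2 / (2 * k1) :=
    (min_le_left _ _).trans ((min_le_right _ _).trans (min_le_right _ _))
  have l4 : ν₀ ≤ 1 / (k2 + 1) := (min_le_right _ _).trans (min_le_left _ _)
  have l5 : ν₀ ≤ 2 * c * rp ^ 4 / ((k2 + 1) * (2 * E₀ + 1)) :=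
    (min_le_right _ _).trans ((min_le_right _ _).trans (min_le_left _ _))
  have l6 : ν₀ ≤ rp := (min_le_right _ _).trans ((min_le_right _ _).trans (min_le_right _ _))
  refine ⟨ν₀, by positivity, l1, fun ν hν h b hs e he w hwc hw => ?_⟩
  have hν0 := hs.nonneg hrp
  have m2 : ν * k1 ≤ 1 := by
    have := hν.trans l2; rwa [le_div_iff₀ hk1'] at this
  have m3 : ν * k1 ≤ rp ^ 2 / 2 := by
    have := hν.trans l3
    rw [le_div_iff₀ (by positivity)] at this
    linarith
  have m4 : ν * k2 ≤ 1 := by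
    have := hν.trans l4
    rw [le_div_iff₀ (by positivity)] at this
    linarith
  have m5 : ν * k2 * (2 * E₀ + 1) ≤ 2 * c * rp ^ 4 := by
    have := hν.trans l5
    rw [le_div_iff₀ (by positivity)] at this
    nlinarith [mul_nonneg hν0 (by positivity : 0 ≤ 2 * E₀ + 1)]
  have hτ : ∀ r ∈ Ioi rp, (∫ s in Ioi r, lapseRate q₀ h b w s) * r ^ 2 ≤ ν * k1 := fun r hr => by
    refine (hs.integral_lapseRate_le hrp hwc hw (le_of_lt hr)).trans_eq ?_
    rw [hk1]; ring
  have hκ1 : ∀ r ∈ Ioi rp, (1 - lapse q₀ h b w r) * r ^ 2 ≤ ν * k1 := fun r hr => by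
    refine le_trans ?_ (hτ r hr)
    gcongr
    have := Real.add_one_le_exp (-∫ s in Ioi r, lapseRate q₀ h b w s)
    rw [lapse]; linarith
  have hκle : ∀ r ∈ Ioi rp, lapse q₀ h b w r ≤ 1 := fun r hr =>
    Real.exp_le_one_iff.2 (neg_nonpos.2 (hs.integral_lapseRate_nonneg hrp (le_of_lt hr)))
  have hκhalf : ∀ r ∈ Ioi rp, 1 / 2 ≤ lapse q₀ h b w r := fun r hr => by
    have h1 := (hκ1 r hr).trans m3
    have h2 : rp ^ 2 ≤ r ^ 2 := pow_le_pow_left₀ hrp.le (le_of_lt hr) 2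
    have h3 := hκle r hr
    have h4 : 0 < rp ^ 2 := by positivity
    have h5 : (1 - lapse q₀ h b w r) * rp ^ 2 ≤ 1 / 2 * rp ^ 2 :=
      (mul_le_mul_of_nonneg_left h2 (sub_nonneg.2 h3)).trans (h1.trans_eq (by ring))
    have := le_of_mul_le_mul_right h5 h4
    linarith
  have hQe : ∀ r ∈ Ioi rp, |charge rp q₀ e b w r - e| ≤ ν * k2 := fun r hr => by
    rw [charge, add_sub_cancel_left, abs_mul, abs_of_nonneg (sq_nonneg q₀)]
    calc _ ≤ q₀ ^ 2 * (ν * B / rp ^ 2) := by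
          gcongr; exact hs.abs_integral_b_mul_le hrp hB hw hr
      _ = _ := by rw [hk2]; ring
  have hQ : ∀ r ∈ Ioi rp, |charge rp q₀ e b w r| ≤ E₀ + 1 := fun r hr => by
    have h1 := (hQe r hr).trans m4
    rw [abs_le] at *
    constructor <;> linarith [he.1, he.2]
  refine ⟨fun r hr => (hs.hasDerivAt_lapse hrp hwc hw hr).continuousAt.continuousWithinAt,
    continuousOn_const.add (continuousOn_const.mul (hs.locBdd_bw hrp hwc hw).primitive.cont),
    hs.contb, fun r _ => Real.exp_pos _, hκle, fun r hr => (hκ1 r hr).trans m2, hQ, hs.b_nonneg,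
    fun r hr => (hs.sq_mul_le hrp hr).trans ((div_le_one hrp).2 (hν.trans l6)), fun r hr => ?_⟩
  have hr0 : 0 < r := hrp.trans hr
  have h1 := hlow e he r hr
  have h2 : charge rp q₀ e b w r ^ 2 ≤ e ^ 2 + 2 * c * rp ^ 4 := by
    have h3 := hQe r hr
    have h4 := hQ r hr
    have h5 : |charge rp q₀ e b w r + e| ≤ 2 * E₀ + 1 := by
      rw [abs_le] at *; constructor <;> linarith [he.1, he.2]
    have h6 : |(charge rp q₀ e b w r - e) * (charge rp q₀ e b w r + e)| ≤
        ν * k2 * (2 * E₀ + 1) := by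
      rw [abs_mul]; gcongr
    have := (le_abs_self _).trans (h6.trans m5)
    nlinarith
  have h3 : charge rp q₀ e b w r ^ 2 / r ^ 2 ≤ e ^ 2 / r ^ 2 + 2 * c * r ^ 2 := by
    have h4 : rp ^ 4 ≤ r ^ 4 := pow_le_pow_left₀ hrp.le (le_of_lt hr) 4
    rw [div_add' _ _ _ (by positivity)]
    gcongr
    nlinarith [mul_le_mul_of_nonneg_left h4 hc.le]
  have h4 : 0 ≤ -(L * α * r ^ 2 * b r) := by
    have := hs.b_nonneg r hr
    have h5 : 0 ≤ L * (-α) * r ^ 2 * b r :=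
      mul_nonneg (mul_nonneg (mul_nonneg hL.le (neg_nonneg.2 hα)) (sq_nonneg r)) this
    linarith
  have h5 := hκhalf r hr
  rw [metricDer]
  -- This is where the factor `4` in `hlow` is spent: half goes to the change of `Q²`, and `κ ≥ 1/2`
  -- takes another half. The term with `α` helps, since `α ≤ 0`.
  have h6 : 2 * c * r ^ 2 ≤ 1 - charge rp q₀ e b w r ^ 2 / r ^ 2 + 3 * L * r ^ 2 -
    L * α * r ^ 2 * b r := by linarith
  have h7 : 0 ≤ 2 * c * r ^ 2 := by positivity
  calc c * r ^ 2 = 1 / 2 * (2 * c * r ^ 2) := by ring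
    _ ≤ _ := by gcongr

/-- `κ` and `Q` depend on `w` with a small Lipschitz constant. -/
lemma exists_profileClose_same_source (hrp : 0 < rp) (q₀ : ℝ) {B : ℝ} (hB : 0 ≤ B) :
    ∃ K > 0, ∀ ν h b, IsSource rp ν h b → ∀ e e' w w', ContinuousOn w (Ioi rp) →
      (∀ s ∈ Ioi rp, |w s| ≤ B) → ContinuousOn w' (Ioi rp) → (∀ s ∈ Ioi rp, |w' s| ≤ B) →
      ∀ δ, 0 ≤ δ → (∀ s ∈ Ioi rp, |w s - w' s| ≤ δ) →
      ProfileClose rp (K * ν * δ + |e - e'|) (lapse q₀ h b w) (charge rp q₀ e b w) b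
        (lapse q₀ h b w') (charge rp q₀ e' b w') b := by
  set k1 := q₀ ^ 2 * (2 * B) / rp ^ 2 / rp with hk1
  set k2 := q₀ ^ 2 / rp ^ 2 with hk2
  have hk1' : 0 ≤ k1 := by positivity
  have hk2' : 0 ≤ k2 := by positivity
  refine ⟨k1 + k2 + 1, by positivity, fun ν h b hs e e' w w' hwc hw hwc' hw' δ hδ hd r hr => ?_⟩
  have hr0 : 0 < r := hrp.trans hr
  have hν := hs.nonneg hrp
  have hνδ : 0 ≤ ν * δ := by positivity
  have hc := (hs.continuousOn_lapseRate (q₀ := q₀) hrp hwc)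
  have hc' := (hs.continuousOn_lapseRate (q₀ := q₀) hrp hwc')
  have hrr : Ioi r ⊆ Ioi rp := Ioi_subset_Ioi (le_of_lt hr)
  refine ⟨?_, ?_, ?_⟩
  · have i1 := integrableOn_Ioi_of_le hr0 (hc.mono hrr) fun s hs' =>
        hs.lapseRate_le hrp hw (hrr hs')
    have i2 := integrableOn_Ioi_of_le hr0 (hc'.mono hrr) fun s hs' =>
      hs.lapseRate_le hrp hw' (hrr hs')
    have h1 := abs_exp_neg_sub_le (hs.integral_lapseRate_nonneg (q₀ := q₀) (w := w) hrp
        (le_of_lt hr))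
      (hs.integral_lapseRate_nonneg (q₀ := q₀) (w := w') hrp (le_of_lt hr))
    rw [← integral_sub i1 i2] at h1
    have h2 := abs_integral_Ioi_le (g := fun s => lapseRate q₀ h b w s - lapseRate q₀ h b w' s)
      (K := ν * (q₀ ^ 2 * (2 * B) / rp ^ 2) * δ) hr0 (by positivity)
      ((hc.mono hrr).sub (hc'.mono hrr)) fun s hs' => by
        have hs1 := hrr hs'
        have hs0 : 0 < s := hrp.trans hs1
        have e1 : lapseRate q₀ h b w s - lapseRate q₀ h b w' s =
            q₀ ^ 2 * (b s / s ^ 3) * ((w s - w' s) * (w s + w' s)) := by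
          rw [lapseRate, lapseRate]; ring
        have h3 : 0 ≤ b s / s ^ 3 := div_nonneg (hs.b_nonneg s hs1) (by positivity)
        have h4 : |w s + w' s| ≤ 2 * B :=
          (abs_add_le _ _).trans (by linarith [hw s hs1, hw' s hs1])
        rw [e1, abs_mul, abs_of_nonneg (mul_nonneg (sq_nonneg q₀) h3), abs_mul]
        calc _ ≤ q₀ ^ 2 * (ν / rp ^ 2 / s ^ 4) * (δ * (2 * B)) := by
              have := hs.div_cube_le hrp hs1
              have := hd s hs1
              gcongr
          _ = _ := by ring
    calc _ ≤ ν * (q₀ ^ 2 * (2 * B) / rp ^ 2) * δ / (3 * r ^ 3) * r ^ 2 := by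
          gcongr; exact h1.trans h2
      _ = ν * (q₀ ^ 2 * (2 * B) / rp ^ 2) * δ / (3 * r) := by field_simp
      _ ≤ ν * (q₀ ^ 2 * (2 * B) / rp ^ 2) * δ / rp := by
          gcongr
          have : rp < r := hr
          linarith
      _ = k1 * (ν * δ) := by rw [hk1]; ring
      _ ≤ _ := by
          have : 0 ≤ (k2 + 1) * (ν * δ) := by positivity
          linarith [abs_nonneg (e - e')]
  · have e1 : charge rp q₀ e b w r - charge rp q₀ e' b w' r =
        (e - e') + q₀ ^ 2 * ∫ s in rp..r, b s * (w s - w' s) := by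
      have : ∫ s in rp..r, b s * (w s - w' s) =
          (∫ s in rp..r, b s * w s) - ∫ s in rp..r, b s * w' s := by
        rw [← intervalIntegral.integral_sub
          ((hs.locBdd_bw hrp hwc hw).intervalIntegrable le_rfl (le_of_lt hr))
          ((hs.locBdd_bw hrp hwc' hw').intervalIntegrable le_rfl (le_of_lt hr))]
        congr 1; ext s; ring
      rw [charge, charge, this]; ring
    have h1 := hs.abs_integral_b_mul_le (w := fun s => w s - w' s) hrp hδ hd hr
    rw [e1]
    refine (abs_add_le _ _).trans ?_
    rw [abs_mul, abs_of_nonneg (sq_nonneg q₀)]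
    calc _ ≤ |e - e'| + q₀ ^ 2 * (ν * δ / rp ^ 2) := by gcongr
      _ = |e - e'| + k2 * (ν * δ) := by rw [hk2]; ring
      _ ≤ _ := by
          have : 0 ≤ (k1 + 1) * (ν * δ) := by positivity
          linarith
  · simp only [sub_self, abs_zero, zero_mul]
    positivity

lemma isSource_zero (rp : ℝ) : IsSource rp 0 (fun _ => 0) fun _ => 0 :=
  ⟨continuousOn_const, continuousOn_const, by simp, by simp, by simp, by simp⟩

lemma lapse_zero : lapse q₀ (fun _ => 0) (fun _ => 0) w = fun _ => 1 := by
  ext r; simp [lapse, lapseRate]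

lemma charge_zero : charge rp q₀ e (fun _ => 0) w = fun _ => e := by
  ext r; simp [charge]

/-- A small source changes `κ` and `Q` by little. -/
lemma exists_profileClose_zero_source (hrp : 0 < rp) (q₀ : ℝ) {B : ℝ} (hB : 0 ≤ B) :
    ∃ K > 0, ∀ ν h b, IsSource rp ν h b → ∀ e w w', ContinuousOn w (Ioi rp) →
      (∀ s ∈ Ioi rp, |w s| ≤ B) →
      ProfileClose rp (K * ν) (lapse q₀ h b w) (charge rp q₀ e b w) b
        (lapse q₀ (fun _ => 0) (fun _ => 0) w') (charge rp q₀ e (fun _ => 0) w') fun _ => 0 := by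
  set k1 := (1 + q₀ ^ 2 * B ^ 2 / rp ^ 2) / rp with hk1
  set k2 := q₀ ^ 2 * B / rp ^ 2 with hk2
  have hk1' : 0 < k1 := by positivity
  have hk2' : 0 ≤ k2 := by positivity
  refine ⟨k1 + k2 + 1 / rp, by positivity, fun ν h b hs e w w' hwc hw r hr => ?_⟩
  have hν := hs.nonneg hrp
  have hr0 : 0 < r := hrp.trans hr
  have n1 : 0 ≤ k1 * ν := by positivity
  have n2 : 0 ≤ k2 * ν := by positivity
  have n3 : 0 ≤ 1 / rp * ν := by positivity
  rw [lapse_zero, charge_zero]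
  refine ⟨?_, ?_, ?_⟩
  · have h1 := hs.integral_lapseRate_le (q₀ := q₀) hrp hwc hw (le_of_lt hr)
    have h0 := hs.integral_lapseRate_nonneg (q₀ := q₀) (w := w) hrp (le_of_lt hr)
    have h2 := abs_exp_neg_sub_le h0 (le_refl (0 : ℝ))
    rw [neg_zero, Real.exp_zero, sub_zero, abs_of_nonneg h0] at h2
    calc |lapse q₀ h b w r - 1| * r ^ 2 ≤ (∫ s in Ioi r, lapseRate q₀ h b w s) * r ^ 2 := by
          gcongr; exact h2
      _ ≤ k1 * ν := h1.trans_eq (by rw [hk1]; ring)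
      _ ≤ _ := by linarith
  · rw [charge, add_sub_cancel_left, abs_mul, abs_of_nonneg (sq_nonneg q₀)]
    calc _ ≤ q₀ ^ 2 * (ν * B / rp ^ 2) := by
          gcongr; exact hs.abs_integral_b_mul_le hrp hB hw hr
      _ = k2 * ν := by rw [hk2]; ring
      _ ≤ _ := by linarith
  · have h1 := hs.sq_mul_le hrp hr
    rw [sub_zero, abs_of_nonneg (hs.b_nonneg r hr)]
    calc b r * r ^ 2 = r ^ 2 * b r := mul_comm _ _
      _ ≤ 1 / rp * ν := h1.trans_eq (by ring)
      _ ≤ _ := by linarith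

/-- Existence, bounds and Lipschitz dependence of small-source backgrounds, with uniform constants
for horizon charges in `[0, E₀]`. -/
theorem exists_background (hrp : 0 < rp) (hL : 0 < L) (hα : α ≤ 0) (q₀ : ℝ) {E₀ c : ℝ}
    (hE₀ : 0 ≤ E₀) (hc : 0 < c)
    (hlow : ∀ e ∈ Icc 0 E₀, ∀ s ∈ Ioi rp, 4 * c * s ^ 2 ≤ 1 - e ^ 2 / s ^ 2 + 3 * L * s ^ 2) :
    ∃ B ≥ 0, ∃ C > 0, ∃ K > 0, ∃ ν₀ > 0, ∀ ν ≤ ν₀, ∀ h b, IsSource rp ν h b → ∀ e ∈ Icc 0 E₀,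
      (∃ w, IsBgRatio rp L α q₀ B e h b w) ∧
      ∀ w, IsBgRatio rp L α q₀ B e h b w →
        IsProfile rp L α c (E₀ + 1) (lapse q₀ h b w) (charge rp q₀ e b w) b ∧
        IsRadialCoef rp L α C c (metricDer L α (lapse q₀ h b w) (charge rp q₀ e b w) b)
          (massCoef rp L α q₀ (lapse q₀ h b w) (charge rp q₀ e b w) w) ∧
        (∀ e' ∈ Icc 0 E₀, ∀ w', IsBgRatio rp L α q₀ B e' h b w' →
          CoefClose rp (K * |e - e'|)
            (metricDer L α (lapse q₀ h b w) (charge rp q₀ e b w) b)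
            (massCoef rp L α q₀ (lapse q₀ h b w) (charge rp q₀ e b w) w)
            (metricDer L α (lapse q₀ h b w') (charge rp q₀ e' b w') b)
            (massCoef rp L α q₀ (lapse q₀ h b w') (charge rp q₀ e' b w') w')) ∧
        ∀ w', IsBgRatio rp L α q₀ B e (fun _ => 0) (fun _ => 0) w' →
          CoefClose rp (K * ν)
            (metricDer L α (lapse q₀ h b w) (charge rp q₀ e b w) b)
            (massCoef rp L α q₀ (lapse q₀ h b w) (charge rp q₀ e b w) w)
            (metricDer L α (fun _ => 1) (fun _ => e) fun _ => 0)
            (massCoef rp L α q₀ (fun _ => 1) (fun _ => e) w') := by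
  set B := 3 * (E₀ + 1) / (c * rp) with hBdef
  have hB : 0 ≤ B := by positivity
  obtain ⟨ν₁, hν₁, hν₁', hprof⟩ := exists_isProfile hrp hL hα q₀ hE₀ hc hB hlow
  obtain ⟨C, hC, hcoef⟩ := exists_isRadialCoef (α := α) (c := c) (E := E₀ + 1) hrp hL
      (by positivity)
    q₀ B hB
  obtain ⟨K1, hK1, hlip⟩ := exists_profile_lipschitz (α := α) (c := c) (E := E₀ + 1) hrp hL hc
    (by positivity) q₀
  obtain ⟨K2, hK2, hsame⟩ := exists_profileClose_same_source hrp q₀ hB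
  obtain ⟨K3, hK3, hzero⟩ := exists_profileClose_zero_source hrp q₀ hB
  -- `K2 ν` is the Lipschitz constant of `w ↦ (κ, Q)` and `K1` that of the map back to the gauge
  -- ratio; the second constraint makes the product at most `1/2`.
  have hν0 : 0 < min ν₁ (1 / (2 * K1 * K2)) := by positivity
  refine ⟨B, hB, C, hC, K1 * 2 + K1 * K3, by positivity, min ν₁ (1 / (2 * K1 * K2)), hν0,
    fun ν hν h b hs e he => ?_⟩
  have hνν₁ : ν ≤ ν₁ := hν.trans (min_le_left _ _)
  have hνn := hs.nonneg hrp
  have hhalf : K1 * (K2 * ν) ≤ 1 / 2 := by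
    have := hν.trans (min_le_right _ _)
    rw [le_div_iff₀ (by positivity)] at this
    linarith
  have hcontr : ∀ δ, 0 ≤ δ → K1 * (K2 * ν * δ) ≤ δ / 2 := fun δ hδ => by nlinarith
  refine ⟨?_, fun w hw => ?_⟩
  · obtain ⟨w, hwc, hw, hweq⟩ := exists_fixedPoint (a := rp) (B := B) (ω := fun _ => 1) hB
      (fun _ _ => ⟨zero_le_one, le_rfl⟩)
      (fun w => gaugeRatio rp L α (lapse q₀ h b w) (charge rp q₀ e b w) b)
      (fun w hwc hw => by
        simp only [mul_one] at hw ⊢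
        have hp := hprof ν hνν₁ h b hs e he w hwc hw
        exact ⟨hp.continuousOn_gaugeRatio hrp hL hc, fun r hr => hp.abs_gaugeRatio_le hrp hL hc hr⟩)
      (fun w w' hwc hw hwc' hw' δ hδ hd r hr => by
        simp only [mul_one] at hw hw' hd ⊢
        have hcl := hsame ν h b hs e e w w' hwc hw hwc' hw' δ hδ hd
        simp only [sub_self, abs_zero, add_zero] at hcl
        exact ((hlip _ _ _ (hprof ν hνν₁ h b hs e he w hwc hw) _ _ _
          (hprof ν hνν₁ h b hs e he w' hwc' hw') _ (by positivity) hcl r hr).2.1).trans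
          (hcontr δ hδ))
    simp only [mul_one] at hw
    exact ⟨w, hwc, hw, hweq⟩
  · have hp := hprof ν hνν₁ h b hs e he w hw.cont hw.le
    have hmass : ∀ e w, IsBgRatio rp L α q₀ B e h b w → ∀ r ∈ Ioi rp,
        massCoef rp L α q₀ (lapse q₀ h b w) (charge rp q₀ e b w)
          (gaugeRatio rp L α (lapse q₀ h b w) (charge rp q₀ e b w) b) r =
        massCoef rp L α q₀ (lapse q₀ h b w) (charge rp q₀ e b w) w r := fun e w hw r hr => by
      rw [massCoef, massCoef, hw.eq r hr]
    refine ⟨hp, hcoef _ _ _ _ hp hw.cont hw.le, fun e' he' w' hw' => ?_, fun w' hw' => ?_⟩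
    · have hp' := hprof ν hνν₁ h b hs e' he' w' hw'.cont hw'.le
      have hwd : ∀ r ∈ Ioi rp, |w r - w' r| ≤ 2 * (K1 * |e - e'|) * 1 := by
        -- The ratio for another charge differs through the direct change of charge, at most `K1 |e
        -- - e'|`, plus half of the difference already present; iterating removes the half.
        refine abs_le_of_halving (S := Ioi rp) (y := fun r => w r - w' r) (ω := fun _ => 1)
          (B := B + B) (fun r hr => ?_) fun δ hδ r hr => ?_
        · rw [mul_one]
          exact (abs_sub _ _).trans (add_le_add (hw.le r hr) (hw'.le r hr))
        · simp only [mul_one] at hδ ⊢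
          have hδ0 : 0 ≤ δ := (abs_nonneg _).trans (hδ r hr)
          have hcl := hsame ν h b hs e e' w w' hw.cont hw.le hw'.cont hw'.le δ hδ0 hδ
          have := (hlip _ _ _ hp _ _ _ hp' _ (by positivity) hcl r hr).2.1
          rw [hw.eq r hr, hw'.eq r hr] at this
          refine this.trans ?_
          rw [mul_add]
          linarith [hcontr δ hδ0]
      simp only [mul_one] at hwd
      have hcl := hsame ν h b hs e e' w w' hw.cont hw.le hw'.cont hw'.le _ (by positivity) hwd
      intro r hr
      have := hlip _ _ _ hp _ _ _ hp' _ (by positivity) hcl r hr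
      rw [hmass e w hw r hr, hmass e' w' hw' r hr] at this
      have hb : K1 * (K2 * ν * (2 * (K1 * |e - e'|)) + |e - e'|) ≤
          (K1 * 2 + K1 * K3) * |e - e'| := by
        have h1 := hcontr (2 * (K1 * |e - e'|)) (by positivity)
        have h2 : 0 ≤ K1 * K3 * |e - e'| := by positivity
        nlinarith
      exact ⟨this.1.trans hb, this.2.2.trans hb⟩
    · have hp' := hprof 0 hν₁.le _ _ (isSource_zero rp) e he w' hw'.cont hw'.le
      have hcl := hzero ν h b hs e w w' hw.cont hw.le
      intro r hr
      have := hlip _ _ _ hp _ _ _ hp' _ (by positivity) hcl r hr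
      have e2 : massCoef rp L α q₀ (lapse q₀ (fun _ => 0) (fun _ => 0) w')
          (charge rp q₀ e (fun _ => 0) w')
            (gaugeRatio rp L α (lapse q₀ (fun _ => 0) (fun _ => 0) w')
          (charge rp q₀ e (fun _ => 0) w') fun _ => 0) r =
          massCoef rp L α q₀ (lapse q₀ (fun _ => 0) (fun _ => 0) w')
          (charge rp q₀ e (fun _ => 0) w') w' r := by
        rw [massCoef, massCoef, hw'.eq r hr]
      rw [hmass e w hw r hr, e2, lapse_zero, charge_zero] at this
      have hb : K1 * (K3 * ν) ≤ (K1 * 2 + K1 * K3) * ν := by nlinarith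
      exact ⟨this.1.trans hb, this.2.2.trans hb⟩

end Background

/-! ### Continuity at the horizon selects the regular solution. -/

section Regularity

variable {rp L α C c D a : ℝ} {G q φ φ' : ℝ → ℝ}

/-- The flux of a solution with a finite limit at the horizon cannot have a positive limit there. -/
lemma not_tendsto_flux_pos (h : IsRadialCoef rp L α C c G q) (hrp : 0 < rp) (hc : 0 < c)
    (hφ : ∀ r ∈ Ioi rp, HasDerivAt φ (φ' r) r) (ha : Tendsto φ (𝓝[>] rp) (𝓝 a)) {l : ℝ} (hl : 0 < l)
    (hX : Tendsto (fun s => s * hprim rp G s * φ' s) (𝓝[>] rp) (𝓝 l)) : False := by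
  obtain ⟨K, hK⟩ := h.locBddG.bdd (rp + 1)
  have hK0 : 0 ≤ K := (abs_nonneg _).trans (hK (rp + 1) ⟨by linarith, le_rfl⟩)
  set N := (rp + 1) * K + 1 with hN
  have hN0 : 0 < N := by positivity
  have hev : ∀ᶠ s in 𝓝[>] rp, l / 2 < s * hprim rp G s * φ' s :=
    hX.eventually (lt_mem_nhds (half_lt_self hl))
  obtain ⟨u, hu, hsub⟩ := (mem_nhdsGT_iff_exists_Ioo_subset).1 hev
  have hu' : rp < u := hu
  set r1 := min u (rp + 1) with hr1
  have hr1' : rp < r1 := lt_min hu' (by linarith)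
  set m := l / 2 / N with hm
  have hm0 : 0 < m := by positivity
  have hder : ∀ s ∈ Ioo rp r1, m / (s - rp) ≤ φ' s := by
    intro s hs
    have hs0 : 0 < s := hrp.trans hs.1
    have hd : 0 < s - rp := sub_pos.2 hs.1
    have h1 : l / 2 < s * hprim rp G s * φ' s :=
      hsub ⟨hs.1, hs.2.trans_le (min_le_left _ _)⟩
    have hU := h.hprim_pos hrp hc hs.1
    have hs1 : s ≤ rp + 1 := (hs.2.trans_le (min_le_right _ _)).le
    have h2 : hprim rp G s ≤ K * (s - rp) := by
      have := intervalIntegral.norm_integral_le_of_norm_le_const (a := rp) (b := s) (C := K)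
        (f := G) (fun x hx => by
          rw [uIoc_of_le hs.1.le] at hx; exact hK x ⟨hx.1, hx.2.trans hs1⟩)
      rw [abs_of_pos hd] at this
      exact (le_abs_self _).trans this
    have h3 : s * hprim rp G s ≤ N * (s - rp) := by
      calc s * hprim rp G s ≤ (rp + 1) * (K * (s - rp)) := by gcongr
        _ ≤ _ := by rw [hN]; nlinarith
    have hφ0 : 0 < φ' s := by
      by_contra hneg
      have := mul_nonpos_of_nonneg_of_nonpos (mul_pos hs0 hU).le (not_lt.1 hneg)
      linarith
    rw [hm, div_div, div_le_iff₀ (by positivity)]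
    nlinarith [mul_le_mul_of_nonneg_right h3 hφ0.le]
  -- A positive limit of the flux forces `φ' ≥ m/(s - rp)`, so `φ - m log(s - rp)` increases. It
  -- also tends to `+∞` at the horizon, as `φ` stays finite there, and the two are incompatible.
  have hmono : MonotoneOn (fun s => φ s - m * Real.log (s - rp)) (Ioo rp r1) := by
    have hd : ∀ s ∈ Ioo rp r1, HasDerivAt (fun s => φ s - m * Real.log (s - rp))
        (φ' s - m * (1 / (s - rp))) s := fun s hs =>
      (hφ s hs.1).sub ((((hasDerivAt_id s).sub_const rp).log (sub_pos.2 hs.1).ne').const_mul m)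
    refine monotoneOn_of_deriv_nonneg (convex_Ioo _ _)
      (fun s hs => (hd s hs).continuousAt.continuousWithinAt) ?_ ?_
    · rw [interior_Ioo]
      exact fun s hs => (hd s hs).differentiableAt.differentiableWithinAt
    · rw [interior_Ioo]
      intro s hs
      rw [(hd s hs).deriv]
      have := hder s hs
      rw [mul_one_div]; linarith
  have hlog : Tendsto (fun s => Real.log (s - rp)) (𝓝[>] rp) atBot := by
    refine Real.tendsto_log_nhdsGT_zero.comp ?_
    refine tendsto_nhdsWithin_iff.2 ⟨?_, ?_⟩
    · have : Tendsto (fun s => s - rp) (𝓝 rp) (𝓝 (rp - rp)) := tendsto_id.sub_const rp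
      rw [sub_self] at this
      exact this.mono_left nhdsWithin_le_nhds
    · filter_upwards [self_mem_nhdsWithin] with s hs
      exact sub_pos.2 (show rp < s from hs)
  have htop : Tendsto (fun s => φ s - m * Real.log (s - rp)) (𝓝[>] rp) atTop := by
    simp only [sub_eq_add_neg]
    exact ha.add_atTop (tendsto_neg_atBot_atTop.comp (hlog.const_mul_atBot hm0))
  set x := (rp + r1) / 2 with hx
  have hx1 : rp < x := by rw [hx]; linarith
  have hx2 : x < r1 := by rw [hx]; linarith
  have e1 := htop.eventually (eventually_gt_atTop (φ x - m * Real.log (x - rp)))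
  obtain ⟨s, hs, hs'⟩ := (e1.and (Ioo_mem_nhdsGT hx1)).exists
  exact absurd (hmono ⟨hs'.1, hs'.2.trans hx2⟩ ⟨hx1, hx2⟩ hs'.2.le) (not_le.2 hs)

lemma slope_const_mul (k : ℝ) (y : ℝ → ℝ) (r : ℝ) :
    slope rp D G q (fun s => k * y s) r = k * slope rp D G q y r := by
  have : flux rp D G q (fun s => k * y s) r = k * flux rp D G q y r := by
    rw [flux, flux, ← intervalIntegral.integral_const_mul]
    congr 1; ext t; ring
  rw [slope, slope, this]; ring

lemma IsRegularSol.const_mul {y : ℝ → ℝ} (hy : IsRegularSol rp D G q a y) (k : ℝ) :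
    IsRegularSol rp D G q (k * a) fun s => k * y s := by
  obtain ⟨B, hB⟩ := hy.bdd
  refine ⟨continuousOn_const.mul hy.cont, ⟨|k| * B, fun r hr => ?_⟩, fun r hr => ?_⟩
  · rw [abs_mul]; exact mul_le_mul_of_nonneg_left (hB r hr) (abs_nonneg k)
  · simp only [slope_const_mul, intervalIntegral.integral_const_mul]
    rw [hy.eq r hr]; ring

/-- A bounded Dirichlet solution of the radial equation that extends continuously to the horizon
is a multiple of the regular solution. -/
theorem exists_regularSol_of_solution (hrp : 0 < rp) (hc : 0 < c) (hC : 0 ≤ C) (hD0 : 0 < D)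
    (hD : D < 3 / 2) (hα : α = (3 / 2 - D) ^ 2 - 3 * (3 / 2 - D))
    (h : IsRadialCoef rp L α C c G q) (hφ : ∀ r ∈ Ioi rp, HasDerivAt φ (φ' r) r)
    (heq : ∀ r ∈ Ioi rp, HasDerivAt (fun s => s * hprim rp G s * φ' s) (q r * φ r) r)
    (hbdd : ∃ B, ∀ r ∈ Ioi rp, |φ r| ≤ B) (ha : Tendsto φ (𝓝[>] rp) (𝓝 a))
    (hdir : Tendsto (fun r => r ^ (3 / 2 - D) * φ r) atTop (𝓝 0)) (hne : ∃ r ∈ Ioi rp, φ r ≠ 0) :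
    ∃ y, IsRegularSol rp D G q 1 y ∧ Tendsto y atTop (𝓝 0) := by
  obtain ⟨B, hB⟩ := hbdd
  have hφc : ContinuousOn φ (Ioi rp) := fun r hr => (hφ r hr).continuousAt.continuousWithinAt
  have hφl : LocBdd rp φ := locBdd_of_bdd hφc hB
  have hql : LocBdd rp fun s => q s * φ s := h.locBddq.mul hφl
  have hr1 : rp < rp + 1 := by linarith
  set X : ℝ → ℝ := fun s => s * hprim rp G s * φ' s with hX
  -- The integration constant of the flux is its horizon limit; regularity of the solution amounts
  -- to `l = 0`.
  set l := X (rp + 1) - ∫ s in rp..(rp + 1), q s * φ s with hl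
  have hXeq : ∀ r ∈ Ioi rp, X r = l + ∫ s in rp..r, q s * φ s := by
    intro r hr
    have : X r - ∫ s in rp..r, q s * φ s = X (rp + 1) - ∫ s in rp..(rp + 1), q s * φ s := by
      refine isOpen_Ioi.is_const_of_deriv_eq_zero isPreconnected_Ioi (s := Ioi rp)
        (f := fun r => X r - ∫ s in rp..r, q s * φ s) ?_ ?_ hr hr1
      · exact fun s hs => ((heq s hs).sub (hql.hasDerivAt hs)).differentiableAt
          |>.differentiableWithinAt
      · intro s hs
        have := ((heq s hs).sub (hql.hasDerivAt hs)).deriv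
        rw [sub_self] at this
        exact this
    rw [hl]; linarith
  have hXl : Tendsto X (𝓝[>] rp) (𝓝 l) := by
    have := hql.tendsto_primitive.const_add l
    rw [add_zero] at this
    refine this.congr' ?_
    filter_upwards [self_mem_nhdsWithin] with r hr using (hXeq r hr).symm
  have hl0 : l = 0 := by
    rcases lt_trichotomy l 0 with h1 | h1 | h1
    · refine (not_tendsto_flux_pos (φ := fun r => -φ r) (φ' := fun r => -φ' r) h hrp hc
        (fun r hr => (hφ r hr).neg) ha.neg (neg_pos.2 h1) ?_).elim
      refine hXl.neg.congr fun r => ?_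
      rw [hX]; ring
    · exact h1
    · exact (not_tendsto_flux_pos h hrp hc hφ ha h1 hXl).elim
  rw [hl0] at hXl
  set y : ℝ → ℝ := fun r => r ^ (3 / 2 - D) * φ r with hy
  set v : ℝ → ℝ := fun r => r ^ (D - 3 / 2) * (X r + (3 / 2 - D) * (hprim rp G r * φ r)) with hv
  have hyd : ∀ r ∈ Ioi rp, HasDerivAt y (r ^ (3 - 2 * D) / (r * hprim rp G r) * v r) r := by
    intro r hr
    have hr0 : 0 < r := hrp.trans hr
    have hU := h.hprim_pos hrp hc hr
    refine ((Real.hasDerivAt_rpow_const (p := 3 / 2 - D) (Or.inl hr0.ne')).mul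
      (hφ r hr)).congr_deriv ?_
    obtain ⟨e1, e2, -⟩ := rpow_weights hr0 D
    have hp := Real.rpow_pos_of_pos hr0 (D - 3 / 2)
    rw [Real.rpow_sub_one hr0.ne', hv, hX]
    simp only
    rw [e1, e2]
    generalize r ^ (D - 3 / 2) = Z at *
    field_simp
    ring
  have hvd : ∀ r ∈ Ioi rp, HasDerivAt v (r ^ (2 * D - 3) * (redCoef rp D G q r * y r)) r := by
    intro r hr
    have hr0 : 0 < r := hrp.trans hr
    have d := (Real.hasDerivAt_rpow_const (p := D - 3 / 2) (Or.inl hr0.ne')).mul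
      ((heq r hr).add (((h.hasDerivAt_hprim hr).mul (hφ r hr)).const_mul (3 / 2 - D)))
    refine d.congr_deriv ?_
    obtain ⟨e1, -, e3⟩ := rpow_weights hr0 D
    have hp := Real.rpow_pos_of_pos hr0 (D - 3 / 2)
    simp only [Pi.mul_apply, Pi.add_apply]
    rw [Real.rpow_sub_one hr0.ne', hy, redCoef]
    simp only
    rw [e1, e3]
    generalize r ^ (D - 3 / 2) = Z at *
    field_simp
    ring
  have hyc : ContinuousOn y (Ioi rp) := fun r hr => (hyd r hr).continuousAt.continuousWithinAt
  have hyb : ∃ K, ∀ r ∈ Ioi rp, |y r| ≤ K := by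
    obtain ⟨R, hR⟩ := eventually_atTop.1 (hdir.eventually (Metric.ball_mem_nhds 0 one_pos))
    set R' := max R rp with hR'
    have hR0 : 0 < R' := lt_of_lt_of_le hrp (le_max_right _ _)
    have hB0 : 0 ≤ B := (abs_nonneg _).trans (hB (rp + 1) hr1)
    refine ⟨R' ^ (3 / 2 - D) * B + 1, fun r hr => ?_⟩
    have hr0 : 0 < r := hrp.trans hr
    rcases le_total r R' with hrR | hrR
    · rw [hy]
      simp only
      rw [abs_mul, abs_of_pos (Real.rpow_pos_of_pos hr0 _)]
      have : r ^ (3 / 2 - D) * |φ r| ≤ R' ^ (3 / 2 - D) * B :=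
        mul_le_mul (Real.rpow_le_rpow hr0.le hrR (by linarith)) (hB r hr) (abs_nonneg _)
          (Real.rpow_nonneg hR0.le _)
      linarith
    · have h1 := hR r ((le_max_left _ _).trans hrR)
      rw [dist_zero_right, Real.norm_eq_abs] at h1
      have : 0 ≤ R' ^ (3 / 2 - D) * B := mul_nonneg (Real.rpow_nonneg hR0.le _) hB0
      linarith
  obtain ⟨K, hK⟩ := hyb
  have hyl : LocBdd rp y := locBdd_of_bdd hyc hK
  have hpow : ∀ p : ℝ, Tendsto (fun r : ℝ => r ^ p) (𝓝[>] rp) (𝓝 (rp ^ p)) := fun p =>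
    (Real.continuousAt_rpow_const rp _ (Or.inl hrp.ne')).tendsto.mono_left nhdsWithin_le_nhds
  have hv0 : Tendsto v (𝓝[>] rp) (𝓝 0) := by
    have := (hpow (D - 3 / 2)).mul
      (hXl.add ((h.locBddG.tendsto_primitive.mul ha).const_mul (3 / 2 - D)))
    rwa [zero_mul, mul_zero, add_zero, mul_zero] at this
  have hflux : ∀ r ∈ Ioi rp, flux rp D G q y r = v r := fun r hr => by
    rw [flux, (h.locBdd_fluxIntegrand hrp hyl).integral_eq hr hvd hv0, sub_zero]
  have hreg : IsRegularSol rp D G q (rp ^ (3 / 2 - D) * a) y := by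
    refine ⟨hyc, ⟨K, hK⟩, fun r hr => ?_⟩
    rw [(h.locBdd_slope hrp hc hC hD0 hD hα hyc hK).integral_eq hr (F := y)
      (fun s hs => (hyd s hs).congr_deriv (by rw [slope, hflux s hs])) ((hpow _).mul ha)]
    ring
  -- A regular solution with zero horizon value is identically zero, so nontriviality allows
  -- normalisation to `1`.
  have ha0 : rp ^ (3 / 2 - D) * a ≠ 0 := by
    intro h0
    rw [h0] at hreg
    obtain ⟨r, hr, hne⟩ := hne
    have := hreg.eq_zero hrp hc hC hD0 hD hα h hr
    rcases mul_eq_zero.1 this with h1 | h1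
    · exact (Real.rpow_pos_of_pos (hrp.trans hr) _).ne' h1
    · exact hne h1
  have hone := hreg.const_mul (rp ^ (3 / 2 - D) * a)⁻¹
  rw [inv_mul_cancel₀ ha0] at hone
  refine ⟨_, hone, ?_⟩
  simpa using hdir.const_mul (rp ^ (3 / 2 - D) * a)⁻¹

end Regularity

/-! ### Sturm comparison and positivity. -/

section Sturm

variable {rp L α C c D : ℝ} {G q y : ℝ → ℝ}

/-- Picone's identity: a solution that is positive on `[s₁, s₂]` forbids negative test functions. -/
lemma IsRegularSol.picone (hrp : 0 < rp) (hc : 0 < c) (hC : 0 ≤ C) (hD0 : 0 < D)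
    (hD : D < 3 / 2) (hα : α = (3 / 2 - D) ^ 2 - 3 * (3 / 2 - D))
    (h : IsRadialCoef rp L α C c G q) (hy : IsRegularSol rp D G q 1 y)
    (hpos : ∀ r ∈ Ioi rp, 0 < y r)
    {s₁ s₂ : ℝ} (h1 : rp < s₁) (h12 : s₁ < s₂) {g g' H H' : ℝ → ℝ}
    (hg : ∀ s ∈ Icc s₁ s₂, HasDerivAt g (g' s) s) (hH : ∀ s ∈ Icc s₁ s₂, HasDerivAt H (H' s) s)
    (hg1 : g s₁ = 0) (hg2 : g s₂ = 0) (hH12 : H s₁ = H s₂)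
    (hlt : ∀ s ∈ Ioo s₁ s₂, s * hprim rp G s * g' s ^ 2 + q s * g s ^ 2 < H' s) : False := by
  set φ := radialSol D y with hφ
  set φ' := radialDer rp D G q y with hφ'
  have hφpos : ∀ s ∈ Icc s₁ s₂, 0 < φ s := fun s hs =>
    mul_pos (Real.rpow_pos_of_pos (hrp.trans (h1.trans_le hs.1)) _) (hpos s (h1.trans_le hs.1))
  -- Completing the square in Picone's identity. The corrector `H` has equal end values, so it lets
  -- the integrated form be negative while only a pointwise comparison with `H'` has to be verified.
  have hd : ∀ s ∈ Icc s₁ s₂, HasDerivAt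
      (fun s => g s ^ 2 * (s * hprim rp G s * φ' s / φ s) - H s)
      (s * hprim rp G s * g' s ^ 2 + q s * g s ^ 2 -
        s * hprim rp G s * (g' s - g s * φ' s / φ s) ^ 2 - H' s) s := by
    intro s hs
    have hs1 : rp < s := h1.trans_le hs.1
    have hp := hφpos s hs
    have d := (((hg s hs).pow 2).mul ((hy.hasDerivAt_equation hrp hc hC hD0 hD hα h hs1).div
      (hy.hasDerivAt_radialSol hrp hc hC hD0 hD hα h hs1) hp.ne')).sub (hH s hs)
    refine d.congr_deriv ?_
    simp only [Pi.pow_apply, Pi.div_apply]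
    rw [← hφ, ← hφ']
    field_simp
    ring
  have hanti : StrictAntiOn (fun s => g s ^ 2 * (s * hprim rp G s * φ' s / φ s) - H s)
      (Icc s₁ s₂) := by
    refine strictAntiOn_of_deriv_neg (convex_Icc _ _)
      (fun s hs => (hd s hs).continuousAt.continuousWithinAt) fun s hs => ?_
    rw [interior_Icc] at hs
    rw [(hd s (Ioo_subset_Icc_self hs)).deriv]
    have h2 := hlt s hs
    have hs1 : rp < s := h1.trans hs.1
    have h3 : 0 ≤ s * hprim rp G s * (g' s - g s * φ' s / φ s) ^ 2 :=
      mul_nonneg (mul_pos (hrp.trans hs1) (h.hprim_pos hrp hc hs1)).le (sq_nonneg _)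
    linarith
  have := hanti (left_mem_Icc.2 h12.le) (right_mem_Icc.2 h12.le) h12
  simp only [hg1, hg2, hH12] at this
  linarith

/-- A positive solution is incompatible with an oscillatory comparison equation. -/
lemma IsRegularSol.not_pos_of_sine (hrp : 0 < rp) (hc : 0 < c) (hC : 0 ≤ C) (hD0 : 0 < D)
    (hD : D < 3 / 2) (hα : α = (3 / 2 - D) ^ 2 - 3 * (3 / 2 - D))
    (h : IsRadialCoef rp L α C c G q) (hy : IsRegularSol rp D G q 1 y)
    {s₁ s₂ p V : ℝ} (h1 : rp < s₁) (h12 : s₁ < s₂)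
    (hp : ∀ s ∈ Icc s₁ s₂, s * hprim rp G s ≤ p) (hV : ∀ s ∈ Icc s₁ s₂, q s ≤ -V)
    (hpV : p * (Real.pi / (s₂ - s₁)) ^ 2 < V) : ¬∀ r ∈ Ioi rp, 0 < y r := by
  intro hpos
  set k := Real.pi / (s₂ - s₁) with hk
  have hk0 : 0 < k := div_pos Real.pi_pos (sub_pos.2 h12)
  have hk2 : k * (s₂ - s₁) = Real.pi := div_mul_cancel₀ _ (sub_pos.2 h12).ne'
  have hθ : ∀ s, HasDerivAt (fun s => k * (s - s₁)) k s := fun s => by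
    simpa using ((hasDerivAt_id s).sub_const s₁).const_mul k
  -- For constant coefficients `p (g')² - p k² g² = H'` with `g = sin θ` and `H = p k sin θ cos θ`;
  -- the strict gap `V - p k²` gives the inequality.
  refine hy.picone hrp hc hC hD0 hD hα h hpos h1 h12 (g := fun s => Real.sin (k * (s - s₁)))
    (g' := fun s => Real.cos (k * (s - s₁)) * k)
    (H := fun s => p * k * (Real.sin (k * (s - s₁)) * Real.cos (k * (s - s₁))))
    (H' := fun s => p * k ^ 2 * (Real.cos (k * (s - s₁)) ^ 2 - Real.sin (k * (s - s₁)) ^ 2))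
    (fun s _ => (hθ s).sin)
    (fun s _ => (((hθ s).sin.mul (hθ s).cos).const_mul (p * k)).congr_deriv (by ring))
    (by simp) (by simp [hk2]) (by simp [hk2]) fun s hs => ?_
  have hsin : 0 < Real.sin (k * (s - s₁)) := by
    refine Real.sin_pos_of_pos_of_lt_pi (mul_pos hk0 (sub_pos.2 hs.1)) ?_
    rw [← hk2]
    exact mul_lt_mul_of_pos_left (by linarith [hs.2]) hk0
  have a1 := hp s (Ioo_subset_Icc_self hs)
  have a2 := hV s (Ioo_subset_Icc_self hs)
  have a3 : s * hprim rp G s * (Real.cos (k * (s - s₁)) * k) ^ 2 ≤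
      p * (Real.cos (k * (s - s₁)) * k) ^ 2 := by gcongr
  have a4 : q s * Real.sin (k * (s - s₁)) ^ 2 ≤ -V * Real.sin (k * (s - s₁)) ^ 2 := by gcongr
  have a5 : 0 < (V - p * k ^ 2) * Real.sin (k * (s - s₁)) ^ 2 :=
    mul_pos (sub_pos.2 hpV) (pow_pos hsin 2)
  nlinarith

/-- A positive solution is incompatible with a violation of the near-horizon
Breitenlohner–Freedman bound. -/
lemma IsRegularSol.not_pos_of_log_sine (hrp : 0 < rp) (hc : 0 < c) (hC : 0 ≤ C) (hD0 : 0 < D)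
    (hD : D < 3 / 2) (hα : α = (3 / 2 - D) ^ 2 - 3 * (3 / 2 - D))
    (h : IsRadialCoef rp L α C c G q) (hy : IsRegularSol rp D G q 1 y)
    {k ξ₀ p V : ℝ} (hk : 0 < k) (hξ₀ : 0 < ξ₀)
    (hp : ∀ s ∈ Icc (rp + ξ₀) (rp + ξ₀ * Real.exp (Real.pi / k)),
      s * hprim rp G s ≤ p * (s - rp) ^ 2)
    (hV : ∀ s ∈ Icc (rp + ξ₀) (rp + ξ₀ * Real.exp (Real.pi / k)), q s ≤ -V)
    (hpV : p * (1 / 4 + k ^ 2) < V) : ¬∀ r ∈ Ioi rp, 0 < y r := by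
  intro hpos
  -- With `ξ = s - rp`, the function `ξ^{-1/2} sin(k log(ξ/ξ₀))` solves the Euler equation `(ξ² g')'
  -- + (1/4 + k²) g = 0`; the window is exactly one half-period.
  set θ : ℝ → ℝ := fun s => k * (Real.log (s - rp) - Real.log ξ₀) with hθ
  have hexp : 1 < Real.exp (Real.pi / k) := Real.one_lt_exp_iff.2 (div_pos Real.pi_pos hk)
  have h12 : rp + ξ₀ < rp + ξ₀ * Real.exp (Real.pi / k) := by nlinarith
  have hξ : ∀ s ∈ Icc (rp + ξ₀) (rp + ξ₀ * Real.exp (Real.pi / k)), 0 < s - rp := fun s hs => by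
    linarith [hs.1]
  have hlog : ∀ s ∈ Icc (rp + ξ₀) (rp + ξ₀ * Real.exp (Real.pi / k)),
      HasDerivAt (fun s => Real.log (s - rp)) (1 / (s - rp)) s := fun s hs =>
    ((hasDerivAt_id s).sub_const rp).log (hξ s hs).ne'
  have hθd : ∀ s ∈ Icc (rp + ξ₀) (rp + ξ₀ * Real.exp (Real.pi / k)),
      HasDerivAt θ (k * (1 / (s - rp))) s := fun s hs => ((hlog s hs).sub_const _).const_mul k
  have hθ1 : θ (rp + ξ₀) = 0 := by simp [hθ]
  have hθ2 : θ (rp + ξ₀ * Real.exp (Real.pi / k)) = Real.pi := by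
    simp only [hθ, add_sub_cancel_left]
    rw [Real.log_mul hξ₀.ne' (Real.exp_pos _).ne', Real.log_exp]
    field_simp
    ring
  refine hy.picone hrp hc hC hD0 hD hα h hpos (by linarith) h12
    (g := fun s => Real.exp (-(Real.log (s - rp) / 2)) * Real.sin (θ s))
    (g' := fun s => Real.exp (-(Real.log (s - rp) / 2)) / (s - rp) *
      (k * Real.cos (θ s) - Real.sin (θ s) / 2))
    (H := fun s => p * (k * (Real.sin (θ s) * Real.cos (θ s)) - Real.sin (θ s) ^ 2 / 2))
    (H' := fun s => p * (k / (s - rp)) * (k * (Real.cos (θ s) ^ 2 - Real.sin (θ s) ^ 2) -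
      Real.sin (θ s) * Real.cos (θ s)))
    (fun s hs => ?_) (fun s hs => ?_) (by simp [hθ1]) (by simp [hθ2]) (by simp [hθ1, hθ2])
    fun s hs => ?_
  · refine ((((hlog s hs).div_const 2).neg.exp).mul (hθd s hs).sin).congr_deriv ?_
    have := (hξ s hs).ne'
    simp only [Pi.neg_apply]
    field_simp
    ring
  · refine (((((hθd s hs).sin.mul (hθd s hs).cos).const_mul k).sub
      (((hθd s hs).sin.pow 2).div_const 2)).const_mul p).congr_deriv ?_
    have := (hξ s hs).ne'
    field_simp
    ring
  · have hs' := Ioo_subset_Icc_self hs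
    have hx := hξ s hs'
    have hsin : 0 < Real.sin (θ s) := by
      refine Real.sin_pos_of_pos_of_lt_pi ?_ ?_
      · have : Real.log ξ₀ < Real.log (s - rp) := Real.log_lt_log hξ₀ (by linarith [hs.1])
        exact mul_pos hk (sub_pos.2 this)
      · rw [← hθ2]
        refine mul_lt_mul_of_pos_left (sub_lt_sub_right ?_ _) hk
        exact Real.log_lt_log hx (by linarith [hs.2])
    have hE : Real.exp (-(Real.log (s - rp) / 2)) ^ 2 = 1 / (s - rp) := by
      rw [← Real.exp_nat_mul, one_div, ← Real.exp_log hx, ← Real.exp_neg, Real.log_exp]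
      congr 1; push_cast; ring
    have a1 := hp s hs'
    have a2 := hV s hs'
    have a3 : s * hprim rp G s * (Real.exp (-(Real.log (s - rp) / 2)) / (s - rp) *
        (k * Real.cos (θ s) - Real.sin (θ s) / 2)) ^ 2 ≤
        p / (s - rp) * (k * Real.cos (θ s) - Real.sin (θ s) / 2) ^ 2 := by
      rw [mul_pow, div_pow, hE]
      calc _ ≤ p * (s - rp) ^ 2 * (1 / (s - rp) / (s - rp) ^ 2 *
            (k * Real.cos (θ s) - Real.sin (θ s) / 2) ^ 2) := by gcongr
        _ = _ := by field_simp
    have a4 : q s * (Real.exp (-(Real.log (s - rp) / 2)) * Real.sin (θ s)) ^ 2 ≤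
        -V / (s - rp) * Real.sin (θ s) ^ 2 := by
      rw [mul_pow, hE]
      calc _ ≤ -V * (1 / (s - rp) * Real.sin (θ s) ^ 2) := by gcongr
        _ = _ := by ring
    have a5 : 0 < (V - p * (1 / 4 + k ^ 2)) / (s - rp) * Real.sin (θ s) ^ 2 :=
      mul_pos (div_pos (sub_pos.2 hpV) hx) (pow_pos hsin 2)
    have e : p * (k / (s - rp)) * (k * (Real.cos (θ s) ^ 2 - Real.sin (θ s) ^ 2) -
        Real.sin (θ s) * Real.cos (θ s)) =
        p / (s - rp) * (k * Real.cos (θ s) - Real.sin (θ s) / 2) ^ 2 +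
        -V / (s - rp) * Real.sin (θ s) ^ 2 +
        (V - p * (1 / 4 + k ^ 2)) / (s - rp) * Real.sin (θ s) ^ 2 := by
      field_simp
      ring
    rw [e]
    linarith

/-- A nonnegative regular solution is positive. -/
lemma IsRegularSol.pos_of_nonneg (hrp : 0 < rp) (hc : 0 < c) (hC : 0 ≤ C) (hD0 : 0 < D)
    (hD : D < 3 / 2) (hα : α = (3 / 2 - D) ^ 2 - 3 * (3 / 2 - D))
    (h : IsRadialCoef rp L α C c G q) (hy : IsRegularSol rp D G q 1 y)
    (hnn : ∀ r ∈ Ioi rp, 0 ≤ y r) : ∀ r ∈ Ioi rp, 0 < y r := by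
  intro r1 hr1
  refine (hnn r1 hr1).lt_of_ne' fun hzero => ?_
  have hr1' : rp < r1 := hr1
  have hyd : ∀ r ∈ Ioi rp, HasDerivAt y
      (r ^ (3 - 2 * D) / (r * hprim rp G r) * flux rp D G q y r) r := fun r hr =>
    hy.hasDerivAt hrp hc hC hD0 hD hα h hr
  have hvd : ∀ r ∈ Ioi rp, HasDerivAt (flux rp D G q y)
      (r ^ (2 * D - 3) * redCoef rp D G q r * y r) r := fun r hr =>
    (h.hasDerivAt_flux hrp hy.locBdd hr).congr_deriv (by ring)
  have hmin : IsLocalMin y r1 := by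
    filter_upwards [Ioi_mem_nhds hr1'] with s hs
    rw [hzero]; exact hnn s hs
  have hv1 : flux rp D G q y r1 = 0 := by
    have h0 := hmin.hasDerivAt_eq_zero (hyd r1 hr1)
    have hr0 := hrp.trans hr1'
    have := (div_pos (Real.rpow_pos_of_pos hr0 (3 - 2 * D))
      (mul_pos hr0 (h.hprim_pos hrp hc hr1'))).ne'
    exact (mul_eq_zero.1 h0).resolve_left this
  have hev := (hy.tendsto_horizon hrp hc hC hD0 hD hα h).eventually (lt_mem_nhds one_pos)
  obtain ⟨r0, hr0, hr0'⟩ := (hev.and (Ioo_mem_nhdsGT hr1')).exists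
  have hsub : Icc r0 r1 ⊆ Ioi rp := fun s hs => hr0'.1.trans_le hs.1
  have hAc : ContinuousOn (fun r => r ^ (3 - 2 * D) / (r * hprim rp G r)) (Icc r0 r1) :=
    ((LocBdd.rpow hrp _).cont.div (continuousOn_id.mul h.locBddG.primitive.cont) fun r hr =>
      (mul_pos (hrp.trans hr) (h.hprim_pos hrp hc hr)).ne').mono hsub
  have hBc : ContinuousOn (fun r => r ^ (2 * D - 3) * redCoef rp D G q r) (Icc r0 r1) :=
    ((LocBdd.rpow hrp _).mul (h.locBdd_redCoef hrp)).cont.mono hsub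
  -- A Grönwall estimate: with `N` bounding the sum of the two coefficients of the system for `(y,
  -- flux)`, `(y² + flux²) e^{Nr}` is nondecreasing. It is positive at `r0`, whereas a zero minimum
  -- at `r1` would make both components vanish.
  obtain ⟨N, hN⟩ := isCompact_Icc.exists_bound_of_continuousOn (hAc.add hBc)
  have hN0 : 0 ≤ N := (norm_nonneg _).trans (hN r0 (left_mem_Icc.2 hr0'.2.le))
  set A : ℝ → ℝ := fun r => r ^ (3 - 2 * D) / (r * hprim rp G r)
  set Bf : ℝ → ℝ := fun r => r ^ (2 * D - 3) * redCoef rp D G q r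
  have hd : ∀ r ∈ Icc r0 r1, HasDerivAt
      (fun r => (y r ^ 2 + flux rp D G q y r ^ 2) * Real.exp (N * r))
      ((2 * (A r + Bf r) * (y r * flux rp D G q y r) +
        N * (y r ^ 2 + flux rp D G q y r ^ 2)) * Real.exp (N * r)) r := by
    intro r hr
    have d := (((hyd r (hsub hr)).pow 2).add ((hvd r (hsub hr)).pow 2)).mul
      ((hasDerivAt_id r).const_mul N).exp
    refine d.congr_deriv ?_
    simp only [Pi.pow_apply, Pi.add_apply, id, A, Bf]
    ring
  have hmono : MonotoneOn (fun r => (y r ^ 2 + flux rp D G q y r ^ 2) * Real.exp (N * r))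
      (Icc r0 r1) := by
    refine monotoneOn_of_deriv_nonneg (convex_Icc _ _)
      (fun s hs => (hd s hs).continuousAt.continuousWithinAt) ?_ ?_
    · rw [interior_Icc]
      exact fun s hs => (hd s (Ioo_subset_Icc_self hs)).differentiableAt.differentiableWithinAt
    · rw [interior_Icc]
      intro s hs
      have hs' := Ioo_subset_Icc_self hs
      rw [(hd s hs').deriv]
      refine mul_nonneg ?_ (Real.exp_pos _).le
      have h1 := hN s hs'
      rw [Real.norm_eq_abs, abs_le] at h1
      have h1a : -N ≤ A s + Bf s := h1.1
      have h1b : A s + Bf s ≤ N := h1.2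
      set v := flux rp D G q y s
      nlinarith [mul_nonneg (by linarith : 0 ≤ N + (A s + Bf s)) (sq_nonneg (y s + v)),
        mul_nonneg (by linarith : 0 ≤ N - (A s + Bf s)) (sq_nonneg (y s - v))]
  have := hmono (left_mem_Icc.2 hr0'.2.le) (right_mem_Icc.2 hr0'.2.le) hr0'.2.le
  simp only [hzero, hv1] at this
  have h2 : 0 < (y r0 ^ 2 + flux rp D G q y r0 ^ 2) * Real.exp (N * r0) :=
    mul_pos (by have := pow_pos hr0 2; positivity) (Real.exp_pos _)
  norm_num at this
  linarith

/-- A positive regular solution that is not Dirichlet is bounded below. -/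
lemma IsRegularSol.exists_lower_bound (hrp : 0 < rp) (hc : 0 < c) (hC : 0 ≤ C) (hD0 : 0 < D)
    (hD : D < 3 / 2) (hα : α = (3 / 2 - D) ^ 2 - 3 * (3 / 2 - D))
    (h : IsRadialCoef rp L α C c G q) (hy : IsRegularSol rp D G q 1 y)
    (hpos : ∀ r ∈ Ioi rp, 0 < y r) (hnd : ¬Tendsto y atTop (𝓝 0)) :
    ∃ m > 0, ∀ r ∈ Ioi rp, m ≤ y r := by
  obtain ⟨F, hF⟩ := hy.exists_limit hrp hc hC hD0 hD hα h
  have hF0 : 0 < F := by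
    refine (ge_of_tendsto hF ?_).lt_of_ne' fun h0 => hnd (h0 ▸ hF)
    filter_upwards [Ioi_mem_atTop rp] with r hr using (hpos r hr).le
  obtain ⟨R, hR⟩ := eventually_atTop.1 (hF.eventually (lt_mem_nhds (half_lt_self hF0)))
  have hev := (hy.tendsto_horizon hrp hc hC hD0 hD hα h).eventually
    (lt_mem_nhds (half_lt_self one_pos))
  obtain ⟨u, hu, hsub⟩ := (mem_nhdsGT_iff_exists_Ioo_subset).1 hev
  have hu' : rp < u := hu
  set r0 := (rp + u) / 2 with hr0
  have h1 : rp < r0 := by rw [hr0]; linarith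
  have h2 : r0 < u := by rw [hr0]; linarith
  obtain ⟨x, hx, hmin⟩ := (isCompact_Icc (a := r0) (b := max R r0)).exists_isMinOn
    (nonempty_Icc.2 (le_max_right _ _)) (hy.cont.mono fun s hs => h1.trans_le hs.1)
  -- Three regions: near infinity `y > F/2`, near the horizon `y > 1/2`, and a compact minimum in
  -- between.
  refine ⟨min (y x) (min (F / 2) (1 / 2)), lt_min (hpos x (h1.trans_le hx.1))
    (lt_min (half_pos hF0) (by norm_num)), fun r hr => ?_⟩
  rcases lt_or_ge r r0 with hlt | hge
  · have : 1 / 2 < y r := hsub ⟨hr, hlt.trans h2⟩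
    exact (min_le_right _ _).trans ((min_le_right _ _).trans this.le)
  · rcases le_total r (max R r0) with hle | hle
    · exact (min_le_left _ _).trans (hmin ⟨hge, hle⟩)
    · exact (min_le_right _ _).trans ((min_le_left _ _).trans
        (hR r ((le_max_left _ _).trans hle)).le)

end Sturm

/-! ### The Reissner–Nordström–AdS family. -/

/-- `(r Ω²)'` for the Reissner–Nordström-AdS metric with charge `e`. -/
abbrev rnDer (L α e : ℝ) : ℝ → ℝ := metricDer L α (fun _ => 1) (fun _ => e) fun _ => 0

/-- `r² A / Ω²` for the Reissner–Nordström-AdS metric with charge `e`. -/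
abbrev rnRatio (rp L α e : ℝ) : ℝ → ℝ := gaugeRatio rp L α (fun _ => 1) (fun _ => e) fun _ => 0

/-- The zeroth order coefficient of the Klein–Gordon equation on Reissner–Nordström-AdS. -/
abbrev rnMass (rp L α q₀ e : ℝ) : ℝ → ℝ :=
  massCoef rp L α q₀ (fun _ => 1) (fun _ => e) (rnRatio rp L α e)

section ReissnerNordstrom

variable {rp L α q₀ e : ℝ}

lemma rnDer_eq (L α e s : ℝ) : rnDer L α e s = 1 - e ^ 2 / s ^ 2 + 3 * L * s ^ 2 := by
  simp [rnDer, metricDer]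

lemma hprim_rnDer (hrp : 0 < rp) {r : ℝ} (hr : rp < r) :
    hprim rp (rnDer L α e) r = (r - rp) - e ^ 2 * (1 / rp - 1 / r) + L * (r ^ 3 - rp ^ 3) := by
  have hpos : ∀ x ∈ uIcc rp r, 0 < x := fun x hx => by
    rw [uIcc_of_le hr.le] at hx; exact hrp.trans_le hx.1
  have hd : ∀ x ∈ uIcc rp r, HasDerivAt (fun x => x + e ^ 2 * x⁻¹ + L * x ^ 3) (rnDer L α e x) x :=
    fun x hx => by
      have h0 := (hpos x hx).ne'
      refine (((hasDerivAt_id x).add ((hasDerivAt_inv h0).const_mul (e ^ 2))).add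
        ((hasDerivAt_pow 3 x).const_mul L)).congr_deriv ?_
      rw [rnDer_eq]; norm_num; ring
  have hc : ContinuousOn (rnDer L α e) (uIcc rp r) := by
    rw [show rnDer L α e = fun s => 1 - e ^ 2 / s ^ 2 + 3 * L * s ^ 2 from funext (rnDer_eq L α e)]
    exact (continuousOn_const.sub (continuousOn_const.div (by fun_prop)
      fun s hs => (pow_pos (hpos s hs) 2).ne')).add (by fun_prop)
  rw [hprim, intervalIntegral.integral_eq_sub_of_hasDerivAt hd hc.intervalIntegrable]
  ring

lemma gaugePot_rn (hrp : 0 < rp) {r : ℝ} (hr : rp < r) :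
    gaugePot rp (fun _ => 1) (fun _ => e) r = e * (1 / rp - 1 / r) := by
  have hpos : ∀ x ∈ uIcc rp r, 0 < x := fun x hx => by
    rw [uIcc_of_le hr.le] at hx; exact hrp.trans_le hx.1
  have hd : ∀ x ∈ uIcc rp r, HasDerivAt (fun x => -e * x⁻¹) (1 * e / x ^ 2) x := fun x hx =>
    ((hasDerivAt_inv (hpos x hx).ne').const_mul (-e)).congr_deriv (by ring)
  have hc : ContinuousOn (fun x => 1 * e / x ^ 2) (uIcc rp r) :=
    continuousOn_const.div (by fun_prop) fun s hs => (pow_pos (hpos s hs) 2).ne'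
  rw [gaugePot, intervalIntegral.integral_eq_sub_of_hasDerivAt hd hc.intervalIntegrable]
  ring

lemma rnMass_eq (hrp : 0 < rp) {r : ℝ} (hr : rp < r) :
    rnMass rp L α q₀ e r = L * α * r ^ 2 -
      q₀ ^ 2 * (r ^ 3 * (1 / rp - 1 / r) ^ 2 * (e ^ 2 / hprim rp (rnDer L α e) r)) := by
  rw [rnMass, massCoef, rnRatio, gaugeRatio, gaugePot_rn hrp hr]
  ring

/-- The hypothesis is subextremality at the largest charge. Smaller charges and larger radii only
improve the bound, so one `c` serves the whole range; the `4` is a reserve for perturbation by a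
source. -/
lemma exists_rn_lower (hrp : 0 < rp) (hL : 0 < L) {E₀ : ℝ}
    (h : 0 < 1 - E₀ ^ 2 / rp ^ 2 + 3 * L * rp ^ 2) :
    ∃ c > 0, ∀ e ∈ Icc 0 E₀, ∀ s ∈ Ioi rp, 4 * c * s ^ 2 ≤ 1 - e ^ 2 / s ^ 2 + 3 * L * s ^ 2 := by
  set c0 := 1 - E₀ ^ 2 / rp ^ 2 + 3 * L * rp ^ 2
  refine ⟨min (c0 / rp ^ 2) (3 * L) / 4, by positivity, fun e he s hs => ?_⟩
  have hrs : rp < s := hs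
  have h1 : e ^ 2 / s ^ 2 ≤ E₀ ^ 2 / rp ^ 2 :=
    div_le_div₀ (by positivity) (pow_le_pow_left₀ he.1 he.2 2) (by positivity)
      (pow_le_pow_left₀ hrp.le hrs.le 2)
  have h2 : rp ^ 2 ≤ s ^ 2 := pow_le_pow_left₀ hrp.le hrs.le 2
  set m := min (c0 / rp ^ 2) (3 * L)
  have h3 : m * rp ^ 2 ≤ c0 := (le_div_iff₀ (by positivity)).1 (min_le_left _ _)
  have h4 : m * (s ^ 2 - rp ^ 2) ≤ 3 * L * (s ^ 2 - rp ^ 2) :=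
    mul_le_mul_of_nonneg_right (min_le_right _ _) (by linarith)
  have h5 : c0 = 1 - E₀ ^ 2 / rp ^ 2 + 3 * L * rp ^ 2 := rfl
  linarith

/-- Backgrounds with a small source, as perturbations of the Reissner–Nordström-AdS family. -/
theorem exists_background_family (hrp : 0 < rp) (hL : 0 < L) (hα : α ≤ 0) (q₀ : ℝ) {E₀ c : ℝ}
    (hE₀ : 0 ≤ E₀) (hc : 0 < c)
    (hlow : ∀ e ∈ Icc 0 E₀, ∀ s ∈ Ioi rp, 4 * c * s ^ 2 ≤ 1 - e ^ 2 / s ^ 2 + 3 * L * s ^ 2) :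
    ∃ B ≥ 0, ∃ C > 0, ∃ K > 0, ∃ ν₀ > 0,
      (∀ e ∈ Icc 0 E₀, IsRadialCoef rp L α C c (rnDer L α e) (rnMass rp L α q₀ e)) ∧
      (∀ e ∈ Icc 0 E₀, ∀ e' ∈ Icc 0 E₀, CoefClose rp (K * |e - e'|) (rnDer L α e)
        (rnMass rp L α q₀ e) (rnDer L α e') (rnMass rp L α q₀ e')) ∧
      ∀ ν ≤ ν₀, ∀ h b, IsSource rp ν h b → ∃ W : ℝ → ℝ → ℝ, ∀ e ∈ Icc 0 E₀,
        IsBgRatio rp L α q₀ B e h b (W e) ∧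
        IsProfile rp L α c (E₀ + 1) (lapse q₀ h b (W e)) (charge rp q₀ e b (W e)) b ∧
        IsRadialCoef rp L α C c (metricDer L α (lapse q₀ h b (W e)) (charge rp q₀ e b (W e)) b)
          (massCoef rp L α q₀ (lapse q₀ h b (W e)) (charge rp q₀ e b (W e)) (W e)) ∧
        CoefClose rp (K * ν)
          (metricDer L α (lapse q₀ h b (W e)) (charge rp q₀ e b (W e)) b)
          (massCoef rp L α q₀ (lapse q₀ h b (W e)) (charge rp q₀ e b (W e)) (W e))
          (rnDer L α e) (rnMass rp L α q₀ e) ∧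
        ∀ e' ∈ Icc 0 E₀, CoefClose rp (K * |e - e'|)
          (metricDer L α (lapse q₀ h b (W e)) (charge rp q₀ e b (W e)) b)
          (massCoef rp L α q₀ (lapse q₀ h b (W e)) (charge rp q₀ e b (W e)) (W e))
          (metricDer L α (lapse q₀ h b (W e')) (charge rp q₀ e' b (W e')) b)
          (massCoef rp L α q₀ (lapse q₀ h b (W e')) (charge rp q₀ e' b (W e')) (W e')) := by
  obtain ⟨B, hB, C, hC, K, hK, ν₀, hν₀, H⟩ := exists_background hrp hL hα q₀ hE₀ hc hlow
  -- The family itself is the case of zero source, so its bounds are read off from the general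
  -- background theorem.
  have hrn : ∀ e ∈ Icc 0 E₀, IsBgRatio rp L α q₀ B e (fun _ => 0) (fun _ => 0)
      (rnRatio rp L α e) := by
    intro e he
    obtain ⟨w, hw⟩ := (H 0 hν₀.le _ _ (isSource_zero rp) e he).1
    have heq : EqOn (rnRatio rp L α e) w (Ioi rp) := fun s hs => by
      have := hw.eq s hs
      rwa [lapse_zero, charge_zero] at this
    refine ⟨hw.cont.congr heq, fun s hs => by rw [heq hs]; exact hw.le s hs, fun s _ => ?_⟩
    rw [lapse_zero, charge_zero]
  refine ⟨B, hB, C, hC, K, hK, ν₀, hν₀, fun e he => ?_, fun e he e' he' => ?_,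
    fun ν hν h b hs => ?_⟩
  · have := ((H 0 hν₀.le _ _ (isSource_zero rp) e he).2 _ (hrn e he)).2.1
    rwa [lapse_zero, charge_zero] at this
  · have := ((H 0 hν₀.le _ _ (isSource_zero rp) e he).2 _ (hrn e he)).2.2.1 e' he' _ (hrn e' he')
    rwa [lapse_zero, charge_zero, lapse_zero, charge_zero] at this
  · have hex : ∀ e, ∃ w, e ∈ Icc 0 E₀ → IsBgRatio rp L α q₀ B e h b w := fun e => by
      by_cases he : e ∈ Icc 0 E₀
      · obtain ⟨w, hw⟩ := (H ν hν h b hs e he).1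
        exact ⟨w, fun _ => hw⟩
      · exact ⟨0, fun h => absurd h he⟩
    choose W hW using hex
    refine ⟨W, fun e he => ?_⟩
    obtain ⟨h1, h2, h3, h4⟩ := (H ν hν h b hs e he).2 _ (hW e he)
    exact ⟨hW e he, h1, h2, h4 _ (hrn e he), fun e' he' => h3 e' he' _ (hW e' he')⟩

lemma rnDer_sub (L α e e' s : ℝ) : rnDer L α e s - rnDer L α e' s = -(e ^ 2 - e' ^ 2) / s ^ 2 := by
  rw [rnDer_eq, rnDer_eq]; ring

/-- At fixed radius `U` is a positive function minus `e²` times a positive one, so `e²/U` increases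
with `e²`. The charge enters `q` only through `-q₀² e²/U` with a nonnegative factor. -/
lemma rnMass_sub_nonpos (hrp : 0 < rp) (hL : 0 < L) {e' s : ℝ} (hs : rp < s)
    (h : 0 < hprim rp (rnDer L α e) s) (h' : 0 < hprim rp (rnDer L α e') s) :
    (e ^ 2 - e' ^ 2) * (rnMass rp L α q₀ e s - rnMass rp L α q₀ e' s) ≤ 0 := by
  rw [rnMass_eq hrp hs, rnMass_eq hrp hs]
  have hs0 := hrp.trans hs
  have e1 := hprim_rnDer (L := L) (α := α) (e := e) hrp hs
  have e2 := hprim_rnDer (L := L) (α := α) (e := e') hrp hs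
  set U := hprim rp (rnDer L α e) s
  set U' := hprim rp (rnDer L α e') s
  set a := 1 / rp - 1 / s with ha
  have h0 : 0 < (s - rp) + L * (s ^ 3 - rp ^ 3) := by
    have := pow_le_pow_left₀ hrp.le hs.le 3
    nlinarith [mul_nonneg hL.le (sub_nonneg.2 this)]
  have key : e ^ 2 / U - e' ^ 2 / U' =
      (e ^ 2 - e' ^ 2) * (((s - rp) + L * (s ^ 3 - rp ^ 3)) / (U * U')) := by
    rw [div_sub_div _ _ h.ne' h'.ne', ← mul_div_assoc]
    congr 1
    rw [e1, e2]; ring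
  have : (e ^ 2 - e' ^ 2) * (L * α * s ^ 2 - q₀ ^ 2 * (s ^ 3 * a ^ 2 * (e ^ 2 / U)) -
      (L * α * s ^ 2 - q₀ ^ 2 * (s ^ 3 * a ^ 2 * (e' ^ 2 / U')))) =
      -(q₀ ^ 2 * s ^ 3 * a ^ 2 * (e ^ 2 - e' ^ 2) ^ 2 *
        (((s - rp) + L * (s ^ 3 - rp ^ 3)) / (U * U'))) := by
    linear_combination (-(e ^ 2 - e' ^ 2) * (q₀ ^ 2 * s ^ 3 * a ^ 2)) * key
  rw [this]
  have : 0 ≤ q₀ ^ 2 * s ^ 3 * a ^ 2 * (e ^ 2 - e' ^ 2) ^ 2 *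
        (((s - rp) + L * (s ^ 3 - rp ^ 3)) / (U * U')) := by positivity
  linarith

end ReissnerNordstrom

/-! ### Continuity method starting from the neutral black hole. -/

lemma LocBdd.tendsto_mul_zero {a : ℝ} {f g : ℝ → ℝ} (hg : LocBdd a g)
    (hf : Tendsto f (𝓝[>] a) (𝓝 0)) : Tendsto (fun s => f s * g s) (𝓝[>] a) (𝓝 0) := by
  obtain ⟨M, hM⟩ := hg.bdd (a + 1)
  have h1 : Tendsto (fun s => |f s| * M) (𝓝[>] a) (𝓝 0) := by simpa using hf.abs.mul_const M
  refine squeeze_zero_norm' ?_ h1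
  filter_upwards [Ioc_mem_nhdsGT (lt_add_one a)] with s hs
  rw [Real.norm_eq_abs, abs_mul]
  exact mul_le_mul_of_nonneg_left (hM s hs) (abs_nonneg _)

/-- A continuous function cannot stop being positive if positivity up to a point implies positivity
at that point. -/
lemma pos_of_forall_Ioo {a : ℝ} {φ : ℝ → ℝ} (hφ : ContinuousOn φ (Ioi a))
    (h0 : ∀ᶠ s in 𝓝[>] a, 0 < φ s)
    (hstep : ∀ r ∈ Ioi a, (∀ s ∈ Ioo a r, 0 < φ s) → 0 < φ r) : ∀ r ∈ Ioi a, 0 < φ r := by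
  by_contra! hex
  obtain ⟨z, hz, hz'⟩ := hex
  obtain ⟨b, hb, hb'⟩ := (mem_nhdsGT_iff_exists_Ioo_subset).1 h0
  set Z := {r | r ∈ Ioi a ∧ φ r ≤ 0} with hZ
  have hbZ : ∀ r ∈ Z, b ≤ r := fun r hr => by
    by_contra! hlt
    exact absurd (hb' ⟨hr.1, hlt⟩) (not_lt.2 hr.2)
  have hne : Z.Nonempty := ⟨z, hz, hz'⟩
  have hbdd : BddBelow Z := ⟨b, hbZ⟩
  have hr1 : a < sInf Z := lt_of_lt_of_le hb (le_csInf hne hbZ)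
  have hpos := hstep _ hr1 fun s hs => by
    by_contra! hle
    exact absurd (csInf_le hbdd (⟨hs.1, hle⟩ : s ∈ Z)) (not_le.2 hs.2)
  have hev := (hφ.continuousAt (Ioi_mem_nhds hr1)).eventually (lt_mem_nhds hpos)
  obtain ⟨ε, hε, hball⟩ := Metric.eventually_nhds_iff.1 hev
  obtain ⟨w, hw, hw'⟩ := exists_lt_of_csInf_lt hne (lt_add_of_pos_right (sInf Z) hε)
  refine absurd (hball ?_) (not_lt.2 hw.2)
  rw [Real.dist_eq, abs_of_nonneg (sub_nonneg.2 (csInf_le hbdd hw))]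
  linarith

section Neutral

variable {rp L α C c D q₀ : ℝ} {y : ℝ → ℝ}

/-- Let `b = (3/2) L (r³ - rp³)`, `β = b/(rU)` and `E = r U φ' + b φ`. Then `E` vanishes at the
horizon and `E' = β E + (L(α + 9/2) r² - bβ) φ`. Since `bβ ≤ (9/4) L r²`, the last coefficient is at
least `L(α + 9/4) r² ≥ 0`: this is the Breitenlohner–Freedman bound. Hence `E ≥ 0`, so `φ' ≥ -βφ ≥
-(3/2) φ/r`. -/
lemma monotoneOn_neutral (hrp : 0 < rp) (hL : 0 < L) (hc : 0 < c) (hC : 0 ≤ C) (hD0 : 0 < D)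
    (hD : D < 3 / 2) (hα : α = (3 / 2 - D) ^ 2 - 3 * (3 / 2 - D))
    (h : IsRadialCoef rp L α C c (rnDer L α 0) (rnMass rp L α q₀ 0))
    (hy : IsRegularSol rp D (rnDer L α 0) (rnMass rp L α q₀ 0) 1 y) {r₁ : ℝ}
    (hpos : ∀ s ∈ Ioo rp r₁, 0 < radialSol D y s) :
    MonotoneOn (fun r => r ^ (3 / 2 : ℝ) * radialSol D y r) (Ioc rp r₁) := by
  set φ := radialSol D y with hφ
  set ψ := radialDer rp D (rnDer L α 0) (rnMass rp L α q₀ 0) y with hψ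
  set U := hprim rp (rnDer L α 0) with hU
  set X : ℝ → ℝ := fun s => s * U s * ψ s with hX
  set b : ℝ → ℝ := fun s => 3 / 2 * L * (s ^ 3 - rp ^ 3) with hb
  set E : ℝ → ℝ := fun s => X s + b s * φ s with hE
  set β : ℝ → ℝ := fun s => b s / (s * U s) with hβ
  have hφd : ∀ r ∈ Ioi rp, HasDerivAt φ (ψ r) r := fun r hr =>
    hy.hasDerivAt_radialSol hrp hc hC hD0 hD hα h hr
  have hXd : ∀ r ∈ Ioi rp, HasDerivAt X (rnMass rp L α q₀ 0 r * φ r) r := fun r hr =>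
    hy.hasDerivAt_equation hrp hc hC hD0 hD hα h hr
  have hUpos : ∀ r ∈ Ioi rp, 0 < U r := fun r hr => h.hprim_pos hrp hc hr
  have hb0 : ∀ r ∈ Ioi rp, 0 ≤ b r := fun r hr => by
    have : rp ^ 3 ≤ r ^ 3 := pow_le_pow_left₀ hrp.le (le_of_lt hr) 3
    have := sub_nonneg.2 this
    simp only [hb]; positivity
  have hβ0 : ∀ r ∈ Ioi rp, 0 ≤ β r := fun r hr =>
    div_nonneg (hb0 r hr) (mul_pos (hrp.trans hr) (hUpos r hr)).le
  have hUb : ∀ r ∈ Ioi rp, b r ≤ 3 / 2 * U r := fun r hr => by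
    have hr' : rp < r := hr
    simp only [hU, hb]
    rw [hprim_rnDer hrp hr]
    linarith
  have hβle : ∀ r ∈ Ioi rp, β r ≤ 3 / 2 * r⁻¹ := fun r hr => by
    have hr0 : 0 < r := hrp.trans hr
    have hUp := hUpos r hr
    rw [hβ, div_le_iff₀ (by positivity)]
    calc b r ≤ 3 / 2 * U r := hUb r hr
      _ = _ := by field_simp
  have hUc : ContinuousOn U (Ioi rp) := h.locBddG.primitive.cont
  have hβl : LocBdd rp β := by
    refine LocBdd.of_le ?_ ((LocBdd.const (3 / 2)).mul (locBdd_inv hrp)) fun s hs => by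
      rw [abs_of_nonneg (hβ0 s hs)]; exact hβle s hs
    exact ContinuousOn.div (by fun_prop) (continuousOn_id.mul hUc) fun r hr =>
      (mul_pos (hrp.trans hr) (hUpos r hr)).ne'
  have hEd : ∀ r ∈ Ioi rp, HasDerivAt E
      (β r * E r + (L * (α + 9 / 2) * r ^ 2 - b r * β r) * φ r) r := fun r hr => by
    have hr0 : 0 < r := hrp.trans hr
    have hUp := hUpos r hr
    have hbd : HasDerivAt b (9 / 2 * L * r ^ 2) r :=
      (((hasDerivAt_pow 3 r).sub_const (rp ^ 3)).const_mul (3 / 2 * L)).congr_deriv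
        (by norm_num; ring)
    refine ((hXd r hr).add (hbd.mul (hφd r hr))).congr_deriv ?_
    rw [rnMass_eq hrp hr]
    simp only [hE, hX, hβ]
    field_simp
    ring
  have hcoef : ∀ r ∈ Ioi rp, 0 ≤ L * (α + 9 / 2) * r ^ 2 - b r * β r := fun r hr => by
    have hr0 : 0 < r := hrp.trans hr
    have h1 : b r * β r ≤ b r * (3 / 2 * r⁻¹) := mul_le_mul_of_nonneg_left (hβle r hr) (hb0 r hr)
    have h2 : b r ≤ 3 / 2 * L * r ^ 3 := by
      have := pow_pos hrp 3
      simp only [hb]; nlinarith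
    have h3 : b r * (3 / 2 * r⁻¹) ≤ 3 / 2 * L * r ^ 3 * (3 / 2 * r⁻¹) :=
      mul_le_mul_of_nonneg_right h2 (by positivity)
    have h4 : 3 / 2 * L * r ^ 3 * (3 / 2 * r⁻¹) = 9 / 4 * L * r ^ 2 := by field_simp; ring
    have h5 : 0 ≤ L * (α + 9 / 4) * r ^ 2 := by
      have : α + 9 / 4 = D ^ 2 := by rw [hα]; ring
      rw [this]; positivity
    nlinarith
  have hφl : LocBdd rp φ := hy.locBdd_radialSol hrp
  have hE0 : Tendsto E (𝓝[>] rp) (𝓝 0) := by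
    have t1 : Tendsto (fun s => U s * (s * ψ s)) (𝓝[>] rp) (𝓝 0) :=
      ((LocBdd.of_continuousOn continuousOn_id).mul
        (hy.locBdd_radialDer hrp hc hC hD0 hD hα h)).tendsto_mul_zero h.locBddG.tendsto_primitive
    have t2 : Tendsto b (𝓝[>] rp) (𝓝 0) := by
      have : Continuous b := by fun_prop
      have := (this.tendsto rp).mono_left (nhdsWithin_le_nhds (s := Ioi rp))
      simpa [hb] using this
    have t3 := t1.add (hφl.tendsto_mul_zero t2)
    rw [add_zero] at t3
    refine t3.congr fun s => ?_
    simp only [hE, hX]; ring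
  -- The integrating factor that removes the term `β E`.
  set I : ℝ → ℝ := fun r => Real.exp (-∫ s in rp..r, β s) with hI
  have hId : ∀ r ∈ Ioi rp, HasDerivAt I (-(β r) * I r) r := fun r hr => by
    refine (hβl.hasDerivAt hr).neg.exp.congr_deriv ?_
    simp only [hI, Pi.neg_apply]; ring
  have hEI : ∀ r ∈ Ioi rp, HasDerivAt (fun s => E s * I s)
      ((L * (α + 9 / 2) * r ^ 2 - b r * β r) * φ r * I r) r := fun r hr =>
    ((hEd r hr).mul (hId r hr)).congr_deriv (by ring)
  have hIpos : ∀ r, 0 < I r := fun r => Real.exp_pos _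
  have hsub : Ioo rp r₁ ⊆ Ioi rp := fun s hs => hs.1
  have hmono : MonotoneOn (fun s => E s * I s) (Ioo rp r₁) := by
    refine monotoneOn_of_deriv_nonneg (convex_Ioo _ _)
      (fun s hs => (hEI s (hsub hs)).continuousAt.continuousWithinAt) ?_ ?_ <;> rw [interior_Ioo]
    · exact fun s hs => (hEI s (hsub hs)).differentiableAt.differentiableWithinAt
    · intro s hs
      rw [(hEI s (hsub hs)).deriv]
      exact mul_nonneg (mul_nonneg (hcoef s (hsub hs)) (hpos s hs).le) (hIpos s).le
  have hEnn : ∀ s ∈ Ioo rp r₁, 0 ≤ E s := fun s hs => by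
    have t : Tendsto (fun s => E s * I s) (𝓝[>] rp) (𝓝 0) := by
      have := hE0.mul ((Real.continuous_exp.tendsto _).comp hβl.tendsto_primitive.neg)
      rw [zero_mul] at this
      exact this
    have h1 : 0 ≤ E s * I s := by
      refine le_of_tendsto t ?_
      filter_upwards [Ioo_mem_nhdsGT hs.1] with x hx
      exact hmono ⟨hx.1, hx.2.trans hs.2⟩ hs hx.2.le
    exact nonneg_of_mul_nonneg_left h1 (hIpos s)
  have hd : ∀ r ∈ Ioi rp, HasDerivAt (fun r => r ^ (3 / 2 : ℝ) * φ r)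
      (r ^ (3 / 2 : ℝ) * (ψ r + 3 / 2 * r⁻¹ * φ r)) r := fun r hr => by
    have hr0 : 0 < r := hrp.trans hr
    refine ((Real.hasDerivAt_rpow_const (p := 3 / 2) (Or.inl hr0.ne')).mul
      (hφd r hr)).congr_deriv ?_
    rw [Real.rpow_sub_one hr0.ne']
    field_simp
    ring
  have hsub' : Ioc rp r₁ ⊆ Ioi rp := fun s hs => hs.1
  refine monotoneOn_of_deriv_nonneg (convex_Ioc _ _)
      (fun s hs => (hd s (hsub' hs)).continuousAt.continuousWithinAt) ?_ ?_ <;> rw [interior_Ioc]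
  · exact fun s hs => (hd s (hsub hs)).differentiableAt.differentiableWithinAt
  · intro s hs
    have hs' := hsub hs
    have hs0 : 0 < s := hrp.trans hs'
    have hUp := hUpos s hs'
    rw [(hd s hs').deriv]
    refine mul_nonneg (Real.rpow_nonneg hs0.le _) ?_
    have h1 : ψ s + β s * φ s = E s / (s * U s) := by
      simp only [hE, hX, hβ]; field_simp
    have h2 : 0 ≤ E s / (s * U s) := div_nonneg (hEnn s hs) (by positivity)
    have h3 : β s * φ s ≤ 3 / 2 * s⁻¹ * φ s :=
      mul_le_mul_of_nonneg_right (hβle s hs') (hpos s hs).le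
    linarith

/-- On the neutral black hole the regular solution is positive and not Dirichlet. -/
theorem neutral_pos_and_not_dirichlet (hrp : 0 < rp) (hL : 0 < L) (hc : 0 < c) (hC : 0 ≤ C)
    (hD0 : 0 < D) (hD : D < 3 / 2) (hα : α = (3 / 2 - D) ^ 2 - 3 * (3 / 2 - D))
    (h : IsRadialCoef rp L α C c (rnDer L α 0) (rnMass rp L α q₀ 0))
    (hy : IsRegularSol rp D (rnDer L α 0) (rnMass rp L α q₀ 0) 1 y) :
    (∀ r ∈ Ioi rp, 0 < y r) ∧ ¬Tendsto y atTop (𝓝 0) := by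
  have hiff : ∀ r ∈ Ioi rp, (0 < radialSol D y r ↔ 0 < y r) := fun r hr =>
    mul_pos_iff_of_pos_left (Real.rpow_pos_of_pos (hrp.trans hr) _)
  have hw : ∀ r ∈ Ioi rp, r ^ (3 / 2 : ℝ) * radialSol D y r = r ^ D * y r := fun r hr => by
    rw [radialSol, ← mul_assoc, ← Real.rpow_add (hrp.trans hr)]
    congr 2; ring
  have hpos : ∀ r ∈ Ioi rp, 0 < y r := by
    refine pos_of_forall_Ioo hy.cont
      ((hy.tendsto_horizon hrp hc hC hD0 hD hα h).eventually (lt_mem_nhds one_pos)) ?_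
    intro r hr hs
    have hr' : rp < r := hr
    have hm := monotoneOn_neutral hrp hL hc hC hD0 hD hα h hy (r₁ := r)
      fun s hs' => (hiff s hs'.1).2 (hs s hs')
    have hmid : (rp + r) / 2 ∈ Ioo rp r := ⟨by linarith, by linarith⟩
    have := hm (Ioo_subset_Ioc_self hmid) (right_mem_Ioc.2 hr) hmid.2.le
    simp only [hw _ hmid.1, hw r hr] at this
    have h1 := mul_pos (Real.rpow_pos_of_pos (hrp.trans hmid.1) D) (hs _ hmid)
    exact pos_of_mul_pos_right (h1.trans_le this) (Real.rpow_nonneg (hrp.trans hr).le _)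
  refine ⟨hpos, fun h0 => ?_⟩
  obtain ⟨K, hK, hdec⟩ := hy.decay_of_dirichlet hrp hc hC hD0 hD hα h h0
  have h2 : rp < 2 * rp := by linarith
  -- The monotone quantity equals `r^D y`, while a Dirichlet solution has `y = O(r^{-2D})`; a
  -- positive nondecreasing function cannot be `O(r^{-D})`.
  have hlow : ∀ r, 2 * rp ≤ r → (2 * rp) ^ D * y (2 * rp) ≤ K * r ^ (-D) := fun r hr => by
    have hr' : rp < r := h2.trans_le hr
    have hr0 := hrp.trans hr'
    have hm := monotoneOn_neutral hrp hL hc hC hD0 hD hα h hy (r₁ := r)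
      fun s hs' => (hiff s hs'.1).2 (hpos s hs'.1)
    have := hm ⟨h2, hr⟩ (right_mem_Ioc.2 hr') hr
    simp only [hw _ h2, hw r hr'] at this
    refine this.trans ?_
    have h3 := mul_le_mul_of_nonneg_left ((le_abs_self _).trans (hdec r hr))
      (Real.rpow_nonneg hr0.le D)
    refine h3.trans_eq ?_
    rw [mul_left_comm, ← Real.rpow_add hr0]
    congr 2; ring
  have ht : Tendsto (fun r : ℝ => K * r ^ (-D)) atTop (𝓝 (K * 0)) :=
    (tendsto_rpow_neg_atTop hD0).const_mul K
  rw [mul_zero] at ht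
  have := ge_of_tendsto ht (by filter_upwards [Ici_mem_atTop (2 * rp)] with r hr using hlow r hr)
  exact absurd this (not_le.2 (mul_pos (Real.rpow_pos_of_pos (by linarith) D) (hpos _ h2)))

/-- If positivity of the regular solution is lost by the charge `E₀`, some smaller charge admits a
Dirichlet solution. -/
theorem exists_dirichlet_charge (hrp : 0 < rp) (hL : 0 < L) (hc : 0 < c) (hC : 0 ≤ C)
    (hD0 : 0 < D) (hD : D < 3 / 2) (hα : α = (3 / 2 - D) ^ 2 - 3 * (3 / 2 - D)) {E₀ K : ℝ}
    (hE₀ : 0 ≤ E₀)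
    (h : ∀ e ∈ Icc 0 E₀, IsRadialCoef rp L α C c (rnDer L α e) (rnMass rp L α q₀ e)) (hK : 0 ≤ K)
    (hclose : ∀ e ∈ Icc 0 E₀, ∀ e' ∈ Icc 0 E₀, CoefClose rp (K * |e - e'|) (rnDer L α e)
        (rnMass rp L α q₀ e) (rnDer L α e') (rnMass rp L α q₀ e'))
    (hneg : ∀ y, IsRegularSol rp D (rnDer L α E₀) (rnMass rp L α q₀ E₀) 1 y →
      ¬∀ r ∈ Ioi rp, 0 < y r) :
    ∃ e ∈ Ioc 0 E₀, ∃ y, IsRegularSol rp D (rnDer L α e) (rnMass rp L α q₀ e) 1 y ∧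
      Tendsto y atTop (𝓝 0) := by
  by_contra! hno
  have hex : ∀ e, ∃ y, e ∈ Icc 0 E₀ → IsRegularSol rp D (rnDer L α e) (rnMass rp L α q₀ e) 1 y :=
    fun e => by
      by_cases he : e ∈ Icc 0 E₀
      · obtain ⟨y, hy⟩ := (h e he).exists_regularSol hrp hc hC hD0 hD hα
        exact ⟨y, fun _ => hy⟩
      · exact ⟨0, fun h' => absurd h' he⟩
  choose Y hY using hex
  obtain ⟨M, hM, hlip⟩ := exists_regularSol_lipschitz (L := L) hrp hc hC hD0 hD hα
  have hYlip : ∀ e ∈ Icc 0 E₀, ∀ e' ∈ Icc 0 E₀, ∀ r ∈ Ioi rp,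
      |Y e r - Y e' r| ≤ M * (K * |e - e'|) := fun e he e' he' r hr =>
    (hlip _ _ (h e he) _ _ (h e' he') _ (by positivity) (hclose e he e' he') _ (hY e he) _
      (hY e' he') r hr).1
  have hnd : ∀ e ∈ Icc 0 E₀, ¬Tendsto (Y e) atTop (𝓝 0) := fun e he => by
    rcases he.1.eq_or_lt with h0 | h0
    · subst h0
      exact (neutral_pos_and_not_dirichlet hrp hL hc hC hD0 hD hα (h 0 he) (hY 0 he)).2
    · exact hno e ⟨h0, he.2⟩ _ (hY e he)
  set S : Set ℝ := {e | ∀ r ∈ Ioi rp, 0 < Y e r} with hS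
  have hcont : ∀ r ∈ Ioi rp, ContinuousOn (fun e => Y e r) (Icc 0 E₀) := fun r hr => by
    have : LipschitzOnWith (Real.toNNReal (M * K)) (fun e => Y e r) (Icc 0 E₀) :=
      LipschitzOnWith.of_dist_le_mul fun e he e' he' => by
        rw [Real.dist_eq, Real.dist_eq, Real.coe_toNNReal _ (by positivity), mul_assoc]
        exact hYlip e he e' he' r hr
    exact this.continuousOn
  -- Positivity can be replaced by nonnegativity, a closed condition at each radius.
  have hSeq : S ∩ Icc 0 E₀ = ⋂ r ∈ Ioi rp, {e | e ∈ Icc 0 E₀ ∧ Y e r ∈ Ici (0 : ℝ)} := by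
    ext e
    simp only [mem_inter_iff, mem_iInter, mem_ofPred_eq]
    refine ⟨fun he r hr => ⟨he.2, (he.1 r hr).le⟩, fun he => ?_⟩
    have he' := (he (rp + 1) (lt_add_one rp)).1
    exact ⟨(hY e he').pos_of_nonneg hrp hc hC hD0 hD hα (h e he') fun r hr => (he r hr).2, he'⟩
  have hclosed : IsClosed (S ∩ Icc 0 E₀) := by
    rw [hSeq]
    exact isClosed_biInter fun r hr => (hcont r hr).preimage_isClosed_of_isClosed isClosed_Icc
      isClosed_Ici
  have h0mem : (0 : ℝ) ∈ Icc 0 E₀ := ⟨le_rfl, hE₀⟩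
  have h0S : (0 : ℝ) ∈ S :=
    (neutral_pos_and_not_dirichlet hrp hL hc hC hD0 hD hα (h 0 h0mem) (hY 0 h0mem)).1
  -- Openness to the right: without a Dirichlet charge a positive solution is bounded below by some
  -- `m > 0` on the whole exterior, and solutions vary uniformly in the charge.
  have hall := hclosed.Icc_subset_of_forall_mem_nhdsWithin h0S (fun e he => by
    have heI : e ∈ Icc 0 E₀ := Ico_subset_Icc_self he.2
    obtain ⟨m, hm, hlow⟩ := (hY e heI).exists_lower_bound hrp hc hC hD0 hD hα (h e heI) he.1
      (hnd e heI)
    have hT : Tendsto (fun e' => M * (K * |e' - e|)) (𝓝[>] e) (𝓝 0) := by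
      have : Continuous fun e' : ℝ => M * (K * |e' - e|) := by fun_prop
      have := (this.tendsto e).mono_left (nhdsWithin_le_nhds (s := Ioi e))
      simpa using this
    filter_upwards [hT.eventually (gt_mem_nhds hm), Ioo_mem_nhdsGT he.2.2] with e' he' heI' r hr
    have h1 := hYlip e' ⟨heI.1.trans heI'.1.le, heI'.2.le⟩ e heI r hr
    have h2 := (abs_le.1 h1).1
    have h3 := hlow r hr
    linarith)
  have hE₀mem : E₀ ∈ Icc 0 E₀ := ⟨hE₀, le_rfl⟩
  exact hneg _ (hY E₀ hE₀mem) (hall hE₀mem)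

end Neutral

/-! ### Dictionary between masses, charges and the radial equation. -/

section Del

variable {α : ℝ}

lemma Del_pos (h : -(9 / 4) < α) : 0 < Del α := Real.sqrt_pos.2 (by linarith)

lemma Del_lt (h : α < 0) : Del α < 3 / 2 := by
  rw [Del, Real.sqrt_lt' (by norm_num)]; linarith

/-- The indicial equation at infinity with exponent `3/2 - Δ`, in the form required by the reduced
equation. -/
lemma eq_of_Del (h : -(9 / 4) < α) : α = (3 / 2 - Del α) ^ 2 - 3 * (3 / 2 - Del α) := by
  have := Real.sq_sqrt (show 0 ≤ 9 / 4 + α by linarith)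
  rw [Del]; linear_combination -this

end Del

section RadialSolLimits

variable {rp L α C c D a : ℝ} {G q y : ℝ → ℝ}

lemma rpow_mul_radialSol {r : ℝ} (hr : 0 < r) : r ^ (3 / 2 - D) * radialSol D y r = y r := by
  rw [radialSol, ← mul_assoc, ← Real.rpow_add hr]; norm_num

lemma IsRegularSol.exists_radialSol_bound (hrp : 0 < rp) (hD : D < 3 / 2)
    (hy : IsRegularSol rp D G q a y) : ∃ B, ∀ r ∈ Ioi rp, |radialSol D y r| ≤ B := by
  obtain ⟨B, hB⟩ := hy.bdd
  refine ⟨rp ^ (D - 3 / 2) * B, fun r hr => ?_⟩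
  have hr0 : 0 < r := hrp.trans hr
  rw [radialSol, abs_mul, abs_of_pos (Real.rpow_pos_of_pos hr0 _)]
  exact mul_le_mul (Real.rpow_le_rpow_of_nonpos hrp (le_of_lt hr) (by linarith)) (hB r hr)
    (abs_nonneg _) (Real.rpow_nonneg hrp.le _)

lemma IsRegularSol.tendsto_radialSol_horizon (hrp : 0 < rp) (hc : 0 < c) (hC : 0 ≤ C) (hD0 : 0 < D)
    (hD : D < 3 / 2) (hα : α = (3 / 2 - D) ^ 2 - 3 * (3 / 2 - D))
    (h : IsRadialCoef rp L α C c G q) (hy : IsRegularSol rp D G q a y) :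
    Tendsto (radialSol D y) (𝓝[>] rp) (𝓝 (rp ^ (D - 3 / 2) * a)) :=
  (((Real.continuousAt_rpow_const rp (D - 3 / 2) (Or.inl hrp.ne')).tendsto).mono_left
    nhdsWithin_le_nhds).mul (hy.tendsto_horizon hrp hc hC hD0 hD hα h)

end RadialSolLimits

section Parameters

variable {rp Λ α q₀ M e : ℝ}

/-- The mass of the Reissner–Nordström-AdS black hole of horizon radius `rp` and charge `e`. -/
def massRN (rp Λ e : ℝ) : ℝ := massNeutral rp Λ + e ^ 2 / (2 * rp)

lemma chargeRN_sq (hrp : 0 < rp) (hM : massNeutral rp Λ ≤ M) :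
    chargeRN rp Λ M ^ 2 = 2 * rp * (M - massNeutral rp Λ) := by
  have h1 : 2 * M * rp - rp ^ 2 - adsConst Λ * rp ^ 4 = 2 * rp * (M - massNeutral rp Λ) := by
    rw [massNeutral]; ring
  have h2 : 0 ≤ M - massNeutral rp Λ := sub_nonneg.2 hM
  rw [chargeRN, h1, Real.sq_sqrt (by positivity)]

lemma chargeRN_massRN (hrp : 0 < rp) (he : 0 ≤ e) : chargeRN rp Λ (massRN rp Λ e) = e := by
  have h1 : 2 * massRN rp Λ e * rp - rp ^ 2 - adsConst Λ * rp ^ 4 = e ^ 2 := by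
    rw [massRN, massNeutral]; field_simp; ring
  rw [chargeRN, h1, Real.sqrt_sq he]

lemma massRN_chargeRN (hrp : 0 < rp) (hM : massNeutral rp Λ ≤ M) :
    massRN rp Λ (chargeRN rp Λ M) = M := by
  rw [massRN, chargeRN_sq hrp hM]
  field_simp
  ring

lemma massNeutral_le_massRN (hrp : 0 < rp) : massNeutral rp Λ ≤ massRN rp Λ e := by
  rw [massRN]; have : 0 ≤ e ^ 2 / (2 * rp) := by positivity
  linarith

lemma chargeRN_pos (hrp : 0 < rp) (hM : massNeutral rp Λ < M) : 0 < chargeRN rp Λ M := by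
  have h1 := chargeRN_sq hrp hM.le
  have h2 : 0 < M - massNeutral rp Λ := sub_pos.2 hM
  have h3 : 0 ≤ chargeRN rp Λ M := Real.sqrt_nonneg _
  refine h3.lt_of_ne' fun h0 => ?_
  rw [h0] at h1
  have : 0 < 2 * rp * (M - massNeutral rp Λ) := by positivity
  linarith

/-- The right side is `(rΩ²)'` at the horizon, which links surface gravity to the lower bounds on
`rnDer`. -/
lemma two_mul_surfaceGravity (hrp : 0 < rp) (hM : massNeutral rp Λ ≤ M) :
    2 * surfaceGravity rp Λ M * rp =
      1 - chargeRN rp Λ M ^ 2 / rp ^ 2 + 3 * adsConst Λ * rp ^ 2 := by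
  rw [surfaceGravity, chargeRN_sq hrp hM, massNeutral]
  field_simp
  ring

/-- Subextremality in terms of the charge. -/
lemma lt_massExtremal_iff (hrp : 0 < rp) (hM : massNeutral rp Λ ≤ M) :
    M < massExtremal rp Λ ↔
      0 < 1 - chargeRN rp Λ M ^ 2 / rp ^ 2 + 3 * adsConst Λ * rp ^ 2 := by
  have h : 1 - chargeRN rp Λ M ^ 2 / rp ^ 2 + 3 * adsConst Λ * rp ^ 2 =
      2 / rp * (massExtremal rp Λ - M) := by
    rw [chargeRN_sq hrp hM, massNeutral, massExtremal]
    field_simp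
    ring
  rw [h, mul_pos_iff_of_pos_left (by positivity), sub_pos]

lemma mul_OmegaRN (hrp : 0 < rp) (hM : massNeutral rp Λ ≤ M) {r : ℝ} (hr : rp < r) :
    r * OmegaRN rp Λ M r = hprim rp (rnDer (adsConst Λ) α (chargeRN rp Λ M)) r := by
  have hr0 := hrp.trans hr
  rw [hprim_rnDer hrp hr, OmegaRN, chargeRN_sq hrp hM, massNeutral]
  field_simp
  ring

lemma rnMass_eq_OmegaRN (hrp : 0 < rp) (hM : massNeutral rp Λ ≤ M) {r : ℝ} (hr : rp < r) :
    rnMass rp (adsConst Λ) α q₀ (chargeRN rp Λ M) r =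
      (adsConst Λ * α - q₀ ^ 2 * potentialRN rp Λ M r ^ 2 / OmegaRN rp Λ M r) * r ^ 2 := by
  have hr0 := hrp.trans hr
  rw [rnMass_eq hrp hr, ← mul_OmegaRN hrp hM hr, potentialRN]
  rw [show r ^ 3 = r ^ 2 * r by ring, ← div_div]
  field_simp

variable {C c : ℝ}

/-- Regular Dirichlet solutions give linear hair. -/
lemma isLinearHairMass_of_regularSol (hrp : 0 < rp) (hα : -(9 / 4) < α) (hα0 : α < 0) (hc : 0 < c)
    (hC : 0 ≤ C) (hM : massNeutral rp Λ ≤ M)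
    (h : IsRadialCoef rp (adsConst Λ) α C c (rnDer (adsConst Λ) α (chargeRN rp Λ M))
      (rnMass rp (adsConst Λ) α q₀ (chargeRN rp Λ M))) {y : ℝ → ℝ}
    (hy : IsRegularSol rp (Del α) (rnDer (adsConst Λ) α (chargeRN rp Λ M))
      (rnMass rp (adsConst Λ) α q₀ (chargeRN rp Λ M)) 1 y) (h0 : Tendsto y atTop (𝓝 0)) :
    IsLinearHairMass rp Λ α q₀ M := by
  have hD0 := Del_pos hα
  have hD := Del_lt hα0
  have hαD := eq_of_Del hα
  have hφ : ∀ r ∈ Ioi rp, deriv (radialSol (Del α) y) r = _ := fun r hr =>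
    (hy.hasDerivAt_radialSol hrp hc hC hD0 hD hαD h hr).deriv
  refine ⟨radialSol (Del α) y, hy.contDiffOn_radialSol hrp hc hC hD0 hD hαD h, fun r hr => ?_,
    hy.exists_radialSol_bound hrp hD, ⟨_, hy.tendsto_radialSol_horizon hrp hc hC hD0 hD hαD h⟩,
    ?_, ?_⟩
  · have d := hy.hasDerivAt_equation hrp hc hC hD0 hD hαD h hr
    rw [rnMass_eq_OmegaRN hrp hM hr] at d
    refine d.congr_of_eventuallyEq ?_
    filter_upwards [Ioi_mem_nhds hr] with s hs
    rw [hφ s hs, ← mul_OmegaRN hrp hM hs]; ring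
  · refine h0.congr' ?_
    filter_upwards [Ioi_mem_atTop 0] with r hr using (rpow_mul_radialSol hr).symm
  · obtain ⟨r, hr, hr'⟩ := (((hy.tendsto_horizon hrp hc hC hD0 hD hαD h).eventually
      (lt_mem_nhds one_pos)).and self_mem_nhdsWithin).exists
    exact ⟨r, hr', (mul_pos (Real.rpow_pos_of_pos (hrp.trans hr') _) hr).ne'⟩

/-- Linear hair is a multiple of a regular Dirichlet solution. -/
lemma exists_regularSol_of_isLinearHairMass (hrp : 0 < rp) (hα : -(9 / 4) < α) (hα0 : α < 0)
    (hc : 0 < c) (hC : 0 ≤ C) (hM : massNeutral rp Λ ≤ M)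
    (h : IsRadialCoef rp (adsConst Λ) α C c (rnDer (adsConst Λ) α (chargeRN rp Λ M))
      (rnMass rp (adsConst Λ) α q₀ (chargeRN rp Λ M))) (hM' : IsLinearHairMass rp Λ α q₀ M) :
    ∃ y, IsRegularSol rp (Del α) (rnDer (adsConst Λ) α (chargeRN rp Λ M))
      (rnMass rp (adsConst Λ) α q₀ (chargeRN rp Λ M)) 1 y ∧ Tendsto y atTop (𝓝 0) := by
  obtain ⟨φ, hφ⟩ := hM'
  obtain ⟨a, ha⟩ := hφ.horizon
  refine exists_regularSol_of_solution hrp hc hC (Del_pos hα) (Del_lt hα0) (eq_of_Del hα) h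
    (φ := φ) (φ' := deriv φ) (fun r hr => ?_) (fun r hr => ?_) hφ.bounded ha hφ.dirichlet hφ.nonzero
  · exact ((hφ.contDiff.differentiableOn (by norm_num)).differentiableAt
      (Ioi_mem_nhds hr)).hasDerivAt
  · have d := hφ.equation r hr
    rw [← rnMass_eq_OmegaRN hrp hM hr] at d
    refine d.congr_of_eventuallyEq ?_
    filter_upwards [Ioi_mem_nhds hr] with s hs
    rw [← mul_OmegaRN hrp hM hs]; ring

end Parameters

/-! ### Reconstruction of the background and of the hair. -/

lemma surfaceGravity_pos {rp Λ M : ℝ} (hrp : 0 < rp) (hM : massNeutral rp Λ ≤ M)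
    (hM' : M < massExtremal rp Λ) : 0 < surfaceGravity rp Λ M := by
  have h1 := (lt_massExtremal_iff hrp hM).1 hM'
  rw [← two_mul_surfaceGravity hrp hM, mul_pos_iff_of_pos_right hrp] at h1
  linarith

lemma kappaInvHorizon_pos {rp Λ α ε M : ℝ} (hrp : 0 < rp) (hL : 0 < adsConst Λ) (hα : α < 0)
    (hK : 0 < surfaceGravity rp Λ M) : 0 < kappaInvHorizon rp Λ α ε M := by
  have h1 : 0 ≤ adsConst Λ * -α * rp / (2 * surfaceGravity rp Λ M) * ε ^ 2 := by
    have : 0 < -α := neg_pos.2 hα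
    positivity
  rw [kappaInvHorizon]
  have h2 : adsConst Λ * α * rp / (2 * surfaceGravity rp Λ M) * ε ^ 2 =
    -(adsConst Λ * -α * rp / (2 * surfaceGravity rp Λ M) * ε ^ 2) := by ring
  linarith

/-- The charge function of the background with horizon mass `M`. -/
abbrev bgCharge (rp Λ q₀ M : ℝ) (b w : ℝ → ℝ) : ℝ → ℝ := charge rp q₀ (chargeRN rp Λ M) b w

/-- The potential of the background with horizon mass `M`, in the gauge `κ(∞) = 1`. -/
abbrev bgPot (rp Λ q₀ M : ℝ) (h b w : ℝ → ℝ) : ℝ → ℝ :=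
  gaugePot rp (lapse q₀ h b w) (bgCharge rp Λ q₀ M b w)

/-- `(r Ω² / κ)'` for the background with horizon mass `M`, in the gauge `κ(∞) = 1`. -/
abbrev bgDer (rp Λ α q₀ M : ℝ) (h b w : ℝ → ℝ) : ℝ → ℝ :=
  metricDer (adsConst Λ) α (lapse q₀ h b w) (bgCharge rp Λ q₀ M b w) b

/-- The zeroth order Klein–Gordon coefficient of the background with horizon mass `M`. -/
abbrev bgMass (rp Λ α q₀ M : ℝ) (h b w : ℝ → ℝ) : ℝ → ℝ :=
  massCoef rp (adsConst Λ) α q₀ (lapse q₀ h b w) (bgCharge rp Λ q₀ M b w) w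

/-- A background with horizon mass `M`, in the gauge `κ(∞) = 1`, together with its bounds. -/
structure IsNormalizedBg (rp Λ α q₀ M B C c E ν : ℝ) (f h b w : ℝ → ℝ) : Prop where
  rp_pos : 0 < rp
  adsConst_pos : 0 < adsConst Λ
  lower_pos : 0 < c
  mass_ge : massNeutral rp Λ ≤ M
  mass_lt : M < massExtremal rp Λ
  source : IsSource rp ν h b
  h_eq : ∀ r ∈ Ioi rp, h r = r * deriv f r ^ 2
  b_eq : ∀ r ∈ Ioi rp, b r = f r ^ 2
  ratio : IsBgRatio rp (adsConst Λ) α q₀ B (chargeRN rp Λ M) h b w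
  profile : IsProfile rp (adsConst Λ) α c E (lapse q₀ h b w) (bgCharge rp Λ q₀ M b w) b
  coef : IsRadialCoef rp (adsConst Λ) α C c (bgDer rp Λ α q₀ M h b w) (bgMass rp Λ α q₀ M h b w)

/-- The factor relating the gauge `κ(∞) = 1` to the prescribed horizon value of `κ`. -/
def gaugeFactor (rp Λ α q₀ ε M : ℝ) (h b w : ℝ → ℝ) : ℝ :=
  (kappaInvHorizon rp Λ α ε M)⁻¹ / lapse q₀ h b w rp

namespace IsNormalizedBg

variable {rp Λ α q₀ M B C c E ν ε : ℝ} {f h b w : ℝ → ℝ}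

lemma lapse_hasDerivAt (H : IsNormalizedBg rp Λ α q₀ M B C c E ν f h b w) {r : ℝ} (hr : rp < r) :
    HasDerivAt (lapse q₀ h b w) (lapse q₀ h b w r * lapseRate q₀ h b w r) r :=
  H.source.hasDerivAt_lapse H.rp_pos H.ratio.cont H.ratio.le hr

lemma charge_hasDerivAt (H : IsNormalizedBg rp Λ α q₀ M B C c E ν f h b w) {r : ℝ} (hr : rp < r) :
    HasDerivAt (bgCharge rp Λ q₀ M b w) (q₀ ^ 2 * (b r * w r)) r :=
  (((H.source.locBdd_bw H.rp_pos H.ratio.cont H.ratio.le).hasDerivAt hr).const_mul _).const_add _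

lemma pot_hasDerivAt (H : IsNormalizedBg rp Λ α q₀ M B C c E ν f h b w) {r : ℝ} (hr : rp < r) :
    HasDerivAt (bgPot rp Λ q₀ M h b w)
      (lapse q₀ h b w r * bgCharge rp Λ q₀ M b w r / r ^ 2) r :=
  (H.profile.locBdd_potInt H.rp_pos).hasDerivAt hr

lemma metric_hasDerivAt (H : IsNormalizedBg rp Λ α q₀ M B C c E ν f h b w) {r : ℝ} (hr : rp < r) :
    HasDerivAt (hprim rp (bgDer rp Λ α q₀ M h b w)) (bgDer rp Λ α q₀ M h b w r) r :=
  H.coef.hasDerivAt_hprim hr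

lemma metric_pos (H : IsNormalizedBg rp Λ α q₀ M B C c E ν f h b w) {r : ℝ} (hr : rp < r) :
    0 < hprim rp (bgDer rp Λ α q₀ M h b w) r := H.coef.hprim_pos H.rp_pos H.lower_pos hr

lemma pot_eq (H : IsNormalizedBg rp Λ α q₀ M B C c E ν f h b w) {r : ℝ} (hr : rp < r) :
    bgPot rp Λ q₀ M h b w r = w r * hprim rp (bgDer rp Λ α q₀ M h b w) r / r ^ 3 := by
  have h1 := H.ratio.eq r hr
  have hU := H.metric_pos hr
  have hr0 := H.rp_pos.trans hr
  rw [← h1, gaugeRatio]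
  field_simp

lemma lapse_horizon_pos : 0 < lapse q₀ h b w rp := Real.exp_pos _

lemma tendsto_lapse (H : IsNormalizedBg rp Λ α q₀ M B C c E ν f h b w) :
    Tendsto (lapse q₀ h b w) (𝓝[>] rp) (𝓝 (lapse q₀ h b w rp)) :=
  H.source.tendsto_lapse_horizon H.rp_pos H.ratio.cont H.ratio.le

lemma tendsto_charge (H : IsNormalizedBg rp Λ α q₀ M B C c E ν f h b w) :
    Tendsto (bgCharge rp Λ q₀ M b w) (𝓝[>] rp) (𝓝 (chargeRN rp Λ M)) := by
  have := (((H.source.locBdd_bw H.rp_pos H.ratio.cont H.ratio.le).tendsto_primitive).const_mul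
    (q₀ ^ 2)).const_add (chargeRN rp Λ M)
  rwa [mul_zero, add_zero] at this

lemma tendsto_pot (H : IsNormalizedBg rp Λ α q₀ M B C c E ν f h b w) :
    Tendsto (bgPot rp Λ q₀ M h b w) (𝓝[>] rp) (𝓝 0) :=
  (H.profile.locBdd_potInt H.rp_pos).tendsto_primitive

lemma tendsto_metric (H : IsNormalizedBg rp Λ α q₀ M B C c E ν f h b w) :
    Tendsto (hprim rp (bgDer rp Λ α q₀ M h b w)) (𝓝[>] rp) (𝓝 0) :=
  H.coef.locBddG.tendsto_primitive

lemma gravity_pos (H : IsNormalizedBg rp Λ α q₀ M B C c E ν f h b w) :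
    0 < surfaceGravity rp Λ M := surfaceGravity_pos H.rp_pos H.mass_ge H.mass_lt

lemma tendsto_id_horizon : Tendsto (fun r : ℝ => r) (𝓝[>] rp) (𝓝 rp) :=
  tendsto_id.mono_left nhdsWithin_le_nhds

/-- If `f → ε`, the last term of `metricDer` contributes `-ℓ α rp² ε²`; factoring out `2 K₊ rp`
leaves precisely the prescribed value of `κ⁻¹` at the horizon. -/
lemma tendsto_der (H : IsNormalizedBg rp Λ α q₀ M B C c E ν f h b w)
    (hf : Tendsto f (𝓝[>] rp) (𝓝 ε)) :
    Tendsto (bgDer rp Λ α q₀ M h b w) (𝓝[>] rp) (𝓝 (lapse q₀ h b w rp *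
      (2 * surfaceGravity rp Λ M * rp * kappaInvHorizon rp Λ α ε M))) := by
  have hb : Tendsto b (𝓝[>] rp) (𝓝 (ε ^ 2)) := by
    refine (hf.pow 2).congr' ?_
    filter_upwards [self_mem_nhdsWithin] with r hr using (H.b_eq r hr).symm
  have hK := H.gravity_pos
  have hrp := H.rp_pos
  have hi := tendsto_id_horizon (rp := rp)
  have t := H.tendsto_lapse.mul (((((H.tendsto_charge.pow 2).div (hi.pow 2)
    (pow_pos hrp 2).ne').const_sub 1).add ((hi.pow 2).const_mul (3 * adsConst Λ))).sub
    (((hi.pow 2).const_mul (adsConst Λ * α)).mul hb))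
  rw [← two_mul_surfaceGravity hrp H.mass_ge] at t
  refine t.mono_right (le_of_eq (congrArg 𝓝 ?_))
  rw [kappaInvHorizon]
  field_simp

lemma kappaInv_pos (H : IsNormalizedBg rp Λ α q₀ M B C c E ν f h b w) (hα : α < 0) :
    0 < kappaInvHorizon rp Λ α ε M :=
  kappaInvHorizon_pos H.rp_pos H.adsConst_pos hα H.gravity_pos

lemma gaugeFactor_pos (H : IsNormalizedBg rp Λ α q₀ M B C c E ν f h b w) (hα : α < 0) :
    0 < gaugeFactor rp Λ α q₀ ε M h b w :=
  div_pos (inv_pos.2 (H.kappaInv_pos hα)) (Real.exp_pos _)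

/-- L'Hôpital for the quotient of the potential by `U`, both of which vanish at the horizon with
explicit derivatives. -/
lemma tendsto_ratio (H : IsNormalizedBg rp Λ α q₀ M B C c E ν f h b w) (hα : α < 0)
    (hf : Tendsto f (𝓝[>] rp) (𝓝 ε)) :
    Tendsto w (𝓝[>] rp) (𝓝 (chargeRN rp Λ M /
      (2 * surfaceGravity rp Λ M * kappaInvHorizon rp Λ α ε M))) := by
  have hK := H.gravity_pos
  have hk := H.kappaInv_pos (ε := ε) hα
  have hκ := lapse_horizon_pos (rp := rp) (q₀ := q₀) (h := h) (b := b) (w := w)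
  have hrp := H.rp_pos
  have hi := tendsto_id_horizon (rp := rp)
  have t1 := HasDerivAt.lhopital_zero_nhdsGT
    (eventually_of_mem self_mem_nhdsWithin fun r hr => H.pot_hasDerivAt hr)
    (eventually_of_mem self_mem_nhdsWithin fun r hr => H.metric_hasDerivAt hr)
    (eventually_of_mem self_mem_nhdsWithin fun r hr =>
      ((mul_pos H.lower_pos (pow_pos (hrp.trans hr) 2)).trans_le (H.coef.lower r hr)).ne')
    H.tendsto_pot H.tendsto_metric
    (((H.tendsto_lapse.mul H.tendsto_charge).div (hi.pow 2) (pow_pos hrp 2).ne').div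
      (H.tendsto_der hf) (by positivity))
  have t2 := (hi.pow 3).mul t1
  have t3 : Tendsto w (𝓝[>] rp) _ := t2.congr' (by
    filter_upwards [self_mem_nhdsWithin] with r hr
    rw [← H.ratio.eq r hr, gaugeRatio, mul_div_assoc])
  convert t3 using 2
  field_simp

lemma kappa_tendsto (H : IsNormalizedBg rp Λ α q₀ M B C c E ν f h b w) :
    Tendsto (fun r => gaugeFactor rp Λ α q₀ ε M h b w * lapse q₀ h b w r) (𝓝[>] rp)
      (𝓝 (kappaInvHorizon rp Λ α ε M)⁻¹) := by
  have hκ := lapse_horizon_pos (rp := rp) (q₀ := q₀) (h := h) (b := b) (w := w)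
  have := H.tendsto_lapse.const_mul (gaugeFactor rp Λ α q₀ ε M h b w)
  rwa [gaugeFactor, div_mul_cancel₀ _ hκ.ne'] at this

/-- The normalized background, rescaled to the prescribed horizon value of `κ`. -/
theorem isBackground (H : IsNormalizedBg rp Λ α q₀ M B C c E ν f h b w) (hα : α < 0) :
    IsBackground rp Λ α q₀ ε M f
      (fun r => gaugeFactor rp Λ α q₀ ε M h b w * lapse q₀ h b w r)
      (fun r => gaugeFactor rp Λ α q₀ ε M h b w ^ 2 *
        (lapse q₀ h b w r * hprim rp (bgDer rp Λ α q₀ M h b w) r / r))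
      (fun r => r / 2 * (1 + bgCharge rp Λ q₀ M b w r ^ 2 / r ^ 2 + adsConst Λ * r ^ 2 -
        hprim rp (bgDer rp Λ α q₀ M h b w) r / (r * lapse q₀ h b w r)))
      (bgCharge rp Λ q₀ M b w)
      (fun r => gaugeFactor rp Λ α q₀ ε M h b w * bgPot rp Λ q₀ M h b w r) := by
  have hrp := H.rp_pos
  have hi := tendsto_id_horizon (rp := rp)
  have hγ := H.gaugeFactor_pos (ε := ε) hα
  have hk := H.kappaInv_pos (ε := ε) hα
  have hK := H.gravity_pos
  have hκ0 := lapse_horizon_pos (rp := rp) (q₀ := q₀) (h := h) (b := b) (w := w)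
  have hκt := H.kappa_tendsto (ε := ε)
  have hγdef : gaugeFactor rp Λ α q₀ ε M h b w * lapse q₀ h b w rp =
      (kappaInvHorizon rp Λ α ε M)⁻¹ := div_mul_cancel₀ _ hκ0.ne'
  have hκ : ∀ r, 0 < lapse q₀ h b w r := fun r => Real.exp_pos _
  have hΩd : ∀ r ∈ Ioi rp, HasDerivAt (fun r => gaugeFactor rp Λ α q₀ ε M h b w ^ 2 *
        (lapse q₀ h b w r * hprim rp (bgDer rp Λ α q₀ M h b w) r / r)) _ r := fun r hr =>
    ((((H.lapse_hasDerivAt hr).mul (H.metric_hasDerivAt hr)).div (hasDerivAt_id r)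
      (hrp.trans hr).ne').const_mul _)
  -- Under the constant rescaling `κ` and `A` have weight one, `Ω²` weight two, and `ϖ`, `Q` weight
  -- zero, so all equations are preserved. The constraint holds because `ϖ` was defined by solving
  -- it; the equation for `ϖ'` then follows from the others.
  refine ⟨fun r hr => mul_pos hγ (hκ r), fun r hr => ?_, fun r hr => ?_, fun r hr => ?_,
    fun r hr => ?_, fun r hr => ?_, fun r hr => ?_, ?_, H.tendsto_charge, ?_, ?_, ?_, fun hf => ?_,
    fun hf => ?_⟩
  · have := H.metric_pos hr
    have := hκ r
    have hr0 : 0 < r := hrp.trans hr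
    positivity
  · have hr0 : 0 < r := hrp.trans hr
    have hU := H.metric_pos hr
    have hκr := hκ r
    refine ((H.lapse_hasDerivAt hr).const_mul _).congr_deriv ?_
    rw [H.pot_eq hr, lapseRate, H.h_eq r hr, H.b_eq r hr]
    field_simp
  · have hr0 : 0 < r := hrp.trans hr
    have hU := H.metric_pos hr
    have hκr := hκ r
    field_simp
    ring
  · have hr0 : 0 < r := hrp.trans hr
    have hU := H.metric_pos hr
    have hκr := hκ r
    have d := ((hasDerivAt_id r).div_const 2).mul ((((((H.charge_hasDerivAt hr).pow 2).div
      ((hasDerivAt_id r).pow 2) (pow_pos hr0 2).ne').const_add 1).add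
      (((hasDerivAt_id r).pow 2).const_mul (adsConst Λ))).sub
      ((H.metric_hasDerivAt hr).div ((hasDerivAt_id r).mul (H.lapse_hasDerivAt hr))
        (mul_pos hr0 hκr).ne'))
    refine d.congr_deriv ?_
    rw [H.pot_eq hr, lapseRate, H.h_eq r hr, H.b_eq r hr]
    simp only [Pi.pow_apply, Pi.add_apply, Pi.sub_apply, Pi.mul_apply, Pi.div_apply, id]
    have hG : bgDer rp Λ α q₀ M h b w r = lapse q₀ h b w r *
      (1 - bgCharge rp Λ q₀ M b w r ^ 2 / r ^ 2
      + 3 * adsConst Λ * r ^ 2 - adsConst Λ * α * r ^ 2 * f r ^ 2) := by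
      rw [bgDer, metricDer, H.b_eq r hr]
    rw [hG]
    field_simp
    ring
  · have hr0 : 0 < r := hrp.trans hr
    have hU := H.metric_pos hr
    have hκr := hκ r
    refine (H.charge_hasDerivAt hr).congr_deriv ?_
    rw [H.pot_eq hr, H.b_eq r hr]
    field_simp
  · refine ((H.pot_hasDerivAt hr).const_mul _).congr_deriv ?_
    ring
  · have t := (hi.div_const 2).mul (((((H.tendsto_charge.pow 2).div (hi.pow 2)
      (pow_pos hrp 2).ne').const_add 1).add ((hi.pow 2).const_mul (adsConst Λ))).sub
      (H.tendsto_metric.div (hi.mul H.tendsto_lapse) (mul_pos hrp hκ0).ne'))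
    refine t.mono_right (le_of_eq (congrArg 𝓝 ?_))
    rw [chargeRN_sq hrp H.mass_ge, massNeutral]
    field_simp
    ring
  · have := hκt.inv₀ (inv_pos.2 hk).ne'
    rwa [inv_inv] at this
  · have := ((H.tendsto_lapse.mul H.tendsto_metric).div hi hrp.ne').const_mul
      (gaugeFactor rp Λ α q₀ ε M h b w ^ 2)
    simpa using this
  · simpa using H.tendsto_pot.const_mul (gaugeFactor rp Λ α q₀ ε M h b w)
  · have t := (H.tendsto_ratio hα hf).div ((hi.pow 2).mul hκt)
      (mul_pos (pow_pos hrp 2) (inv_pos.2 hk)).ne'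
    have t2 := t.congr' (f₂ := fun r => gaugeFactor rp Λ α q₀ ε M h b w * bgPot rp Λ q₀ M h b w r /
      (gaugeFactor rp Λ α q₀ ε M h b w ^ 2 *
        (lapse q₀ h b w r * hprim rp (bgDer rp Λ α q₀ M h b w) r / r))) (by
      filter_upwards [self_mem_nhdsWithin] with r hr
      have hr0 : 0 < r := hrp.trans hr
      have hU := H.metric_pos hr
      have hκr := hκ r
      rw [H.pot_eq hr, Pi.div_apply]
      field_simp)
    convert t2 using 2
    field_simp
  · have hl := H.source.locBdd_lapseRate (q₀ := q₀) hrp H.ratio.cont H.ratio.le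
    have t0 := ((H.profile.locBddκ.mul hl).tendsto_mul_zero H.tendsto_metric)
    have t := ((((t0.add (H.tendsto_lapse.mul (H.tendsto_der hf))).mul hi).sub
      (H.tendsto_lapse.mul H.tendsto_metric)).div (hi.pow 2) (pow_pos hrp 2).ne').const_mul
      (gaugeFactor rp Λ α q₀ ε M h b w ^ 2)
    have t2 := t.congr' (f₂ := deriv fun r => gaugeFactor rp Λ α q₀ ε M h b w ^ 2 *
        (lapse q₀ h b w r * hprim rp (bgDer rp Λ α q₀ M h b w) r / r)) (by
      filter_upwards [self_mem_nhdsWithin] with r hr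
      rw [(hΩd r hr).deriv]
      simp only [Pi.mul_apply, Pi.div_apply, id, mul_one]
      ring)
    convert t2 using 2
    -- The two rescaling powers combine with two lapses, one from `Ω²` and one from `U'`, into
    -- `κ(rp)²`, and one factor cancels against the prescribed inverse.
    have e1 : gaugeFactor rp Λ α q₀ ε M h b w ^ 2 * lapse q₀ h b w rp ^ 2 =
      ((kappaInvHorizon rp Λ α ε M)⁻¹) ^ 2 := by rw [← mul_pow, hγdef]
    have e2 : (kappaInvHorizon rp Λ α ε M)⁻¹ =
      ((kappaInvHorizon rp Λ α ε M)⁻¹) ^ 2 * kappaInvHorizon rp Λ α ε M := by field_simp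
    rw [e2, ← e1]
    field_simp
    ring

/-- A regular Dirichlet solution, normalized at the horizon, is a perturbed hair. -/
theorem isPerturbedHair (H : IsNormalizedBg rp Λ α q₀ M B C c E ν f h b w) (hC : 0 ≤ C)
    (hα : -(9 / 4) < α) (hα0 : α < 0) {y : ℝ → ℝ}
    (hy : IsRegularSol rp (Del α) (bgDer rp Λ α q₀ M h b w) (bgMass rp Λ α q₀ M h b w) 1 y)
    (h0 : Tendsto y atTop (𝓝 0)) :
    IsPerturbedHair rp Λ α q₀ ε M f
      (fun r => gaugeFactor rp Λ α q₀ ε M h b w * lapse q₀ h b w r)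
      (fun r => gaugeFactor rp Λ α q₀ ε M h b w ^ 2 *
        (lapse q₀ h b w r * hprim rp (bgDer rp Λ α q₀ M h b w) r / r))
      (fun r => gaugeFactor rp Λ α q₀ ε M h b w * bgPot rp Λ q₀ M h b w r)
      (fun r => ε * rp ^ (3 / 2 - Del α) * radialSol (Del α) y r) := by
  have hD0 := Del_pos hα
  have hD := Del_lt hα0
  have hαD := eq_of_Del hα
  have hrp := H.rp_pos
  have hc := H.lower_pos
  have hi := tendsto_id_horizon (rp := rp)
  have hγ := H.gaugeFactor_pos (ε := ε) hα0
  have hk := H.kappaInv_pos (ε := ε) hα0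
  have hK := H.gravity_pos
  have hκ0 := lapse_horizon_pos (rp := rp) (q₀ := q₀) (h := h) (b := b) (w := w)
  have hκ : ∀ r, 0 < lapse q₀ h b w r := fun r => Real.exp_pos _
  have hφd : ∀ r ∈ Ioi rp, HasDerivAt (fun r => ε * rp ^ (3 / 2 - Del α) * radialSol (Del α) y r)
      (ε * rp ^ (3 / 2 - Del α) * radialDer rp (Del α) (bgDer rp Λ α q₀ M h b w)
        (bgMass rp Λ α q₀ M h b w) y r) r := fun r hr =>
    (hy.hasDerivAt_radialSol hrp hc hC hD0 hD hαD H.coef hr).const_mul _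
  -- The prefactor `ε rp^{3/2-Δ}` undoes the weight in `y` and normalises the horizon value.
  have hhor : Tendsto (fun r => ε * rp ^ (3 / 2 - Del α) * radialSol (Del α) y r) (𝓝[>] rp)
      (𝓝 ε) := by
    have := (hy.tendsto_radialSol_horizon hrp hc hC hD0 hD hαD H.coef).const_mul
      (ε * rp ^ (3 / 2 - Del α))
    rwa [mul_one, mul_assoc, ← Real.rpow_add hrp,
      show 3 / 2 - Del α + (Del α - 3 / 2) = 0 by ring, Real.rpow_zero, mul_one] at this
  refine ⟨contDiffOn_const.mul (hy.contDiffOn_radialSol hrp hc hC hD0 hD hαD H.coef),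
    fun r hr => ?_, ?_, ?_, hhor, fun hf => ?_⟩
  · have hr0 : 0 < r := hrp.trans hr
    have hU := H.metric_pos hr
    have hκr := hκ r
    have d := (hy.hasDerivAt_equation hrp hc hC hD0 hD hαD H.coef hr).const_mul
      (gaugeFactor rp Λ α q₀ ε M h b w * (ε * rp ^ (3 / 2 - Del α)))
    refine (d.congr_of_eventuallyEq ?_).congr_deriv ?_
    · filter_upwards [Ioi_mem_nhds hr] with s hs
      have hs0 : 0 < s := hrp.trans hs
      have hκs := hκ s
      rw [(hφd s hs).deriv]
      field_simp
    · rw [bgMass, massCoef, show gaugePot rp (lapse q₀ h b w) (bgCharge rp Λ q₀ M b w) r =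
        bgPot rp Λ q₀ M h b w r from rfl, H.pot_eq hr]
      field_simp
  · obtain ⟨N, hN⟩ := hy.exists_radialSol_bound hrp hD
    refine ⟨|ε * rp ^ (3 / 2 - Del α)| * N, fun r hr => ?_⟩
    rw [abs_mul]
    exact mul_le_mul_of_nonneg_left (hN r hr) (abs_nonneg _)
  · have := h0.const_mul (ε * rp ^ (3 / 2 - Del α))
    rw [mul_zero] at this
    refine this.congr' ?_
    filter_upwards [Ioi_mem_atTop 0] with r hr
    rw [mul_left_comm, rpow_mul_radialSol hr]
  · have hw : LocBdd rp w := locBdd_of_bdd H.ratio.cont H.ratio.le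
    have tq : Tendsto (bgMass rp Λ α q₀ M h b w) (𝓝[>] rp)
        (𝓝 (adsConst Λ * α * rp ^ 2 * lapse q₀ h b w rp)) := by
      have := (((hi.pow 2).const_mul (adsConst Λ * α)).mul H.tendsto_lapse).sub
        ((hw.tendsto_mul_zero H.tendsto_pot).const_mul (q₀ ^ 2))
      rwa [mul_zero, sub_zero] at this
    have tX : Tendsto (fun s => s * hprim rp (bgDer rp Λ α q₀ M h b w) s *
        (ε * rp ^ (3 / 2 - Del α) * radialDer rp (Del α) (bgDer rp Λ α q₀ M h b w)
        (bgMass rp Λ α q₀ M h b w) y s)) (𝓝[>] rp) (𝓝 0) := by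
      have := ((LocBdd.of_continuousOn continuousOn_id).mul
          ((LocBdd.const (ε * rp ^ (3 / 2 - Del α))).mul
        (hy.locBdd_radialDer hrp hc hC hD0 hD hαD H.coef))).tendsto_mul_zero H.tendsto_metric
      refine this.congr fun s => ?_
      simp only [id]; ring
    have hXd : ∀ r ∈ Ioi rp, HasDerivAt (fun s => s * hprim rp (bgDer rp Λ α q₀ M h b w) s *
        (ε * rp ^ (3 / 2 - Del α) * radialDer rp (Del α) (bgDer rp Λ α q₀ M h b w)
        (bgMass rp Λ α q₀ M h b w) y s))
        (bgMass rp Λ α q₀ M h b w r * (ε * rp ^ (3 / 2 - Del α) * radialSol (Del α) y r)) r :=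
      fun r hr => by
        have := (hy.hasDerivAt_equation hrp hc hC hD0 hD hαD H.coef hr).const_mul
          (ε * rp ^ (3 / 2 - Del α))
        refine (this.congr_deriv (by ring)).congr_of_eventuallyEq (Eventually.of_forall fun s => ?_)
        ring
    have hPpos : ∀ r ∈ Ioi rp, 0 < 1 * hprim rp (bgDer rp Λ α q₀ M h b w) r +
        r * bgDer rp Λ α q₀ M h b w r := fun r hr => by
      have hr0 : 0 < r := hrp.trans hr
      have h1 := H.metric_pos hr
      have h2 := (mul_pos hc (pow_pos hr0 2)).trans_le (H.coef.lower r hr)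
      have h3 : 0 < r * bgDer rp Λ α q₀ M h b w r := mul_pos hr0 h2
      linarith
    have tP := hi.mul H.tendsto_metric
    rw [mul_zero] at tP
    -- `φ'` is the quotient of the flux `r U φ'` by `r U`, both zero at the horizon; the
    -- Klein–Gordon equation gives the derivative of the numerator, and the term with `A w` drops
    -- out in the limit.
    have t1 := HasDerivAt.lhopital_zero_nhdsGT
      (eventually_of_mem self_mem_nhdsWithin hXd)
      (eventually_of_mem self_mem_nhdsWithin fun r hr =>
        (hasDerivAt_id r).mul (H.metric_hasDerivAt hr))
      (eventually_of_mem self_mem_nhdsWithin fun r hr => (hPpos r hr).ne') tX tP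
      ((tq.mul hhor).div ((H.tendsto_metric.const_mul 1).add (hi.mul (H.tendsto_der hf)))
        (by rw [mul_zero, zero_add]; positivity))
    have t2 := t1.congr' (f₂ := deriv fun r => ε * rp ^ (3 / 2 - Del α) * radialSol (Del α) y r) (by
      filter_upwards [self_mem_nhdsWithin] with r hr
      rw [(hφd r hr).deriv]
      have hr0 : 0 < r := hrp.trans hr
      have h1 := H.metric_pos hr
      simp only [Pi.mul_apply, id]
      rw [mul_div_cancel_left₀ _ (mul_pos hr0 h1).ne'])
    convert t2 using 2
    field_simp
    ring

end IsNormalizedBg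

/-! ### Persistence of the Dirichlet charge under small sources. -/

lemma abs_sqrt_sq_sub_le {e₀ e : ℝ} (h0 : 0 < e₀) (he : 0 ≤ e) :
    |e - e₀| ≤ |e ^ 2 - e₀ ^ 2| / e₀ := by
  rw [le_div_iff₀ h0, sq_sub_sq, abs_mul, mul_comm, abs_of_pos (by linarith : 0 < e + e₀)]
  gcongr
  linarith

/-- A Dirichlet solution at charge `e₀` persists, at a nearby charge, under small sources. -/
theorem exists_dirichlet_perturbation {rp L α q₀ D e₀ E₀ : ℝ} (hrp : 0 < rp) (hL : 0 < L)
    (hD0 : 0 < D) (hD : D < 3 / 2) (hα : α = (3 / 2 - D) ^ 2 - 3 * (3 / 2 - D))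
    (he₀ : 0 < e₀) (heE : e₀ < E₀) {C c B K ν₀ : ℝ} (hc : 0 < c) (hC : 0 ≤ C) (hK : 0 < K)
    (hν₀ : 0 < ν₀)
    (hrn : ∀ e ∈ Icc 0 E₀, IsRadialCoef rp L α C c (rnDer L α e) (rnMass rp L α q₀ e))
    (hrn' : ∀ e ∈ Icc 0 E₀, ∀ e' ∈ Icc 0 E₀, CoefClose rp (K * |e - e'|) (rnDer L α e)
        (rnMass rp L α q₀ e) (rnDer L α e') (rnMass rp L α q₀ e'))
    (hbg : ∀ ν ≤ ν₀, ∀ h b, IsSource rp ν h b → ∃ W : ℝ → ℝ → ℝ, ∀ e ∈ Icc 0 E₀,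
        IsBgRatio rp L α q₀ B e h b (W e) ∧
        IsProfile rp L α c (E₀ + 1) (lapse q₀ h b (W e)) (charge rp q₀ e b (W e)) b ∧
        IsRadialCoef rp L α C c (metricDer L α (lapse q₀ h b (W e)) (charge rp q₀ e b (W e)) b)
          (massCoef rp L α q₀ (lapse q₀ h b (W e)) (charge rp q₀ e b (W e)) (W e)) ∧
        CoefClose rp (K * ν)
          (metricDer L α (lapse q₀ h b (W e)) (charge rp q₀ e b (W e)) b)
          (massCoef rp L α q₀ (lapse q₀ h b (W e)) (charge rp q₀ e b (W e)) (W e))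
          (rnDer L α e) (rnMass rp L α q₀ e) ∧
        ∀ e' ∈ Icc 0 E₀, CoefClose rp (K * |e - e'|)
          (metricDer L α (lapse q₀ h b (W e)) (charge rp q₀ e b (W e)) b)
          (massCoef rp L α q₀ (lapse q₀ h b (W e)) (charge rp q₀ e b (W e)) (W e))
          (metricDer L α (lapse q₀ h b (W e')) (charge rp q₀ e' b (W e')) b)
          (massCoef rp L α q₀ (lapse q₀ h b (W e')) (charge rp q₀ e' b (W e')) (W e')))
    {y₀ : ℝ → ℝ} (hy₀ : IsRegularSol rp D (rnDer L α e₀) (rnMass rp L α q₀ e₀) 1 y₀)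
    (hy₀' : Tendsto y₀ atTop (𝓝 0)) :
    ∃ ν₁ > 0, ∃ A > 0, ∀ ν ≤ ν₁, ∀ h b, IsSource rp ν h b → ∃ e ∈ Ioc 0 E₀,
      |e ^ 2 - e₀ ^ 2| ≤ A * ν ∧ ∃ w y, IsBgRatio rp L α q₀ B e h b w ∧
        IsProfile rp L α c (E₀ + 1) (lapse q₀ h b w) (charge rp q₀ e b w) b ∧
        IsRadialCoef rp L α C c (metricDer L α (lapse q₀ h b w) (charge rp q₀ e b w) b)
          (massCoef rp L α q₀ (lapse q₀ h b w) (charge rp q₀ e b w) w) ∧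
        IsRegularSol rp D (metricDer L α (lapse q₀ h b w) (charge rp q₀ e b w) b)
          (massCoef rp L α q₀ (lapse q₀ h b w) (charge rp q₀ e b w) w) 1 y ∧
        Tendsto y atTop (𝓝 0) := by
  have he₀m : e₀ ∈ Icc 0 E₀ := ⟨he₀.le, heE.le⟩
  have hE₀ : 0 < E₀ := he₀.trans heE
  obtain ⟨v, k, hk, N, hN, htrans⟩ := exists_transversality hrp hc hC hD0 hD hα (hrn e₀ he₀m) hy₀
    hy₀' (K₀ := K + K / e₀) (by positivity)
  obtain ⟨P, hP, hlip⟩ := exists_regularSol_lipschitz (L := L) hrp hc hC hD0 hD hα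
  have hKe : 0 < K / e₀ := by positivity
  -- Transversality in the variable `t = e² - e₀²`. The summand `K/e₀` of the constant converts the
  -- Lipschitz bound in `e` into one in `e²`; the summand `K` measures the effect of the source.
  have hcross : ∀ ν, 0 ≤ ν → ∀ e ∈ Icc 0 E₀, |e ^ 2 - e₀ ^ 2| ≤ 1 → ∀ G q,
      IsRadialCoef rp L α C c G q → CoefClose rp (K * ν) G q (rnDer L α e) (rnMass rp L α q₀ e) →
      ∀ y, IsRegularSol rp D G q 1 y → ∀ F, Tendsto y atTop (𝓝 F) →
      (e ^ 2 - e₀ ^ 2) * (v * F) ≤ -k * (e ^ 2 - e₀ ^ 2) ^ 2 +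
        N * (|e ^ 2 - e₀ ^ 2| * ((e ^ 2 - e₀ ^ 2) ^ 2 + ν)) := by
    intro ν hν e he ht G q hGq hcl y hy F hF
    refine htrans (e ^ 2 - e₀ ^ 2) ν hν ht (rnDer L α e) (rnMass rp L α q₀ e) (hrn e he).locBddG
      (fun s _ => rnDer_sub L α e e₀ s) (fun s hs => ⟨?_, ?_⟩) G q hGq
      (hcl.mono (by nlinarith)) y hy F hF
    · exact rnMass_sub_nonpos hrp hL hs ((hrn e he).hprim_pos hrp hc hs)
        ((hrn e₀ he₀m).hprim_pos hrp hc hs)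
    · refine ((hrn' e he e₀ he₀m) s hs).2.trans ?_
      calc K * |e - e₀| ≤ K * (|e ^ 2 - e₀ ^ 2| / e₀) := by
            gcongr; exact abs_sqrt_sq_sub_le he₀ he.1
        _ = K / e₀ * |e ^ 2 - e₀ ^ 2| := by ring
        _ ≤ _ := by gcongr; linarith
  -- In turn: the range of validity of the crossing estimate, dominance of the quadratic term,
  -- positivity of the charge, and staying below `E₀`.
  set τ₀ := min (min 1 (k / (2 * N))) (min (e₀ ^ 2 / 2) (E₀ ^ 2 - e₀ ^ 2)) with hτ₀
  have hsq : e₀ ^ 2 < E₀ ^ 2 := by gcongr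
  have hτ₀pos : 0 < τ₀ := by
    have := sub_pos.2 hsq
    positivity
  have hτ1 : τ₀ ≤ 1 := (min_le_left _ _).trans (min_le_left _ _)
  have hτ2 : τ₀ ≤ k / (2 * N) := (min_le_left _ _).trans (min_le_right _ _)
  have hτ3 : τ₀ ≤ e₀ ^ 2 / 2 := (min_le_right _ _).trans (min_le_left _ _)
  have hτ4 : τ₀ ≤ E₀ ^ 2 - e₀ ^ 2 := (min_le_right _ _).trans (min_le_right _ _)
  have hmem : ∀ t, |t| ≤ τ₀ → √(e₀ ^ 2 + t) ∈ Ioc 0 E₀ ∧ √(e₀ ^ 2 + t) ^ 2 - e₀ ^ 2 = t := by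
    intro t ht
    have h1 := abs_le.1 ht
    have h2 : 0 < e₀ ^ 2 + t := by nlinarith [pow_pos he₀ 2]
    refine ⟨⟨Real.sqrt_pos.2 h2, ?_⟩, by rw [Real.sq_sqrt h2.le]; ring⟩
    rw [Real.sqrt_le_left hE₀.le]; linarith
  -- The crossing estimate itself excludes `v = 0`: with no source and small `t > 0` it would read
  -- `0 ≤ -k t² + N t³`.
  have hv : v ≠ 0 := by
    intro hv0
    set t := τ₀ / 2 with htdef
    have ht0 : 0 < t := by positivity
    have hta : |t| ≤ τ₀ := by rw [abs_of_pos ht0]; linarith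
    obtain ⟨he, het⟩ := hmem t hta
    have he' := Ioc_subset_Icc_self he
    obtain ⟨y, hy⟩ := (hrn _ he').exists_regularSol hrp hc hC hD0 hD hα
    obtain ⟨F, hF⟩ := hy.exists_limit hrp hc hC hD0 hD hα (hrn _ he')
    have hself : CoefClose rp (K * 0) (rnDer L α √(e₀ ^ 2 + t)) (rnMass rp L α q₀ √(e₀ ^ 2 + t))
        (rnDer L α √(e₀ ^ 2 + t)) (rnMass rp L α q₀ √(e₀ ^ 2 + t)) := fun s _ => by simp
    have := hcross 0 le_rfl _ he' (by rw [het]; exact hta.trans hτ1) _ _ (hrn _ he') hself y hy F hF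
    rw [het, hv0, abs_of_pos ht0] at this
    have h2 : N * t < k := by
      have : t < k / (2 * N) := by linarith
      rw [lt_div_iff₀ (by positivity)] at this
      nlinarith
    nlinarith [mul_pos ht0 ht0]
  -- At `|t| = 2Nν/k` the source error `N|t|ν` equals half of `k t²` and the cubic error is at most
  -- the other half, so `v F` has opposite weak signs at the two ends.
  refine ⟨min ν₀ (τ₀ / (2 * N / k)), by positivity, 2 * N / k, by positivity, fun ν hν h b hs => ?_⟩
  have hνn := hs.nonneg hrp
  obtain ⟨W, hW⟩ := hbg ν (hν.trans (min_le_left _ _)) h b hs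
  set G : ℝ → ℝ → ℝ := fun e => metricDer L α (lapse q₀ h b (W e)) (charge rp q₀ e b (W e)) b
      with hG
  set Q : ℝ → ℝ → ℝ := fun e =>
    massCoef rp L α q₀ (lapse q₀ h b (W e)) (charge rp q₀ e b (W e)) (W e) with hQ
  have hex : ∀ e, ∃ y F, e ∈ Icc 0 E₀ → IsRegularSol rp D (G e) (Q e) 1 y ∧ Tendsto y atTop (𝓝 F) :=
    fun e => by
      by_cases he : e ∈ Icc 0 E₀
      · obtain ⟨y, hy⟩ := (hW e he).2.2.1.exists_regularSol hrp hc hC hD0 hD hα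
        obtain ⟨F, hF⟩ := hy.exists_limit hrp hc hC hD0 hD hα (hW e he).2.2.1
        exact ⟨y, F, fun _ => ⟨hy, hF⟩⟩
      · exact ⟨0, 0, fun h' => absurd h' he⟩
  choose Y F hYF using hex
  have hFlip : ∀ {G' q' y' F' d e}, e ∈ Icc 0 E₀ → IsRadialCoef rp L α C c G' q' → 0 ≤ d →
      CoefClose rp d (G e) (Q e) G' q' → IsRegularSol rp D G' q' 1 y' → Tendsto y' atTop (𝓝 F') →
      |F e - F'| ≤ P * d := by
    intro G' q' y' F' d e he hGq hd hcl hy' hF'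
    refine le_of_tendsto ((hYF e he).2.sub hF').abs ?_
    filter_upwards [Ioi_mem_atTop rp] with r hr
    exact (hlip _ _ (hW e he).2.2.1 _ _ hGq d hd hcl _ (hYF e he).1 _ hy' r hr).1
  have hFc : ContinuousOn F (Icc 0 E₀) := by
    have : LipschitzOnWith (Real.toNNReal (P * K)) F (Icc 0 E₀) :=
      LipschitzOnWith.of_dist_le_mul fun e he e' he' => by
        rw [Real.dist_eq, Real.dist_eq, Real.coe_toNNReal _ (by positivity), mul_assoc]
        exact hFlip he (hW e' he').2.2.1 (by positivity) ((hW e he).2.2.2.2 e' he')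
          (hYF e' he').1 (hYF e' he').2
    exact this.continuousOn
  suffices hzero : ∃ e ∈ Ioc 0 E₀, |e ^ 2 - e₀ ^ 2| ≤ 2 * N / k * ν ∧ F e = 0 by
    obtain ⟨e, he, he1, he2⟩ := hzero
    have he' := Ioc_subset_Icc_self he
    obtain ⟨h1, h2, h3, -⟩ := hW e he'
    exact ⟨e, he, he1, W e, Y e, h1, h2, h3, (hYF e he').1, he2 ▸ (hYF e he').2⟩
  -- For zero source the interval degenerates, and the background coefficients coincide with the
  -- unperturbed ones.
  rcases hνn.eq_or_lt with h0 | hνpos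
  · refine ⟨e₀, ⟨he₀, heE.le⟩, by rw [sub_self, abs_zero]; positivity, ?_⟩
    have := hFlip he₀m (hrn e₀ he₀m) (by positivity) (hW e₀ he₀m).2.2.2.1 hy₀ hy₀'
    rw [← h0, mul_zero, mul_zero, sub_zero] at this
    exact abs_nonpos_iff.1 this
  set τ := 2 * N / k * ν with hτ
  have hτpos : 0 < τ := by positivity
  have hττ₀ : τ ≤ τ₀ := by
    have := hν.trans (min_le_right _ _)
    rw [le_div_iff₀ (by positivity)] at this
    linarith
  have hsign : ∀ t, |t| = τ → t * (v * F √(e₀ ^ 2 + t)) ≤ 0 := by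
    intro t ht
    have hta : |t| ≤ τ₀ := ht.trans_le hττ₀
    obtain ⟨he, het⟩ := hmem t hta
    have he' := Ioc_subset_Icc_self he
    have := hcross ν hνn _ he' (by rw [het]; exact hta.trans hτ1) _ _ (hW _ he').2.2.1
      (hW _ he').2.2.2.1 _ (hYF _ he').1 _ (hYF _ he').2
    rw [het, ht, ← sq_abs t, ht] at this
    refine this.trans ?_
    have h1 : N * ν = k * τ / 2 := by rw [hτ]; field_simp
    have h2 : N * τ ≤ k / 2 := by
      have := hττ₀.trans hτ2
      rw [le_div_iff₀ (by positivity)] at this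
      linarith
    have h3 : N * (τ * (τ ^ 2 + ν)) = τ ^ 2 * (N * τ) + τ * (N * ν) := by ring
    have h4 : τ ^ 2 * (N * τ) ≤ τ ^ 2 * (k / 2) := by gcongr
    rw [h3, h1]
    nlinarith
  obtain ⟨hm, hmt⟩ := hmem (-τ) (by rwa [abs_neg, abs_of_pos hτpos])
  obtain ⟨hp, hpt⟩ := hmem τ (by rwa [abs_of_pos hτpos])
  have hle : √(e₀ ^ 2 + -τ) ≤ √(e₀ ^ 2 + τ) := Real.sqrt_le_sqrt (by linarith)
  have hsub : Icc √(e₀ ^ 2 + -τ) √(e₀ ^ 2 + τ) ⊆ Icc 0 E₀ := fun x hx =>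
    ⟨hm.1.le.trans hx.1, hx.2.trans hp.2⟩
  have s1 := hsign τ (abs_of_pos hτpos)
  have s2 := hsign (-τ) (by rw [abs_neg, abs_of_pos hτpos])
  obtain ⟨e, he, heF⟩ := intermediate_value_Icc' hle
    ((continuousOn_const (c := v)).mul (hFc.mono hsub))
    (show (0 : ℝ) ∈ Icc (v * F √(e₀ ^ 2 + τ)) (v * F √(e₀ ^ 2 + -τ)) from
      ⟨nonpos_of_mul_nonpos_right s1 hτpos, by nlinarith⟩)
  refine ⟨e, ⟨hm.1.trans_le he.1, (hsub he).2⟩, ?_, (mul_eq_zero.1 heF).resolve_left hv⟩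
  have h1 := pow_le_pow_left₀ hm.1.le he.1 2
  have h2 := pow_le_pow_left₀ (hsub he).1 he.2 2
  rw [abs_le]
  constructor <;> linarith

/-! ### From scalar fields in `X` to statements about masses. -/

section Source

variable {rp Λ α Mref : ℝ} {f : ℝ → ℝ}

lemma supNorm_nonneg (rp : ℝ) (g : ℝ → ℝ) : 0 ≤ supNorm rp g :=
  Real.iSup_nonneg fun _ => abs_nonneg _

lemma sq_le_of_weight {p n s g d : ℝ} (hs : 0 < s) (h : |s ^ p * g| ≤ n) (hd : d = 2 * p) :
    g ^ 2 ≤ n ^ 2 * s ^ (-d) := by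
  have h1 : (s ^ p * g) ^ 2 ≤ n ^ 2 := by
    rw [← sq_abs]; exact pow_le_pow_left₀ (abs_nonneg _) h 2
  rw [Real.rpow_neg hs.le, ← div_eq_mul_inv, le_div_iff₀ (Real.rpow_pos_of_pos hs _)]
  have h2 : s ^ d = (s ^ p) ^ 2 := by rw [hd, pow_two, ← Real.rpow_add hs, two_mul]
  rw [h2]
  linarith [h1, mul_pow (s ^ p) g 2]

/-- Scalar fields in `X` are small sources. -/
lemma MemX.isSource (hrp : 0 < rp) (hα : -(9 / 4) < α) (hf : MemX rp Λ α Mref f) :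
    IsSource rp (normX rp Λ α Mref f ^ 2 * rp ^ (-(2 * Del α))) (fun s => s * deriv f s ^ 2)
      fun s => f s ^ 2 := by
  have hD := Del_pos hα
  set n := normX rp Λ α Mref f with hn
  have hw0 : ∀ s ∈ Ioi rp, |s ^ (3 / 2 + Del α) * f s| ≤ n := fun s hs => by
    have h1 : |weight0 α f s| ≤ supNorm rp (weight0 α f) := le_ciSup hf.bdd0 ⟨s, hs⟩
    refine h1.trans ?_
    rw [hn, normX]
    linarith [supNorm_nonneg rp (weight1 α f), supNorm_nonneg rp (weight2 rp Λ α Mref f)]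
  have hw1 : ∀ s ∈ Ioi rp, |s ^ (5 / 2 + Del α) * deriv f s| ≤ n := fun s hs => by
    have h1 : |weight1 α f s| ≤ supNorm rp (weight1 α f) := le_ciSup hf.bdd1 ⟨s, hs⟩
    refine h1.trans ?_
    rw [hn, normX]
    linarith [supNorm_nonneg rp (weight0 α f), supNorm_nonneg rp (weight2 rp Λ α Mref f)]
  have hw : ∀ s ∈ Ioi rp, s ^ (-(2 * Del α)) ≤ rp ^ (-(2 * Del α)) := fun s hs =>
    Real.rpow_le_rpow_of_nonpos hrp (le_of_lt hs) (by linarith)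
  refine ⟨continuousOn_id.mul ((hf.contDiff.continuousOn_deriv_of_isOpen isOpen_Ioi
    (by norm_num)).pow 2), hf.contDiff.continuousOn.pow 2,
    fun s hs => mul_nonneg (hrp.trans hs).le (sq_nonneg _), fun s hs => ?_,
    fun s _ => sq_nonneg _, fun s hs => ?_⟩
  · have hs0 : 0 < s := hrp.trans hs
    -- Squaring the weight gives `f'² ≤ n² s^{-5-2Δ}`; the factor `s` leaves `s^{-4}`, and `s^{-2Δ}`
    -- is bounded by its horizon value.
    have h1 := sq_le_of_weight hs0 (hw1 s hs) (d := 2 * Del α + (5 : ℕ)) (by push_cast; ring)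
    rw [neg_add, Real.rpow_add hs0, Real.rpow_neg hs0.le (5 : ℕ), Real.rpow_natCast] at h1
    calc s * deriv f s ^ 2 ≤ s * (n ^ 2 * (s ^ (-(2 * Del α)) * (s ^ 5)⁻¹)) := by gcongr
      _ = n ^ 2 * s ^ (-(2 * Del α)) / s ^ 4 := by field_simp
      _ ≤ _ := by gcongr n ^ 2 * ?_ / s ^ 4; exact hw s hs
  · have hs0 : 0 < s := hrp.trans hs
    have h1 := sq_le_of_weight hs0 (hw0 s hs) (d := 2 * Del α + (3 : ℕ)) (by push_cast; ring)
    rw [neg_add, Real.rpow_add hs0, Real.rpow_neg hs0.le (3 : ℕ), Real.rpow_natCast] at h1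
    calc f s ^ 2 ≤ n ^ 2 * (s ^ (-(2 * Del α)) * (s ^ 3)⁻¹) := h1
      _ = n ^ 2 * s ^ (-(2 * Del α)) / s ^ 3 := by ring
      _ ≤ _ := by gcongr n ^ 2 * ?_ / s ^ 3; exact hw s hs

end Source

/-- Near a linear hair mass there are hair masses for all small scalar fields. -/
theorem exists_perturbedHairMass {rp Λ α q₀ Ms Mc : ℝ} (hrp : 0 < rp) (hΛ : Λ < 0)
    (hα : -(9 / 4) < α) (hα0 : α < 0) (hMs : Ms ≤ massExtremal rp Λ)
    (hMc : Mc ∈ Ioo (massNeutral rp Λ) Ms) (hlin : IsLinearHairMass rp Λ α q₀ Mc) :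
    ∃ δ₀ > 0, ∃ C > 0, ∀ f, MemX rp Λ α Mc f → normX rp Λ α Mc f < δ₀ → ∀ ε,
      ∃ Mf ∈ Ioo (massNeutral rp Λ) Ms, IsPerturbedHairMass rp Λ α q₀ ε f Mf ∧
        |Mf - Mc| ≤ C * normX rp Λ α Mc f ^ 2 := by
  have hL : 0 < adsConst Λ := by rw [adsConst]; linarith
  have hD0 := Del_pos hα
  have hD := Del_lt hα0
  have hαD := eq_of_Del hα
  -- The largest charge considered belongs to the midpoint mass, so charges stay uniformly
  -- subextremal even when `Ms` is the extremal mass, and the hair mass stays strictly below `Ms`.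
  have hmid : Mc < (Mc + Ms) / 2 := by linarith [hMc.2]
  have hmid' : (Mc + Ms) / 2 < Ms := by linarith [hMc.2]
  have hmidn : massNeutral rp Λ ≤ (Mc + Ms) / 2 := (hMc.1.trans hmid).le
  set E₀ := chargeRN rp Λ ((Mc + Ms) / 2) with hE₀def
  set e₀ := chargeRN rp Λ Mc with he₀def
  have he₀ : 0 < e₀ := chargeRN_pos hrp hMc.1
  have hE₀ : 0 < E₀ := chargeRN_pos hrp (hMc.1.trans hmid)
  have hesq : e₀ ^ 2 = 2 * rp * (Mc - massNeutral rp Λ) := chargeRN_sq hrp hMc.1.le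
  have hEsq : E₀ ^ 2 = 2 * rp * ((Mc + Ms) / 2 - massNeutral rp Λ) := chargeRN_sq hrp hmidn
  have heE : e₀ < E₀ := by
    refine lt_of_pow_lt_pow_left₀ 2 hE₀.le ?_
    rw [hesq, hEsq]
    gcongr
  obtain ⟨c, hc, hlow⟩ := exists_rn_lower hrp hL
    ((lt_massExtremal_iff hrp hmidn).1 (hmid'.trans_le hMs))
  obtain ⟨B, -, C, hC, K, hK, ν₀, hν₀, hrn, hrn', hbg⟩ :=
    exists_background_family hrp hL hα0.le q₀ hE₀.le hc hlow
  obtain ⟨y₀, hy₀, hy₀'⟩ := exists_regularSol_of_isLinearHairMass hrp hα hα0 hc hC.le hMc.1.le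
    (hrn e₀ ⟨he₀.le, heE.le⟩) hlin
  obtain ⟨ν₁, hν₁, A, hA, H⟩ := exists_dirichlet_perturbation hrp hL hD0 hD hαD he₀ heE hc
    hC.le hK hν₀ hrn hrn' hbg hy₀ hy₀'
  have hρ : 0 < rp ^ (-(2 * Del α)) := Real.rpow_pos_of_pos hrp _
  -- The source has size `ν = ‖f‖² rp^{-2Δ}`, so this radius ensures `ν < ν₁`; the constant converts
  -- `A ν` through `M - Mc = (e² - e₀²)/(2 rp)`.
  refine ⟨√(ν₁ / rp ^ (-(2 * Del α))), Real.sqrt_pos.2 (by positivity),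
    A * rp ^ (-(2 * Del α)) / (2 * rp), by positivity, fun f hf hn ε => ?_⟩
  have hn0 : 0 ≤ normX rp Λ α Mc f := add_nonneg (add_nonneg (supNorm_nonneg _ _)
    (supNorm_nonneg _ _)) (supNorm_nonneg _ _)
  have hs := hf.isSource hrp hα
  rw [Real.lt_sqrt hn0, lt_div_iff₀ hρ] at hn
  obtain ⟨e, he, hee, w, y, hratio, hprof, hcoef, hy, hy0⟩ := H _ hn.le _ _ hs
  have hMe := massNeutral_le_massRN (Λ := Λ) (e := e) hrp
  have hch : chargeRN rp Λ (massRN rp Λ e) = e := chargeRN_massRN hrp he.1.le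
  have hlt : massRN rp Λ e < Ms := by
    have h1 : e ^ 2 ≤ E₀ ^ 2 := pow_le_pow_left₀ he.1.le he.2 2
    rw [hEsq] at h1
    have h2 : e ^ 2 / (2 * rp) ≤ (Mc + Ms) / 2 - massNeutral rp Λ := by
      rw [div_le_iff₀ (by positivity)]; linarith
    rw [massRN]; linarith
  refine ⟨massRN rp Λ e, ⟨?_, hlt⟩, ?_, ?_⟩
  · rw [massRN]
    have := he.1
    have : 0 < e ^ 2 / (2 * rp) := by positivity
    linarith
  · rw [← hch] at hratio hprof hcoef hy
    have Hbg : IsNormalizedBg rp Λ α q₀ (massRN rp Λ e) B C c (E₀ + 1) _ f _ _ w :=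
      ⟨hrp, hL, hc, hMe, hlt.trans_le hMs, hs, fun _ _ => rfl, fun _ _ => rfl, hratio, hprof, hcoef⟩
    exact ⟨_, _, _, _, _, Hbg.isBackground hα0, _, Hbg.isPerturbedHair hC.le hα hα0 hy hy0⟩
  · have h1 : massRN rp Λ e - Mc = (e ^ 2 - e₀ ^ 2) / (2 * rp) := by
      rw [massRN, hesq]; field_simp; ring
    rw [h1, abs_div, abs_of_pos (by positivity : 0 < 2 * rp)]
    calc |e ^ 2 - e₀ ^ 2| / (2 * rp) ≤
        A * (normX rp Λ α Mc f ^ 2 * rp ^ (-(2 * Del α))) / (2 * rp) := by gcongr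
      _ = _ := by ring

/-- If positivity of regular solutions fails at a subextremal mass, there is a smaller linear hair
mass. -/
theorem exists_linearHairMass {rp Λ α q₀ M : ℝ} (hrp : 0 < rp) (hΛ : Λ < 0) (hα : -(9 / 4) < α)
    (hα0 : α < 0) (hM : M ∈ Ioo (massNeutral rp Λ) (massExtremal rp Λ))
    (hneg : ∀ c C, 0 < c → 0 ≤ C →
      IsRadialCoef rp (adsConst Λ) α C c (rnDer (adsConst Λ) α (chargeRN rp Λ M))
        (rnMass rp (adsConst Λ) α q₀ (chargeRN rp Λ M)) →
      ∀ y, IsRegularSol rp (Del α) (rnDer (adsConst Λ) α (chargeRN rp Λ M))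
        (rnMass rp (adsConst Λ) α q₀ (chargeRN rp Λ M)) 1 y → ¬∀ r ∈ Ioi rp, 0 < y r) :
    ∃ Mc ∈ Ioc (massNeutral rp Λ) M, IsLinearHairMass rp Λ α q₀ Mc := by
  have hL : 0 < adsConst Λ := by rw [adsConst]; linarith
  have hE₀ := (chargeRN_pos hrp hM.1).le
  obtain ⟨c, hc, hlow⟩ := exists_rn_lower hrp hL ((lt_massExtremal_iff hrp hM.1.le).1 hM.2)
  obtain ⟨B, -, C, hC, K, hK, ν₀, -, hrn, hrn', -⟩ :=
    exists_background_family hrp hL hα0.le q₀ hE₀ hc hlow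
  obtain ⟨e, he, y, hy, hy0⟩ := exists_dirichlet_charge hrp hL hc hC.le (Del_pos hα) (Del_lt hα0)
    (eq_of_Del hα) hE₀ hrn hK.le hrn' (hneg c C hc hC.le (hrn _ ⟨hE₀, le_rfl⟩))
  have hch : chargeRN rp Λ (massRN rp Λ e) = e := chargeRN_massRN hrp he.1.le
  have he' := hrn e (Ioc_subset_Icc_self he)
  refine ⟨massRN rp Λ e, ⟨?_, ?_⟩, ?_⟩
  · rw [massRN]
    have := he.1
    have : 0 < e ^ 2 / (2 * rp) := by positivity
    linarith
  · rw [← massRN_chargeRN hrp hM.1.le, massRN, massRN]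
    have := pow_le_pow_left₀ he.1.le he.2 2
    gcongr
  · rw [← hch] at he' hy
    exact isLinearHairMass_of_regularSol hrp hα hα0 hc hC.le (massNeutral_le_massRN hrp) he' hy hy0

/-! ### Criteria for loss of positivity. -/

section Oscillation

variable {rp L α q₀ e C c D : ℝ}

/-- For a large charge of the scalar field, regular solutions change sign. -/
lemma not_pos_of_large_charge (hrp : 0 < rp) (hL : 0 < L) (hα0 : α < 0) (hc : 0 < c) (hC : 0 ≤ C)
    (hD0 : 0 < D) (hD : D < 3 / 2) (hα : α = (3 / 2 - D) ^ 2 - 3 * (3 / 2 - D)) (he : 0 < e)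
    (hq : 2 * (3 * rp + 27 * L * rp ^ 3) * Real.pi / (rp * e) < |q₀|)
    (h : IsRadialCoef rp L α C c (rnDer L α e) (rnMass rp L α q₀ e)) {y : ℝ → ℝ}
    (hy : IsRegularSol rp D (rnDer L α e) (rnMass rp L α q₀ e) 1 y) :
    ¬∀ r ∈ Ioi rp, 0 < y r := by
  set u := 3 * rp + 27 * L * rp ^ 3 with hu
  have hu0 : 0 < u := by positivity
  have hU : ∀ s ∈ Icc (2 * rp) (3 * rp), hprim rp (rnDer L α e) s ≤ u := fun s hs => by
    have h1 : rp < s := by linarith [hs.1]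
    have h2 : 1 / s ≤ 1 / rp := one_div_le_one_div_of_le hrp h1.le
    have h3 : 0 ≤ e ^ 2 * (1 / rp - 1 / s) := mul_nonneg (sq_nonneg e) (by linarith)
    have h4 : s ^ 3 ≤ (3 * rp) ^ 3 := pow_le_pow_left₀ (hrp.trans h1).le hs.2 3
    have h5 : L * s ^ 3 ≤ L * (3 * rp) ^ 3 := by gcongr
    rw [hprim_rnDer hrp h1]
    have h6 : 0 < L * rp ^ 3 := by positivity
    nlinarith [hs.2]
  -- On `[2rp, 3rp]` both `U` and the potential difference are controlled by explicit constants, so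
  -- `-q` is at least a fixed multiple of `q₀²`, while `s U` does not depend on `q₀`.
  refine hy.not_pos_of_sine hrp hc hC hD0 hD hα h (s₁ := 2 * rp) (s₂ := 3 * rp) (p := 3 * rp * u)
    (V := q₀ ^ 2 * (2 * rp * e ^ 2 / u)) (by linarith) (by linarith) (fun s hs => ?_)
    (fun s hs => ?_) ?_
  · have h1 : rp < s := by linarith [hs.1]
    exact mul_le_mul hs.2 (hU s hs) (h.hprim_pos hrp hc h1).le (by positivity)
  · have h1 : rp < s := by linarith [hs.1]
    have hs0 := hrp.trans h1
    have hUp := h.hprim_pos hrp hc h1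
    have h2 : 1 / (2 * rp) ≤ 1 / rp - 1 / s := by
      have : 1 / s ≤ 1 / (2 * rp) := one_div_le_one_div_of_le (by positivity) hs.1
      have h3 : 1 / rp = 2 * (1 / (2 * rp)) := by field_simp
      linarith
    rw [rnMass_eq hrp h1]
    have h4 : 2 * rp * e ^ 2 / u ≤
        s ^ 3 * (1 / rp - 1 / s) ^ 2 * (e ^ 2 / hprim rp (rnDer L α e) s) := by
      calc 2 * rp * e ^ 2 / u = (2 * rp) ^ 3 * (1 / (2 * rp)) ^ 2 * (e ^ 2 / u) := by field_simp
        _ ≤ _ := by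
          have := hs.1
          have := hU s hs
          gcongr
    have h5 := mul_le_mul_of_nonneg_left h4 (sq_nonneg q₀)
    have h6 : 0 ≤ L * -α * s ^ 2 := by
      have := neg_pos.2 hα0
      positivity
    linarith
  · have h1 : (2 * u * Real.pi / (rp * e)) ^ 2 < q₀ ^ 2 := by
      rw [← sq_abs q₀]
      exact pow_lt_pow_left₀ hq (by positivity) two_ne_zero
    have h2 : 3 * rp * u * (Real.pi / (3 * rp - 2 * rp)) ^ 2 ≤
        (2 * u * Real.pi / (rp * e)) ^ 2 * (2 * rp * e ^ 2 / u) := by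
      have e1 : 3 * rp - 2 * rp = rp := by ring
      have e2 : (2 * u * Real.pi / (rp * e)) ^ 2 * (2 * rp * e ^ 2 / u) =
          8 * (rp * u * (Real.pi / rp) ^ 2) := by field_simp; ring
      rw [e1, e2]
      have : 0 ≤ rp * u * (Real.pi / rp) ^ 2 := by positivity
      linarith
    refine h2.trans_lt ?_
    gcongr

/-- The leading coefficient `24 A` is negative and the constant term is `1`, so the other root is
`1/(24 A R₀) < 0`. Multiplication by `R₀` makes the factorisation explicit without division. -/
lemma quadR0_neg {Λ x R₀ : ℝ} (hα : α < -(3 / 2) + q₀ ^ 2 / (2 * adsConst Λ)) (hR₀ : 0 < R₀)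
    (hroot : quadR0 Λ α q₀ R₀ = 0) (hx : R₀ < x) : quadR0 Λ α q₀ x < 0 := by
  rw [quadR0] at hroot ⊢
  set A := α + 3 / 2 - q₀ ^ 2 / (2 * adsConst Λ) with hA
  set B := 4 * A - 2 * q₀ ^ 2 / adsConst Λ + 6
  have hA0 : A < 0 := by linarith
  have h1 : (24 * A * x ^ 2 + B * x + 1) * R₀ = (x - R₀) * (24 * A * R₀ * x - 1) := by
    linear_combination x * hroot
  have h2 : 24 * A * R₀ * x - 1 < 0 := by
    have : 0 < -A * R₀ * x := mul_pos (mul_pos (neg_pos.2 hA0) hR₀) (hR₀.trans hx)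
    linarith
  have h3 := mul_neg_of_pos_of_neg (sub_pos.2 hx) h2
  rw [← h1] at h3
  exact neg_of_mul_neg_left h3 hR₀.le

/-- The extremal charge satisfies `e² = rp² (1 + 3x)` with `x = ℓ rp²`, and there `s U ≈ (1 + 6x)(s
- rp)²`. The inequality says that the effective mass lies below the threshold `-1/4` of the Euler
operator; cleared of denominators, its defect is `-quadR0`. -/
lemma near_horizon_condition {Λ : ℝ} (hrp : 0 < rp) (hL : 0 < adsConst Λ)
    (h : quadR0 Λ α q₀ (adsConst Λ * rp ^ 2) < 0) :
    (1 + 6 * (adsConst Λ * rp ^ 2)) / 4 < -(adsConst Λ * α * rp ^ 2) +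
      q₀ ^ 2 * (rp ^ 2 * (1 + 3 * (adsConst Λ * rp ^ 2))) / (1 + 6 * (adsConst Λ * rp ^ 2)) := by
  set L := adsConst Λ with hLdef
  have ha : 0 < 1 + 6 * (L * rp ^ 2) := by positivity
  have h1 : (-(L * α * rp ^ 2) + q₀ ^ 2 * (rp ^ 2 * (1 + 3 * (L * rp ^ 2))) /
      (1 + 6 * (L * rp ^ 2)) -
      (1 + 6 * (L * rp ^ 2)) / 4) * (4 * (1 + 6 * (L * rp ^ 2))) = -quadR0 Λ α q₀ (L * rp ^ 2) := by
    rw [quadR0, ← hLdef]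
    field_simp
    ring
  have h2 : 0 < -(L * α * rp ^ 2) + q₀ ^ 2 * (rp ^ 2 * (1 + 3 * (L * rp ^ 2))) /
      (1 + 6 * (L * rp ^ 2)) - (1 + 6 * (L * rp ^ 2)) / 4 := by
    refine pos_of_mul_pos_left ?_ (by positivity : 0 ≤ 4 * (1 + 6 * (L * rp ^ 2)))
    rw [h1]; linarith
  linarith

/-- Expansion at the horizon: the linear term measures the distance to extremality and the quadratic
one becomes `(1 + 6 L rp²)(s - rp)²` in the limit. -/
lemma mul_hprim_rnDer (hrp : 0 < rp) {s : ℝ} (hs : rp < s) :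
    s * hprim rp (rnDer L α e) s = (s - rp) ^ 2 * (1 + L * (s ^ 2 + 2 * rp * s + 3 * rp ^ 2)) +
      (rp ^ 2 * (1 + 3 * (L * rp ^ 2)) - e ^ 2) / rp * (s - rp) := by
  have hs0 := hrp.trans hs
  rw [hprim_rnDer hrp hs]
  field_simp
  ring

/-- Near extremality regular solutions change sign if the near-horizon effective mass violates the
Breitenlohner–Freedman bound. -/
lemma exists_charge_not_pos (hrp : 0 < rp) (hL : 0 < L) (hα0 : α < 0)
    (hcond : (1 + 6 * (L * rp ^ 2)) / 4 < -(L * α * rp ^ 2) +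
      q₀ ^ 2 * (rp ^ 2 * (1 + 3 * (L * rp ^ 2))) / (1 + 6 * (L * rp ^ 2))) :
    ∃ e > 0, e ^ 2 < rp ^ 2 * (1 + 3 * (L * rp ^ 2)) ∧ ∀ C c D : ℝ, 0 < c → 0 ≤ C → 0 < D →
      D < 3 / 2 → α = (3 / 2 - D) ^ 2 - 3 * (3 / 2 - D) →
      IsRadialCoef rp L α C c (rnDer L α e) (rnMass rp L α q₀ e) →
      ∀ y, IsRegularSol rp D (rnDer L α e) (rnMass rp L α q₀ e) 1 y →
      ¬∀ r ∈ Ioi rp, 0 < y r := by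
  set a := 1 + 6 * (L * rp ^ 2) with ha
  set X := rp ^ 2 * (1 + 3 * (L * rp ^ 2)) with hX
  have ha0 : 0 < a := by positivity
  have hX0 : 0 < X := by positivity
  -- The strict inequality leaves room for one slack parameter `σ`, used at once for the frequency
  -- of the test function, the error in `s U` and the defect of the charge from extremality.
  obtain ⟨σ, hσ, hσX, hσcond⟩ : ∃ σ > 0, σ < X ∧ (a + 2 * σ) * (1 / 4 + σ ^ 2) <
      -(L * α * rp ^ 2) + q₀ ^ 2 * (X - σ) / (a + 2 * σ) := by
    have t1 : Tendsto (fun σ : ℝ => (a + 2 * σ) * (1 / 4 + σ ^ 2)) (𝓝[>] 0) (𝓝 (a / 4)) := by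
      have : Continuous fun σ : ℝ => (a + 2 * σ) * (1 / 4 + σ ^ 2) := by fun_prop
      have := (this.tendsto 0).mono_left (nhdsWithin_le_nhds (s := Ioi 0))
      refine this.mono_right (le_of_eq (congrArg 𝓝 ?_))
      ring
    have t2 : Tendsto (fun σ : ℝ => -(L * α * rp ^ 2) + q₀ ^ 2 * (X - σ) / (a + 2 * σ)) (𝓝[>] 0)
        (𝓝 (-(L * α * rp ^ 2) + q₀ ^ 2 * X / a)) := by
      have : ContinuousAt (fun σ : ℝ => -(L * α * rp ^ 2) + q₀ ^ 2 * (X - σ) / (a + 2 * σ)) 0 := by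
        refine continuousAt_const.add (ContinuousAt.div (by fun_prop) (by fun_prop) ?_)
        simpa using ha0.ne'
      have := this.tendsto.mono_left (nhdsWithin_le_nhds (s := Ioi 0))
      simpa using this
    obtain ⟨σ, h1, h2⟩ := ((t1.eventually_lt t2 hcond).and (Ioo_mem_nhdsGT hX0)).exists
    exact ⟨σ, h2.1, h2.2, h1⟩
  obtain ⟨ξ₁, hξ₁, hξσ⟩ : ∃ ξ₁ > 0, L * (4 * rp * ξ₁ + ξ₁ ^ 2) < σ := by
    have t : Tendsto (fun ξ : ℝ => L * (4 * rp * ξ + ξ ^ 2)) (𝓝[>] 0) (𝓝 0) := by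
      have : Continuous fun ξ : ℝ => L * (4 * rp * ξ + ξ ^ 2) := by fun_prop
      have := (this.tendsto 0).mono_left (nhdsWithin_le_nhds (s := Ioi 0))
      simpa using this
    obtain ⟨ξ, h1, h2⟩ := ((t.eventually (gt_mem_nhds hσ)).and self_mem_nhdsWithin).exists
    exact ⟨ξ, h2, h1⟩
  -- The window ends at `ξ₁`, small enough for the quadratic expansion, and starts at `ξ₀` so as to
  -- contain one half-period of frequency `σ`.
  set ξ₀ := ξ₁ / Real.exp (Real.pi / σ) with hξ₀
  have hξ₀0 : 0 < ξ₀ := div_pos hξ₁ (Real.exp_pos _)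
  have hξ₀₁ : ξ₀ * Real.exp (Real.pi / σ) = ξ₁ := div_mul_cancel₀ _ (Real.exp_pos _).ne'
  -- The defect `τ` from the extremal `e²` is chosen last. With `τ ≤ σ rp ξ₀` the linear term of `s
  -- U` is at most `σ (s - rp)²` on the window.
  set τ := min σ (σ * rp * ξ₀) with hτ
  have hτ0 : 0 < τ := by positivity
  have hτσ : τ ≤ σ := min_le_left _ _
  have hτξ : τ ≤ σ * rp * ξ₀ := min_le_right _ _
  have hXτ : 0 < X - τ := by linarith
  have hsq : √(X - τ) ^ 2 = X - τ := Real.sq_sqrt hXτ.le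
  refine ⟨√(X - τ), Real.sqrt_pos.2 hXτ, by rw [hsq]; linarith,
    fun C c D hc hC hD0 hD hα h y hy => ?_⟩
  have hP : ∀ s ∈ Icc (rp + ξ₀) (rp + ξ₀ * Real.exp (Real.pi / σ)),
      s * hprim rp (rnDer L α √(X - τ)) s ≤ (a + 2 * σ) * (s - rp) ^ 2 := fun s hs => by
    rw [hξ₀₁] at hs
    have hs1 : rp < s := by linarith [hs.1]
    have hξ : ξ₀ ≤ s - rp := by linarith [hs.1]
    have hξ' : s - rp ≤ ξ₁ := by linarith [hs.2]
    have hξpos : 0 < s - rp := hξ₀0.trans_le hξ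
    rw [mul_hprim_rnDer hrp hs1, hsq, ← hX]
    have h1 : 1 + L * (s ^ 2 + 2 * rp * s + 3 * rp ^ 2) ≤ a + σ := by
      have h2 : 4 * rp * (s - rp) + (s - rp) ^ 2 ≤ 4 * rp * ξ₁ + ξ₁ ^ 2 := by gcongr
      have h3 := mul_le_mul_of_nonneg_left h2 hL.le
      rw [ha]
      linarith
    have h4 : (X - (X - τ)) / rp * (s - rp) ≤ σ * (s - rp) ^ 2 := by
      rw [sub_sub_cancel]
      have h5 : τ / rp ≤ σ * (s - rp) := by
        rw [div_le_iff₀ hrp]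
        calc τ ≤ σ * rp * ξ₀ := hτξ
          _ ≤ σ * rp * (s - rp) := by gcongr
          _ = _ := by ring
      calc τ / rp * (s - rp) ≤ σ * (s - rp) * (s - rp) := by gcongr
        _ = _ := by ring
    have h6 := mul_le_mul_of_nonneg_left h1 (sq_nonneg (s - rp))
    linarith
  refine hy.not_pos_of_log_sine hrp hc hC hD0 hD hα h hσ hξ₀0 hP (fun s hs => ?_) hσcond
  have hPs := hP s hs
  have hs1 : rp < s := by linarith [hs.1]
  have hs0 := hrp.trans hs1
  have hU := h.hprim_pos hrp hc hs1
  have hξpos := sub_pos.2 hs1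
  rw [rnMass_eq hrp hs1, hsq]
  set U := hprim rp (rnDer L α √(X - τ)) s
  have h1 : (X - σ) / (a + 2 * σ) ≤ s ^ 3 * (1 / rp - 1 / s) ^ 2 * ((X - τ) / U) := by
    have e1 : s ^ 3 * (1 / rp - 1 / s) ^ 2 * ((X - τ) / U) =
        (s / rp) ^ 2 * ((X - τ) * ((s - rp) ^ 2 / (s * U))) := by
      field_simp
    have h2 : 1 ≤ (s / rp) ^ 2 := one_le_pow₀ ((one_le_div hrp).2 hs1.le)
    have h3 : 1 / (a + 2 * σ) ≤ (s - rp) ^ 2 / (s * U) := by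
      rw [div_le_div_iff₀ (by positivity) (by positivity)]
      linarith
    rw [e1]
    calc (X - σ) / (a + 2 * σ) = 1 * ((X - σ) * (1 / (a + 2 * σ))) := by ring
      _ ≤ _ := by
        have : 0 ≤ X - σ := by linarith
        gcongr
  have h2 := mul_le_mul_of_nonneg_left h1 (sq_nonneg q₀)
  have h3 : L * -α * rp ^ 2 ≤ L * -α * s ^ 2 := by
    have := neg_pos.2 hα0
    gcongr
  have h4 : q₀ ^ 2 * (X - σ) / (a + 2 * σ) = q₀ ^ 2 * ((X - σ) / (a + 2 * σ)) := by ring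
  rw [h4]
  linarith

end Oscillation

end HairyBH

end

/-! ### The two cases of the theorem. -/

theorem mainTheorem4 (rp Λ α : ℝ) (hrp : 0 < rp) (hΛ : Λ < 0)
    (hα : -(9 / 4) < α) (hα0 : α < 0) :
    -- large charge case
    (∀ Mb ∈ Set.Ioo (HairyBH.massNeutral rp Λ) (HairyBH.massExtremal rp Λ),
      ∃ q₁ : ℝ, 0 < q₁ ∧ ∀ q₀ : ℝ, q₁ < |q₀| →
        (∃ Mc ∈ Set.Ioo (HairyBH.massNeutral rp Λ) Mb,
          HairyBH.IsLinearHairMass rp Λ α q₀ Mc) ∧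
        ∀ Mc ∈ Set.Ioo (HairyBH.massNeutral rp Λ) Mb,
          HairyBH.IsLinearHairMass rp Λ α q₀ Mc →
          ∃ δ₀ > 0, ∃ ε₀ > 0, ∃ C > 0,
            ∀ δ ∈ Set.Ioo (0 : ℝ) δ₀, ∀ ε ∈ Set.Ioo (0 : ℝ) ε₀,
              ∀ f ∈ HairyBH.ballX rp Λ α Mc δ,
                ∃ Mf ∈ Set.Ioo (HairyBH.massNeutral rp Λ) Mb,
                  HairyBH.IsPerturbedHairMass rp Λ α q₀ ε f Mf ∧
                  |Mf - Mc| ≤ C * HairyBH.normX rp Λ α Mc f ^ 2) ∧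
    -- fixed charge case
    (∀ q₀ R₀ : ℝ,
      α < -(3 / 2) + q₀ ^ 2 / (2 * HairyBH.adsConst Λ) →
      0 < R₀ → HairyBH.quadR0 Λ α q₀ R₀ = 0 →
      R₀ < HairyBH.adsConst Λ * rp ^ 2 →
        (∃ Mc ∈ Set.Ioo (HairyBH.massNeutral rp Λ) (HairyBH.massExtremal rp Λ),
          HairyBH.IsLinearHairMass rp Λ α q₀ Mc) ∧
        ∀ Mc ∈ Set.Ioo (HairyBH.massNeutral rp Λ) (HairyBH.massExtremal rp Λ),
          HairyBH.IsLinearHairMass rp Λ α q₀ Mc →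
          ∃ δ₀ > 0, ∃ ε₀ > 0, ∃ C > 0,
            ∀ δ ∈ Set.Ioo (0 : ℝ) δ₀, ∀ ε ∈ Set.Ioo (0 : ℝ) ε₀,
              ∀ f ∈ HairyBH.ballX rp Λ α Mc δ,
                ∃ Mf ∈ Set.Ioo (HairyBH.massNeutral rp Λ) (HairyBH.massExtremal rp Λ),
                  HairyBH.IsPerturbedHairMass rp Λ α q₀ ε f Mf ∧
                  |Mf - Mc| ≤ C * HairyBH.normX rp Λ α Mc f ^ 2) := by
  have hL : 0 < HairyBH.adsConst Λ := by rw [HairyBH.adsConst]; linarith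
  have hpert : ∀ q₀ Ms, Ms ≤ HairyBH.massExtremal rp Λ →
      ∀ Mc ∈ Set.Ioo (HairyBH.massNeutral rp Λ) Ms, HairyBH.IsLinearHairMass rp Λ α q₀ Mc →
      ∃ δ₀ > 0, ∃ ε₀ > 0, ∃ C > 0, ∀ δ ∈ Set.Ioo (0 : ℝ) δ₀, ∀ ε ∈ Set.Ioo (0 : ℝ) ε₀,
        ∀ f ∈ HairyBH.ballX rp Λ α Mc δ, ∃ Mf ∈ Set.Ioo (HairyBH.massNeutral rp Λ) Ms,
          HairyBH.IsPerturbedHairMass rp Λ α q₀ ε f Mf ∧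
          |Mf - Mc| ≤ C * HairyBH.normX rp Λ α Mc f ^ 2 := by
    intro q₀ Ms hMs Mc hMc hlin
    obtain ⟨δ₀, hδ₀, C, hC, H⟩ :=
      HairyBH.exists_perturbedHairMass hrp hΛ hα hα0 hMs hMc hlin
    -- No smallness of `ε` is needed: for `α < 0` the prescribed `κ⁻¹` is positive for every `ε`,
    -- and the Klein–Gordon equation is linear in `φ`, so `ε₀ = 1` will do.
    exact ⟨δ₀, hδ₀, 1, one_pos, C, hC, fun δ hδ ε _ f hf => H f hf.1 (hf.2.trans hδ.2) ε⟩
  refine ⟨fun Mb hMb => ?_, fun q₀ R₀ hq hR₀ hroot hR => ⟨?_, hpert q₀ _ le_rfl⟩⟩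
  -- The continuity method yields a hair mass in a half-closed interval; ending it at the midpoint
  -- keeps the mass strictly below `Mb`.
  · set M := (HairyBH.massNeutral rp Λ + Mb) / 2 with hM
    have hM1 : HairyBH.massNeutral rp Λ < M := by linarith [hMb.1]
    have hM2 : M < Mb := by linarith [hMb.1]
    have he := HairyBH.chargeRN_pos hrp hM1
    refine ⟨2 * (3 * rp + 27 * HairyBH.adsConst Λ * rp ^ 3) * Real.pi /
      (rp * HairyBH.chargeRN rp Λ M), by positivity, fun q₀ hq => ⟨?_, hpert q₀ Mb hMb.2.le⟩⟩
    obtain ⟨Mc, hMc, hlin⟩ := HairyBH.exists_linearHairMass (q₀ := q₀) hrp hΛ hα hα0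
      ⟨hM1, hM2.trans hMb.2⟩ fun c C hc hC h y hy =>
        HairyBH.not_pos_of_large_charge hrp hL hα0 hc hC (HairyBH.Del_pos hα) (HairyBH.Del_lt hα0)
          (HairyBH.eq_of_Del hα) he hq h hy
    exact ⟨Mc, ⟨hMc.1, hMc.2.trans_lt hM2⟩, hlin⟩
  · obtain ⟨e, he, hesq, hneg⟩ := HairyBH.exists_charge_not_pos hrp hL hα0
      (HairyBH.near_horizon_condition hrp hL (HairyBH.quadR0_neg hq hR₀ hroot hR))
    have hch : HairyBH.chargeRN rp Λ (HairyBH.massRN rp Λ e) = e :=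
      HairyBH.chargeRN_massRN hrp he.le
    have hge := HairyBH.massNeutral_le_massRN (Λ := Λ) (e := e) hrp
    have hgt : HairyBH.massNeutral rp Λ < HairyBH.massRN rp Λ e := by
      rw [HairyBH.massRN]
      have : 0 < e ^ 2 / (2 * rp) := by positivity
      linarith
    have hlt : HairyBH.massRN rp Λ e < HairyBH.massExtremal rp Λ := by
      rw [HairyBH.lt_massExtremal_iff hrp hge, hch]
      have : e ^ 2 / rp ^ 2 < 1 + 3 * (HairyBH.adsConst Λ * rp ^ 2) := by
        rw [div_lt_iff₀ (by positivity)]; linarith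
      linarith
    obtain ⟨Mc, hMc, hlin⟩ := HairyBH.exists_linearHairMass (q₀ := q₀) hrp hΛ hα hα0 ⟨hgt, hlt⟩
      fun c C hc hC h y hy => by
        rw [hch] at h hy
        exact hneg C c _ hc hC (HairyBH.Del_pos hα) (HairyBH.Del_lt hα0) (HairyBH.eq_of_Del hα) h
          y hy
    exact ⟨Mc, ⟨hMc.1, hMc.2.trans_lt hlt⟩, hlin⟩
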